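/- Let $H_0=\Delta^2$ be the bi-Laplacian on $L^2(\mathbb R^3)=L^2(\mathbb R^3;\mathbb C)$, with domain $H^4(\mathbb R^3)$, and let $\Sigma=\{\lambda\in\mathbb C:\operatorname{Re}\lambda>0,\ \operatorname{Im}\lambda>0\}$ be the open first quadrant. For every $\lambda\in\Sigma$ the operator $H_0-\lambda^4:H^4(\mathbb R^3)\to L^2(\mathbb R^3)$ has a bounded inverse $R_0(\lambda)=(H_0-\lambda^4)^{-1}$ on $L^2(\mathbb R^3)$, and $$\|R_0(\lambda)\|_{L^2(\mathbb R^3)\to L^2(\mathbb R^3)}\le\frac{1}{|\lambda|^2\,(\operatorname{Im}\lambda)\,(\operatorname{Re}\lambda)},\qquad \lambda\in\Sigma.$$ Moreover, $R_0(\lambda)$ extends from $\Sigma$ to an analytic family of linear operators $$R_0(\lambda):L^2_{\rm comp}(\mathbb R^3)\to L^2_{\rm loc}(\mathbb R^3),\qquad \lambda\in\mathbb C\setminus\{0\};$$ this means that for every $\rho\in C_0^\infty(\mathbb R^3)$ the operators $\rho R_0(\lambda)\rho$ are bounded on $L^2(\mathbb R^3)$ and depend analytically on $\lambda\in\mathbb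 C\setminus\{0\}$ in the operator norm. The extension has the following property. For every $R>0$ and every $\rho\in C_0^\infty(\mathbb R^3)$ with $\operatorname{supp}\rho\subset B_R=\{x:|x|\le R\}$ there is a constant $C>0$, depending only on $\rho$ and $R$, such that $$\|\rho R_0(\lambda)\rho\|_{L^2(B_R)\to H^j(B_R)}\le C\,|\lambda|^{-2}(1+|\lambda|^2)^{j/2}\left(e^{2R(\operatorname{Im}\lambda)_-}+e^{2R(\operatorname{Re}\lambda)_-}\right)$$ for all $\lambda\in\mathbb C\setminus\{0\}$ and $j=0,1,2,3,4$, where $t_-=\max\{-t,0\}$. -/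

import Mathlib

open MeasureTheory TopologicalSpace
open scoped ENNReal Distributions Laplacian ContDiff

noncomputable section

namespace Biharmonic

/-- The Euclidean space `ℝ³`. -/
abbrev E3 : Type := EuclideanSpace ℝ (Fin 3)

/-- The complex Hilbert space `L²(ℝ³)`. -/
abbrev L2 : Type := Lp ℂ 2 (volume : Measure E3)

/-! ### The self-adjoint operator `Δ²` with domain `H⁴(ℝ³)` and resolvents -/

theorem toTemperedDistribution_injective {f g : L2}
    (h : Lp.toTemperedDistribution f = Lp.toTemperedDistribution g) : f = g := by
  have hk := Lp.ker_toTemperedDistributionCLM_eq_bot (E := E3) (F := ℂ) (μ := volume) (p := 2)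
  exact LinearMap.ker_eq_bot.mp hk h

/-- The Sobolev space `H⁴(ℝ³)`, as a subspace of `L²(ℝ³)`. -/
def H4 : Submodule ℂ L2 where
  carrier := {f | TemperedDistribution.MemSobolev 4 2 (Lp.toTemperedDistribution f)}
  zero_mem' := by
    have h : Lp.toTemperedDistribution (0 : L2) = 0 :=
      map_zero (Lp.toTemperedDistributionCLM ℂ (volume : Measure E3) 2)
    simp [h]
  add_mem' := by
    intro f g hf hg
    have h : Lp.toTemperedDistribution (f + g)
        = Lp.toTemperedDistribution f + Lp.toTemperedDistribution g :=
      map_add (Lp.toTemperedDistributionCLM ℂ (volume : Measure E3) 2) f g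
    simpa only [Set.mem_ofPred_eq, h] using TemperedDistribution.MemSobolev.add hf hg
  smul_mem' := by
    intro c f hf
    have h : Lp.toTemperedDistribution (c • f) = c • Lp.toTemperedDistribution f :=
      map_smul (Lp.toTemperedDistributionCLM ℂ (volume : Measure E3) 2) c f
    simpa only [Set.mem_ofPred_eq, h] using TemperedDistribution.MemSobolev.smul c hf

theorem exists_biLaplacian (f : H4) : ∃ g : L2,
    Lp.toTemperedDistribution g = Δ (Δ (Lp.toTemperedDistribution (f : L2))) := by
  have h := (TemperedDistribution.MemSobolev.laplacian
    (TemperedDistribution.MemSobolev.laplacian f.2))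
  have h0 : (4 : ℝ) - 2 - 2 = 0 := by norm_num
  rw [h0, TemperedDistribution.memSobolev_zero_iff] at h
  obtain ⟨g, hg⟩ := h
  exact ⟨g, hg.symm⟩

/-- The operator `H₀ = Δ²` on `L²(ℝ³)`, unbounded, with domain `H⁴(ℝ³)`;
`H₀ f` is the distributional bi-Laplacian of `f`. -/
def H0 : L2 →ₗ.[ℂ] L2 where
  domain := H4
  toFun :=
    { toFun := fun f => (exists_biLaplacian f).choose
      map_add' := by
        intro f g
        apply toTemperedDistribution_injective
        have h1 : ∀ a b : L2, Lp.toTemperedDistribution (a + b)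
            = Lp.toTemperedDistribution a + Lp.toTemperedDistribution b :=
          map_add (Lp.toTemperedDistributionCLM ℂ (volume : Measure E3) 2)
        rw [(exists_biLaplacian (f + g)).choose_spec, h1,
          (exists_biLaplacian f).choose_spec, (exists_biLaplacian g).choose_spec]
        simp only [Submodule.coe_add, h1, ← TemperedDistribution.laplacianCLM_apply, map_add]
      map_smul' := by
        intro c f
        apply toTemperedDistribution_injective
        have h1 : ∀ a : L2, Lp.toTemperedDistribution (c • a)
            = c • Lp.toTemperedDistribution a :=
          map_smul (Lp.toTemperedDistributionCLM ℂ (volume : Measure E3) 2) c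
        rw [(exists_biLaplacian (c • f)).choose_spec, RingHom.id_apply, h1,
          (exists_biLaplacian f).choose_spec]
        simp only [Submodule.coe_smul, h1, ← TemperedDistribution.laplacianCLM_apply, map_smul] }

theorem H0_spec (f : H0.domain) :
    Lp.toTemperedDistribution (H0 f) = Δ (Δ (Lp.toTemperedDistribution (f : L2))) :=
  (exists_biLaplacian f).choose_spec

/-- `R = (H - w)⁻¹`: the bounded operator `R` is the two-sided inverse of
`H - w : dom H → L²(ℝ³)`. -/
structure IsResolvent (H : L2 →ₗ.[ℂ] L2) (w : ℂ) (R : L2 →L[ℂ] L2) : Prop where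
  right_inv : ∀ f : L2, ∃ h : R f ∈ H.domain, H ⟨R f, h⟩ - w • R f = f
  left_inv : ∀ u : H.domain, R (H u - w • (u : L2)) = u

/-- The open first quadrant. -/
def quadrant : Set ℂ := {z | 0 < z.re ∧ 0 < z.im}

/-! ### Operators from `L²_comp` to `L²_loc` -/

/-- `L²_comp(ℝ³)`: the `L²` functions vanishing almost everywhere off some compact set. -/
def L2comp : Submodule ℂ L2 where
  carrier := {f | ∃ K : Set E3, IsCompact K ∧ ∀ᵐ x ∂volume, x ∉ K → f x = 0}
  zero_mem' := by
    refine ⟨∅, isCompact_empty, ?_⟩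
    filter_upwards [Lp.coeFn_zero ℂ 2 (volume : Measure E3)] with x hx _
    simp
  add_mem' := by
    rintro f g ⟨K, hK, hf⟩ ⟨L, hL, hg⟩
    refine ⟨K ∪ L, hK.union hL, ?_⟩
    filter_upwards [hf, hg, Lp.coeFn_add f g] with x h1 h2 h3 hx
    rw [h3, Pi.add_apply, h1 fun h => hx (Or.inl h), h2 fun h => hx (Or.inr h), add_zero]
  smul_mem' := by
    rintro c f ⟨K, hK, hf⟩
    refine ⟨K, hK, ?_⟩
    filter_upwards [hf, Lp.coeFn_smul c f] with x h1 h2 hx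
    rw [h2, Pi.smul_apply, h1 hx, smul_zero]

/-- `L²_loc(ℝ³)`: the classes of measurable functions, up to equality almost everywhere, that are
square-integrable on every compact set. -/
def L2loc : Submodule ℂ (E3 →ₘ[volume] ℂ) where
  carrier := {u | ∀ K : Set E3, IsCompact K → MemLp u 2 (volume.restrict K)}
  zero_mem' := by
    intro K _
    exact (memLp_congr_ae (ae_restrict_of_ae AEEqFun.coeFn_zero)).2 MemLp.zero
  add_mem' := by
    intro u v hu hv K hK
    exact (memLp_congr_ae (ae_restrict_of_ae (AEEqFun.coeFn_add u v))).2 ((hu K hK).add (hv K hK))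
  smul_mem' := by
    intro c u hu K hK
    exact (memLp_congr_ae (ae_restrict_of_ae (AEEqFun.coeFn_smul c u))).2
      ((hu K hK).const_smul c)

theorem memLp_cutoff (ρ : 𝓓((⊤ : Opens E3), ℂ)) {u : E3 → ℂ}
    (hu : ∀ K : Set E3, IsCompact K → MemLp u 2 (volume.restrict K)) :
    MemLp (fun x => ρ x * u x) 2 volume := by
  have hK : IsCompact (tsupport ρ) := ρ.hasCompactSupport
  have hm : MeasurableSet (tsupport ρ) := (isClosed_tsupport _).measurableSet
  obtain ⟨C, hC⟩ := ρ.continuous.bounded_above_of_compact_support ρ.hasCompactSupport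
  have h1 : MemLp (fun x => ρ x * u x) 2 (volume.restrict (tsupport ρ)) := by
    refine (hu _ hK).of_le_mul (c := C)
      (ρ.continuous.aestronglyMeasurable.mul (hu _ hK).aestronglyMeasurable) ?_
    filter_upwards with x
    rw [norm_mul]
    exact mul_le_mul_of_nonneg_right (hC x) (norm_nonneg _)
  rw [← memLp_indicator_iff_restrict hm] at h1
  have h2 : (tsupport ρ).indicator (fun x => ρ x * u x) = fun x => ρ x * u x := by
    funext x
    by_cases hx : x ∈ tsupport ρ
    · rw [Set.indicator_of_mem hx]
    · rw [Set.indicator_of_notMem hx, image_eq_zero_of_notMem_tsupport hx, zero_mul]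
  rwa [h2] at h1

/-- Multiplication by a test function, `u ↦ ρ u`, from `L²_loc(ℝ³)` to `L²(ℝ³)`. -/
def mulLoc (ρ : 𝓓((⊤ : Opens E3), ℂ)) : L2loc →ₗ[ℂ] L2 where
  toFun u := (memLp_cutoff ρ u.2).toLp
  map_add' := by
    intro u v
    rw [← MemLp.toLp_add]
    apply MemLp.toLp_congr
    filter_upwards [AEEqFun.coeFn_add (u : E3 →ₘ[volume] ℂ) v] with x hx
    simp only [Submodule.coe_add, hx, Pi.add_apply, mul_add]
  map_smul' := by
    intro c u
    rw [RingHom.id_apply, ← MemLp.toLp_const_smul]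
    apply MemLp.toLp_congr
    filter_upwards [AEEqFun.coeFn_smul c (u : E3 →ₘ[volume] ℂ)] with x hx
    simp only [Submodule.coe_smul, hx, Pi.smul_apply, smul_eq_mul]
    ring

theorem memLp_cutoff_L2 (ρ : 𝓓((⊤ : Opens E3), ℂ)) (f : L2) :
    MemLp (fun x => ρ x * f x) 2 volume :=
  memLp_cutoff ρ fun _ _ => (Lp.memLp f).restrict _

/-- Multiplication by a test function, `f ↦ ρ f`, from `L²(ℝ³)` to `L²_comp(ℝ³)`. -/
def mulComp (ρ : 𝓓((⊤ : Opens E3), ℂ)) : L2 →ₗ[ℂ] L2comp where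
  toFun f := ⟨(memLp_cutoff_L2 ρ f).toLp, by
    refine ⟨tsupport ρ, ρ.hasCompactSupport, ?_⟩
    filter_upwards [(memLp_cutoff_L2 ρ f).coeFn_toLp] with x hx hxK
    rw [hx, image_eq_zero_of_notMem_tsupport hxK, zero_mul]⟩
  map_add' := by
    intro f g
    apply Subtype.ext
    rw [Submodule.coe_add, ← MemLp.toLp_add]
    refine MemLp.toLp_congr (memLp_cutoff_L2 ρ (f + g))
      ((memLp_cutoff_L2 ρ f).add (memLp_cutoff_L2 ρ g)) ?_
    filter_upwards [Lp.coeFn_add f g] with x hx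
    simp only [hx, Pi.add_apply, mul_add]
  map_smul' := by
    intro c f
    apply Subtype.ext
    rw [RingHom.id_apply, Submodule.coe_smul, ← MemLp.toLp_const_smul]
    refine MemLp.toLp_congr (memLp_cutoff_L2 ρ (c • f))
      ((memLp_cutoff_L2 ρ f).const_smul c) ?_
    filter_upwards [Lp.coeFn_smul c f] with x hx
    simp only [hx, Pi.smul_apply, smul_eq_mul]
    ring

/-- The cut-off operator `ρ T ρ` on `L²(ℝ³)`, for `T : L²_comp(ℝ³) → L²_loc(ℝ³)`. -/
def cutoff (ρ : 𝓓((⊤ : Opens E3), ℂ)) (T : L2comp →ₗ[ℂ] L2loc) : L2 →ₗ[ℂ] L2 :=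
  mulLoc ρ ∘ₗ T ∘ₗ mulComp ρ

/-- `T` is an analytic family on `U` of operators `L²_comp(ℝ³) → L²_loc(ℝ³)`: for every
test function `ρ`, the operators `ρ T(z) ρ`, `z ∈ U`, are bounded on `L²(ℝ³)` and depend
analytically on `z` in the operator norm. -/
def IsAnalyticFamily (T : ℂ → L2comp →ₗ[ℂ] L2loc) (U : Set ℂ) : Prop :=
  ∀ ρ : 𝓓((⊤ : Opens E3), ℂ), ∃ A : ℂ → L2 →L[ℂ] L2,
    (∀ z ∈ U, (A z : L2 →ₗ[ℂ] L2) = cutoff ρ (T z)) ∧ AnalyticOnNhd ℂ A U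

/-! ### Sobolev norms of integer order on an open set -/

/-- `g` is the weak derivative `∂_{i 0} ⋯ ∂_{i (m-1)} u` of order `m` on the open set `Ω`. -/
def IsWeakDeriv (Ω : Opens E3) {m : ℕ} (i : Fin m → Fin 3) (u g : E3 → ℂ) : Prop :=
  LocallyIntegrableOn u Ω volume ∧ LocallyIntegrableOn g Ω volume ∧
    ∀ φ : 𝓓(Ω, ℂ),
      ∫ x in Ω, u x * iteratedFDeriv ℝ m φ x (fun k => EuclideanSpace.single (i k) (1 : ℝ))
        = (-1) ^ m * ∫ x in Ω, g x * φ x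

/-- The `L²(Ω)` norm of the weak derivative `∂_{i 0} ⋯ ∂_{i (m-1)} u`; it is `∞` if this
derivative does not exist. (Weak derivatives are unique almost everywhere.) -/
def weakDerivENorm (Ω : Opens E3) {m : ℕ} (i : Fin m → Fin 3) (u : E3 → ℂ) : ℝ≥0∞ :=
  ⨅ (g : E3 → ℂ) (_ : IsWeakDeriv Ω i u g), eLpNorm g 2 (volume.restrict Ω)

/-- The norm `(∑_{m ≤ j} ‖Dᵐ u‖²_{L²(Ω)})^{1/2}` of `H^j(Ω)`, where `|Dᵐ u|²` is the sum of
`|∂_{i 0} ⋯ ∂_{i (m-1)} u|²` over all `i`; it is finite exactly for `u ∈ H^j(Ω)`. -/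
def sobolevENorm (Ω : Opens E3) (j : ℕ) (u : E3 → ℂ) : ℝ≥0∞ :=
  (∑ m ∈ Finset.range (j + 1), ∑ i : Fin m → Fin 3, weakDerivENorm Ω i u ^ 2) ^ (1 / 2 : ℝ)

/-- The open ball of radius `R` about the origin. -/
def openBall (R : ℝ) : Opens E3 := ⟨Metric.ball 0 R, Metric.isOpen_ball⟩

end Biharmonic

end

open Biharmonic

noncomputable section

namespace Biharmonic

/-! ### Partial derivatives on `ℝ³` -/

/-- The standard basis vectors of `ℝ³`. -/
abbrev e3 (i : Fin 3) : E3 := EuclideanSpace.single i (1 : ℝ)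

/-- The partial derivative `∂ᵢ f`. -/
def pd (i : Fin 3) (f : E3 → ℂ) : E3 → ℂ := fun x => fderiv ℝ f x (e3 i)

/-- The classical Laplacian `∑ᵢ ∂ᵢ ∂ᵢ f`. -/
def lap (f : E3 → ℂ) : E3 → ℂ := fun x => ∑ i, pd i (pd i f) x

theorem contDiff_pd_nat {n : ℕ} {f : E3 → ℂ} (hf : ContDiff ℝ (n + 1 : ℕ) f) (i : Fin 3) :
    ContDiff ℝ n (pd i f) :=
  (hf.fderiv_right (m := n) (by norm_cast)).clm_apply contDiff_const

theorem contDiff_pd {f : E3 → ℂ} (hf : ContDiff ℝ ∞ f) (i : Fin 3) : ContDiff ℝ ∞ (pd i f) :=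
  (hf.fderiv_right (m := ∞) (by norm_cast)).clm_apply contDiff_const

theorem contDiff_lap {f : E3 → ℂ} (hf : ContDiff ℝ ∞ f) : ContDiff ℝ ∞ (lap f) := by
  unfold lap
  exact ContDiff.sum fun i _ => contDiff_pd (contDiff_pd hf i) i

theorem pd_add {f g : E3 → ℂ} (hf : Differentiable ℝ f) (hg : Differentiable ℝ g) (i : Fin 3) :
    pd i (f + g) = pd i f + pd i g := by
  funext x
  simp [pd, fderiv_add (hf x) (hg x)]

theorem pd_const_smul {f : E3 → ℂ} (hf : Differentiable ℝ f) (c : ℂ) (i : Fin 3) :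
    pd i (c • f) = c • pd i f := by
  funext x
  simp [pd, fderiv_const_smul (hf x) c]

theorem pd_mul {f g : E3 → ℂ} (hf : Differentiable ℝ f) (hg : Differentiable ℝ g) (i : Fin 3) :
    pd i (f * g) = pd i f * g + f * pd i g := by
  funext x
  simp [pd, fderiv_mul (hf x) (hg x)]
  ring

theorem pd_sum {ι : Type*} (s : Finset ι) {f : ι → E3 → ℂ}
    (hf : ∀ k ∈ s, Differentiable ℝ (f k)) (i : Fin 3) :
    pd i (∑ k ∈ s, f k) = ∑ k ∈ s, pd i (f k) := by
  funext x
  simp [pd, fderiv_sum (fun k hk => (hf k hk) x)]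

theorem pd_star {f : E3 → ℂ} (i : Fin 3) :
    pd i (star f) = star (pd i f) := by
  funext x
  have h : (star f : E3 → ℂ) = Complex.conjCLE ∘ f := rfl
  simp only [pd, h, Complex.conjCLE.comp_fderiv]
  rfl

theorem pd_comm {f : E3 → ℂ} (hf : ContDiff ℝ ∞ f) (i j : Fin 3) :
    pd i (pd j f) = pd j (pd i f) := by
  funext x
  have hd : DifferentiableAt ℝ (fderiv ℝ f) x :=
    (hf.fderiv_right (m := ∞) (by norm_cast)).differentiable (by simp) x
  have hs : IsSymmSndFDerivAt ℝ f x :=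
    ((contDiff_infty.1 hf 2).contDiffAt (x := x)).isSymmSndFDerivAt (by simp)
  have key : ∀ k l : Fin 3, pd k (pd l f) x = fderiv ℝ (fderiv ℝ f) x (e3 k) (e3 l) := by
    intro k l
    change fderiv ℝ (fun y => fderiv ℝ f y (e3 l)) x (e3 k) = _
    rw [fderiv_clm_apply hd (differentiableAt_const _)]
    simp
  rw [key, key]
  exact hs _ _

theorem lap_pd {f : E3 → ℂ} (hf : ContDiff ℝ ∞ f) (j : Fin 3) :
    lap (pd j f) = pd j (lap f) := by
  have h : lap f = ∑ i, pd i (pd i f) := by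
    funext x; simp [lap]
  rw [h, pd_sum]
  · funext x
    simp only [lap, Finset.sum_apply]
    refine Finset.sum_congr rfl fun i _ => ?_
    rw [pd_comm hf i j, pd_comm (contDiff_pd hf i) i j]
  · intro i _
    exact (contDiff_pd (contDiff_pd hf i) i).differentiable (by simp)

theorem lap_const_smul {f : E3 → ℂ} (hf : ContDiff ℝ ∞ f) (c : ℂ) :
    lap (c • f) = c • lap f := by
  funext x
  simp only [lap, Pi.smul_apply, Finset.smul_sum]
  refine Finset.sum_congr rfl fun i _ => ?_
  rw [pd_const_smul (hf.differentiable (by simp)),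
    pd_const_smul ((contDiff_pd hf i).differentiable (by simp))]
  rfl

theorem lap_add {f g : E3 → ℂ} (hf : ContDiff ℝ ∞ f) (hg : ContDiff ℝ ∞ g) :
    lap (f + g) = lap f + lap g := by
  funext x
  simp only [lap, Pi.add_apply, ← Finset.sum_add_distrib]
  refine Finset.sum_congr rfl fun i _ => ?_
  rw [pd_add (hf.differentiable (by simp)) (hg.differentiable (by simp)),
    pd_add ((contDiff_pd hf i).differentiable (by simp))
      ((contDiff_pd hg i).differentiable (by simp))]
  rfl

theorem pd_comp_const_sub (g : E3 → ℂ) (a : E3) (i : Fin 3) :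
    pd i (fun t => g (a - t)) = -fun t => pd i g (a - t) := by
  funext x
  have h : (fun t => g (a - t)) = fun t => (fun u => g (a + u)) (-t) := by
    funext t; simp [sub_eq_add_neg]
  have h2 : (fun t => (fun u => g (a + u)) (-t))
      = (fun u => g (a + u)) ∘ (ContinuousLinearEquiv.neg ℝ : E3 ≃L[ℝ] E3) := rfl
  simp only [pd, h]
  rw [h2, ContinuousLinearEquiv.comp_right_fderiv, fderiv_comp_add_left]
  simp [sub_eq_add_neg]

theorem pd_neg (g : E3 → ℂ) (i : Fin 3) : pd i (-g) = -pd i g := by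
  funext x
  simp [pd, fderiv_neg]

theorem lap_comp_const_sub (g : E3 → ℂ) (a : E3) :
    lap (fun t => g (a - t)) = fun t => lap g (a - t) := by
  funext x
  simp only [lap]
  refine Finset.sum_congr rfl fun i _ => ?_
  rw [pd_comp_const_sub, pd_neg, pd_comp_const_sub]
  simp

theorem tsupport_pd_subset (f : E3 → ℂ) (i : Fin 3) : tsupport (pd i f) ⊆ tsupport f := by
  refine closure_minimal ?_ (isClosed_tsupport _)
  intro x hx
  by_contra h
  exact hx (by simp [pd, fderiv_of_notMem_tsupport (𝕜 := ℝ) h])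

theorem hasCompactSupport_pd {f : E3 → ℂ} (hf : HasCompactSupport f) (i : Fin 3) :
    HasCompactSupport (pd i f) :=
  hf.of_isClosed_subset (isClosed_tsupport _) (tsupport_pd_subset f i)

/-- Integration by parts, the first factor having compact support. -/
theorem integral_mul_pd {f g : E3 → ℂ} (hf : ContDiff ℝ ∞ f) (hg : ContDiff ℝ ∞ g)
    (hc : HasCompactSupport f) (i : Fin 3) :
    ∫ x, f x * pd i g x = -∫ x, pd i f x * g x := by
  have hc' := hasCompactSupport_pd hc i
  refine integral_mul_fderiv_eq_neg_fderiv_mul_of_integrable (v := e3 i) ?_ ?_ ?_ ?_ ?_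
  · exact ((contDiff_pd hf i).continuous.mul hg.continuous).integrable_of_hasCompactSupport
      (hc'.mul_right)
  · exact (hf.continuous.mul (contDiff_pd hg i).continuous).integrable_of_hasCompactSupport
      (hc.mul_right)
  · exact (hf.continuous.mul hg.continuous).integrable_of_hasCompactSupport (hc.mul_right)
  · exact fun x _ => hf.differentiable (by simp) x
  · exact fun x _ => hg.differentiable (by simp) x

/-- The iterated partial derivative `∂_{l₀} ∂_{l₁} ⋯ f`. -/
def pdl : List (Fin 3) → (E3 → ℂ) → E3 → ℂ
  | [], f => f
  | i :: l, f => pd i (pdl l f)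

theorem contDiff_pdl {f : E3 → ℂ} (hf : ContDiff ℝ ∞ f) : ∀ l, ContDiff ℝ ∞ (pdl l f)
  | [] => hf
  | i :: l => contDiff_pd (contDiff_pdl hf l) i

theorem tsupport_pdl_subset (f : E3 → ℂ) : ∀ l, tsupport (pdl l f) ⊆ tsupport f
  | [] => subset_rfl
  | i :: l => (tsupport_pd_subset _ i).trans (tsupport_pdl_subset f l)

theorem hasCompactSupport_pdl {f : E3 → ℂ} (hf : HasCompactSupport f) (l : List (Fin 3)) :
    HasCompactSupport (pdl l f) :=
  hf.of_isClosed_subset (isClosed_tsupport _) (tsupport_pdl_subset f l)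

theorem pdl_append (l l' : List (Fin 3)) (f : E3 → ℂ) : pdl (l ++ l') f = pdl l (pdl l' f) := by
  induction l with
  | nil => rfl
  | cons i l ih => simp [pdl, ih]

theorem iteratedFDeriv_eq_pdl {f : E3 → ℂ} (hf : ContDiff ℝ ∞ f) :
    ∀ {m : ℕ} (i : Fin m → Fin 3) (x : E3),
      iteratedFDeriv ℝ m f x (fun k => e3 (i k)) = pdl (List.ofFn i) f x := by
  intro m
  induction m with
  | zero => intro i x; simp [pdl]
  | succ m ih =>
    intro i x
    rw [iteratedFDeriv_succ_apply_left, List.ofFn_succ]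
    have hd : DifferentiableAt ℝ (iteratedFDeriv ℝ m f) x :=
      hf.differentiable_iteratedFDeriv (by exact_mod_cast ENat.natCast_lt_top m) x
    have h : pdl (List.ofFn fun k : Fin m => i k.succ) f
        = fun y => iteratedFDeriv ℝ m f y (fun k => e3 (i k.succ)) := by
      funext y
      exact (ih (fun k => i k.succ) y).symm
    simp only [pdl, h, pd]
    rw [fderiv_continuousMultilinear_apply_const_apply hd]
    rfl

theorem integral_mul_pdl {f g : E3 → ℂ} (hf : ContDiff ℝ ∞ f) (hg : ContDiff ℝ ∞ g)
    (hc : HasCompactSupport f) (l : List (Fin 3)) :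
    ∫ x, f x * pdl l g x = (-1) ^ l.length * ∫ x, pdl l.reverse f x * g x := by
  induction l generalizing f with
  | nil => simp [pdl]
  | cons i l ih =>
    simp only [pdl, List.reverse_cons, List.length_cons]
    rw [integral_mul_pd hf (contDiff_pdl hg l) hc, ih (contDiff_pd hf i)
      (hasCompactSupport_pd hc i), pdl_append, pow_succ]
    simp [pdl]

/-! ### The `L²` norm of functions -/

/-- The `L²(ℝ³)` norm of a function. -/
def nrm (f : E3 → ℂ) : ℝ := (eLpNorm f 2 volume).toReal

theorem nrm_nonneg (f : E3 → ℂ) : 0 ≤ nrm f := ENNReal.toReal_nonneg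

theorem nrm_add_le {f g : E3 → ℂ} (hf : MemLp f 2 volume) (hg : MemLp g 2 volume) :
    nrm (f + g) ≤ nrm f + nrm g := by
  unfold nrm
  rw [← ENNReal.toReal_add hf.2.ne hg.2.ne]
  exact ENNReal.toReal_mono (by simp [hf.2.ne, hg.2.ne])
    (eLpNorm_add_le hf.1 hg.1 (by norm_num))

theorem nrm_const_smul (c : ℂ) (f : E3 → ℂ) : nrm (c • f) = ‖c‖ * nrm f := by
  simp [nrm, eLpNorm_const_smul, ENNReal.toReal_mul]

theorem nrm_mono {f g : E3 → ℂ} (hg : MemLp g 2 volume) (h : ∀ x, ‖f x‖ ≤ ‖g x‖) :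
    nrm f ≤ nrm g :=
  ENNReal.toReal_mono hg.2.ne (eLpNorm_mono h)

theorem nrm_star (f : E3 → ℂ) : nrm (star f) = nrm f := by
  unfold nrm
  congr 1
  exact eLpNorm_congr_norm_ae (by filter_upwards with x; simp)

theorem memLp_of_hasCompactSupport {f : E3 → ℂ} (hf : Continuous f) (hc : HasCompactSupport f) :
    MemLp f 2 volume :=
  hf.memLp_of_hasCompactSupport hc

theorem norm_toLp_eq_nrm {f : E3 → ℂ} (hf : MemLp f 2 volume) : ‖hf.toLp f‖ = nrm f :=
  Lp.norm_toLp f hf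

theorem norm_integral_mul_le {f g : E3 → ℂ} (hf : MemLp f 2 volume) (hg : MemLp g 2 volume) :
    ‖∫ x, f x * g x‖ ≤ nrm f * nrm g := by
  have hs : MemLp (star f) 2 volume := hf.star
  have h : ∫ x, f x * g x = inner ℂ (hs.toLp (star f)) (hg.toLp g) := by
    rw [L2.inner_def]
    apply integral_congr_ae
    filter_upwards [hs.coeFn_toLp, hg.coeFn_toLp] with x h1 h2
    simp [h1, h2, mul_comm]
  rw [h]
  refine (norm_inner_le_norm _ _).trans ?_
  rw [norm_toLp_eq_nrm, norm_toLp_eq_nrm, nrm_star]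

theorem integral_star_mul_self {f : E3 → ℂ} (hf : MemLp f 2 volume) :
    ∫ x, star (f x) * f x = ((nrm f ^ 2 : ℝ) : ℂ) := by
  have h : ∫ x, star (f x) * f x = inner ℂ (hf.toLp f) (hf.toLp f) := by
    rw [L2.inner_def]
    apply integral_congr_ae
    filter_upwards [hf.coeFn_toLp] with x h1
    simp only [h1, RCLike.inner_apply, mul_comm]
    rfl
  rw [h, inner_self_eq_norm_sq_to_K, norm_toLp_eq_nrm]
  simp

/-! ### The fundamental solution of `κ² - Δ` -/

/-- The Yukawa kernel `e^{-κ|y|} / (4π|y|)`. -/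
def yukawa (κ : ℂ) (y : E3) : ℂ := Complex.exp (-κ * ‖y‖) / (4 * Real.pi * ‖y‖)

/-- The function `h` times `e^{-κ|y|}` decays like `|y|⁻⁴`. -/
def Tame (κ : ℂ) (h : E3 → ℂ) : Prop :=
  ∃ C : ℝ, ∀ y, Real.exp (-κ.re * ‖y‖) * ‖h y‖ ≤ C * (1 + ‖y‖) ^ (-4 : ℝ)

theorem Tame.add {κ : ℂ} {f g : E3 → ℂ} (hf : Tame κ f) (hg : Tame κ g) : Tame κ (f + g) := by
  obtain ⟨C, hC⟩ := hf
  obtain ⟨D, hD⟩ := hg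
  refine ⟨C + D, fun y => ?_⟩
  calc _ ≤ Real.exp (-κ.re * ‖y‖) * (‖f y‖ + ‖g y‖) := by gcongr; exact norm_add_le _ _
    _ ≤ _ := by rw [mul_add, add_mul]; exact add_le_add (hC y) (hD y)

theorem Tame.const_smul {κ : ℂ} {f : E3 → ℂ} (hf : Tame κ f) (c : ℂ) : Tame κ (c • f) := by
  obtain ⟨C, hC⟩ := hf
  refine ⟨‖c‖ * C, fun y => ?_⟩
  simp only [Pi.smul_apply, norm_smul]
  nlinarith [mul_le_mul_of_nonneg_left (hC y) (norm_nonneg c)]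

theorem Tame.lap {κ : ℂ} {g : E3 → ℂ} (h2 : ∀ i, Tame κ (pd i (pd i g))) : Tame κ (lap g) := by
  have h : Biharmonic.lap g = pd 0 (pd 0 g) + pd 1 (pd 1 g) + pd 2 (pd 2 g) := by
    funext x; simp [Biharmonic.lap, Fin.sum_univ_three]
  rw [h]
  exact ((h2 0).add (h2 1)).add (h2 2)

/-- The regularised distance `(|y|² + ε²)^{1/2}` to the origin. -/
def regNorm (ε : ℝ) (y : E3) : ℝ := √(‖y‖ ^ 2 + ε ^ 2)

theorem continuous_regNorm (ε : ℝ) : Continuous (regNorm ε) := by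
  unfold regNorm; fun_prop

theorem regNorm_sq (ε : ℝ) (y : E3) : regNorm ε y ^ 2 = ‖y‖ ^ 2 + ε ^ 2 :=
  Real.sq_sqrt (by positivity)

theorem le_regNorm {ε : ℝ} (y : E3) : ε ≤ regNorm ε y :=
  Real.le_sqrt_of_sq_le (by nlinarith [norm_nonneg y])

theorem norm_le_regNorm {ε : ℝ} (y : E3) : ‖y‖ ≤ regNorm ε y :=
  Real.le_sqrt_of_sq_le (by nlinarith [norm_nonneg y])

theorem regNorm_pos {ε : ℝ} (hε : 0 < ε) (y : E3) : 0 < regNorm ε y :=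
  hε.trans_le (le_regNorm y)

theorem regNorm_le {ε : ℝ} (hε : 0 ≤ ε) (y : E3) : regNorm ε y ≤ ‖y‖ + ε :=
  Real.sqrt_le_iff.2 ⟨by positivity, by nlinarith [norm_nonneg y]⟩

theorem hasLineDerivAt_regNorm {ε : ℝ} (hε : 0 < ε) (y : E3) (i : Fin 3) :
    HasLineDerivAt ℝ (regNorm ε) (y i / regNorm ε y) y (e3 i) := by
  have h1 : ∀ t : ℝ, ‖y + t • e3 i‖ ^ 2 = ‖y‖ ^ 2 + 2 * t * y i + t ^ 2 := by
    intro t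
    rw [norm_add_sq_real, inner_smul_right, norm_smul]
    simp [e3, EuclideanSpace.inner_single_right]
    ring
  have h2 : HasDerivAt (fun t : ℝ => ‖y‖ ^ 2 + 2 * t * y i + t ^ 2 + ε ^ 2) (2 * y i) 0 := by
    have := ((((hasDerivAt_id (0 : ℝ)).const_mul 2).mul_const (y i)).const_add (‖y‖ ^ 2)).add
      ((hasDerivAt_id (0 : ℝ)).pow 2)
    have := this.add_const (ε ^ 2)
    simpa using this
  have h3 := h2.sqrt (by simp; positivity)
  have h4 : (fun t : ℝ => regNorm ε (y + t • e3 i))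
      = fun t => √(‖y‖ ^ 2 + 2 * t * y i + t ^ 2 + ε ^ 2) := by
    funext t
    simp only [regNorm, h1]
  have h5 : y i / regNorm ε y
      = 2 * y i / (2 * √(‖y‖ ^ 2 + 2 * 0 * y i + 0 ^ 2 + ε ^ 2)) := by
    simp only [regNorm, mul_zero, zero_mul, add_zero, ne_eq, OfNat.ofNat_ne_zero,
      not_false_eq_true, zero_pow]
    rw [mul_div_mul_left _ _ two_ne_zero]
  unfold HasLineDerivAt
  rw [h4, h5]
  exact h3

theorem hasLineDerivAt_comp_regNorm {ε : ℝ} (hε : 0 < ε) {Φ : ℝ → ℂ} {Φ' : ℂ} (y : E3) (i : Fin 3)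
    (h : HasDerivAt Φ Φ' (regNorm ε y)) :
    HasLineDerivAt ℝ (fun y => Φ (regNorm ε y)) ((y i / regNorm ε y : ℝ) * Φ') y (e3 i) := by
  have h0 : regNorm ε (y + (0 : ℝ) • e3 i) = regNorm ε y := by simp
  have := HasDerivAt.scomp (0 : ℝ) (h := fun t : ℝ => regNorm ε (y + t • e3 i)) (g₁ := Φ)
    (by simpa [h0] using h) (hasLineDerivAt_regNorm hε y i)
  simpa [HasLineDerivAt, Function.comp_def] using this

theorem exp_regNorm_le {ε : ℝ} (hε : 0 ≤ ε) (hε1 : ε ≤ 1) (κ : ℂ) (y : E3) :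
    ‖Complex.exp (-κ * regNorm ε y)‖ ≤ Real.exp ‖κ‖ * Real.exp (-κ.re * ‖y‖) := by
  rw [Complex.norm_exp, ← Real.exp_add]
  apply Real.exp_le_exp.2
  have h1 := norm_le_regNorm (ε := ε) y
  have h2 := regNorm_le hε y
  have h3 := Complex.abs_re_le_norm κ
  have h4 : |κ.re * (regNorm ε y - ‖y‖)| ≤ ‖κ‖ * 1 := by
    rw [abs_mul, abs_of_nonneg (sub_nonneg.2 h1)]
    exact mul_le_mul h3 (by linarith) (by linarith) (norm_nonneg _)
  have h5 := neg_abs_le (κ.re * (regNorm ε y - ‖y‖))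
  simp
  nlinarith

theorem integrable_regNorm_mul {ε : ℝ} (hε : 0 < ε) (hε1 : ε ≤ 1) {κ : ℂ} {h b : E3 → ℂ}
    (hh : Continuous h) (ht : Tame κ h) (hb : Continuous b) {B : ℝ} (hB : ∀ y, ‖b y‖ ≤ B) :
    Integrable fun y => b y * Complex.exp (-κ * regNorm ε y) * h y := by
  obtain ⟨C, hC⟩ := ht
  have hB0 : 0 ≤ B := (norm_nonneg _).trans (hB 0)
  have hi : Integrable fun y : E3 => B * Real.exp ‖κ‖ * C * (1 + ‖y‖) ^ (-4 : ℝ) :=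
    (integrable_one_add_norm (by simp; norm_num)).const_mul _
  refine hi.mono' ?_ ?_
  · have := continuous_regNorm ε
    exact Continuous.aestronglyMeasurable (by fun_prop)
  · filter_upwards with y
    rw [norm_mul, norm_mul]
    calc _ ≤ B * (Real.exp ‖κ‖ * Real.exp (-κ.re * ‖y‖)) * ‖h y‖ := by
          gcongr
          · exact hB y
          · exact exp_regNorm_le hε.le hε1 κ y
      _ = B * Real.exp ‖κ‖ * (Real.exp (-κ.re * ‖y‖) * ‖h y‖) := by ring
      _ ≤ B * Real.exp ‖κ‖ * (C * (1 + ‖y‖) ^ (-4 : ℝ)) := mul_le_mul_of_nonneg_left (hC y) (by positivity)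
      _ = _ := by ring

theorem hasDerivAt_exp_neg_mul (κ : ℂ) (s : ℝ) :
    HasDerivAt (fun s : ℝ => Complex.exp (-κ * s)) (-κ * Complex.exp (-κ * s)) s := by
  have h : HasDerivAt (fun s : ℝ => -κ * (s : ℂ)) (-κ) s := by
    simpa using (Complex.ofRealCLM.hasDerivAt (x := s)).const_mul (-κ)
  simpa [mul_comm] using h.cexp

theorem hasDerivAt_exp_div (κ : ℂ) {s : ℝ} (hs : 0 < s) :
    HasDerivAt (fun s : ℝ => (s : ℂ)⁻¹ * Complex.exp (-κ * s))
      (-(κ / s + 1 / s ^ 2) * Complex.exp (-κ * s)) s := by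
  have hs' : (s : ℂ) ≠ 0 := by exact_mod_cast hs.ne'
  have h : HasDerivAt (fun s : ℝ => (s : ℂ)⁻¹) (-1 / (s : ℂ) ^ 2) s := by
    simpa using (Complex.ofRealCLM.hasDerivAt (x := s)).fun_inv hs'
  refine (h.mul (hasDerivAt_exp_neg_mul κ s)).congr_deriv ?_
  field_simp
  ring

theorem hasDerivAt_exp_div' (κ : ℂ) {s : ℝ} (hs : 0 < s) :
    HasDerivAt (fun s : ℝ => -(κ / s ^ 2 + 1 / (s : ℂ) ^ 3) * Complex.exp (-κ * s))
      ((κ ^ 2 / s ^ 2 + 3 * κ / s ^ 3 + 3 / s ^ 4) * Complex.exp (-κ * s)) s := by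
  have hs' : (s : ℂ) ≠ 0 := by exact_mod_cast hs.ne'
  have h1 : HasDerivAt (fun s : ℝ => (s : ℂ)) 1 s := by
    simpa using (hasDerivAt_id s).ofReal_comp
  have h2 := ((h1.fun_pow 2).fun_inv (by positivity)).const_mul κ
  have h3 := (h1.fun_pow 3).fun_inv (by positivity)
  refine (((h2.add h3).neg.mul (hasDerivAt_exp_neg_mul κ s)).congr_deriv ?_).congr_of_eventuallyEq
    ?_
  · simp
    field_simp
    ring
  · filter_upwards with t
    simp [div_eq_mul_inv]

open scoped BoundedContinuousFunction

theorem norm_ofReal_inv_regNorm_le {ε : ℝ} (hε : 0 < ε) (y : E3) :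
    ‖((regNorm ε y : ℂ))⁻¹‖ ≤ ε⁻¹ := by
  rw [norm_inv, Complex.norm_real, Real.norm_of_nonneg (regNorm_pos hε y).le]
  exact inv_anti₀ hε (le_regNorm y)

theorem continuous_inv_regNorm {ε : ℝ} (hε : 0 < ε) :
    Continuous fun y : E3 => ((regNorm ε y : ℂ))⁻¹ :=
  (Complex.continuous_ofReal.comp (continuous_regNorm ε)).inv₀ fun y =>
    Complex.ofReal_ne_zero.2 (regNorm_pos hε y).ne'

/-- The bounded function `(|y|² + ε²)^{-1/2}`. -/
def invReg {ε : ℝ} (hε : 0 < ε) : E3 →ᵇ ℂ :=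
  BoundedContinuousFunction.ofNormedAddCommGroup (fun y => ((regNorm ε y : ℂ))⁻¹)
    (continuous_inv_regNorm hε) ε⁻¹ (norm_ofReal_inv_regNorm_le hε)

/-- The bounded function `yᵢ (|y|² + ε²)^{-1/2}`. -/
def dirReg {ε : ℝ} (hε : 0 < ε) (i : Fin 3) : E3 →ᵇ ℂ :=
  BoundedContinuousFunction.ofNormedAddCommGroup (fun y => (y i : ℂ) * ((regNorm ε y : ℂ))⁻¹)
    ((by fun_prop : Continuous fun y : E3 => (y i : ℂ)).mul (continuous_inv_regNorm hε)) 1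
    (by
      intro y
      rw [norm_mul, norm_inv, Complex.norm_real, Complex.norm_real,
        Real.norm_of_nonneg (regNorm_pos hε y).le, ← div_eq_mul_inv, div_le_one (regNorm_pos hε y)]
      exact (PiLp.norm_apply_le y i).trans (norm_le_regNorm y))

theorem invReg_apply {ε : ℝ} (hε : 0 < ε) (y : E3) : invReg hε y = ((regNorm ε y : ℂ))⁻¹ := rfl

theorem dirReg_apply {ε : ℝ} (hε : 0 < ε) (i : Fin 3) (y : E3) :
    dirReg hε i y = (y i : ℂ) * ((regNorm ε y : ℂ))⁻¹ := rfl

theorem integrable_bcf_mul {ε : ℝ} (hε : 0 < ε) (hε1 : ε ≤ 1) {κ : ℂ} {h : E3 → ℂ}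
    (hh : Continuous h) (ht : Tame κ h) (b : E3 →ᵇ ℂ) :
    Integrable fun y => b y * Complex.exp (-κ * regNorm ε y) * h y :=
  integrable_regNorm_mul hε hε1 hh ht b.continuous b.norm_coe_le_norm

theorem integral_regNorm_pd_pd {ε : ℝ} (hε : 0 < ε) (hε1 : ε ≤ 1) {κ : ℂ} {g : E3 → ℂ}
    (hg : ContDiff ℝ 2 g) (h0 : Tame κ g) (i : Fin 3) (h1 : Tame κ (pd i g))
    (h2 : Tame κ (pd i (pd i g))) :
    let v : E3 → ℂ := fun y => (regNorm ε y : ℂ)⁻¹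
    ∫ y, v y * Complex.exp (-κ * regNorm ε y) * pd i (pd i g) y =
      ∫ y, (-(κ * v y ^ 2 + v y ^ 3) + (y i * v y) ^ 2 * (κ ^ 2 * v y + 3 * κ * v y ^ 2
        + 3 * v y ^ 3)) * Complex.exp (-κ * regNorm ε y) * g y := by
  intro v
  have c1 : ContDiff ℝ 1 (pd i g) := contDiff_pd_nat (n := 1) (by exact_mod_cast hg) i
  have c2 : Continuous (pd i (pd i g)) :=
    (contDiff_pd_nat (n := 0) (by exact_mod_cast c1) i).continuous
  have hgd : Differentiable ℝ g := hg.differentiable (by simp)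
  have hpd : Differentiable ℝ (pd i g) := c1.differentiable (by simp)
  set K : E3 → ℂ := fun y => v y * Complex.exp (-κ * regNorm ε y) with hK
  set P : E3 → ℂ := fun y => -(κ * (y i * v y) * v y + (y i * v y) * v y ^ 2)
    * Complex.exp (-κ * regNorm ε y) with hP
  set Q : E3 → ℂ := fun y => (-(κ * v y ^ 2 + v y ^ 3) + (y i * v y) ^ 2 *
    (κ ^ 2 * v y + 3 * κ * v y ^ 2 + 3 * v y ^ 3)) * Complex.exp (-κ * regNorm ε y) with hQ
  have dK : ∀ y, HasLineDerivAt ℝ K (P y) y (e3 i) := by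
    intro y
    have h := hasLineDerivAt_comp_regNorm hε y i (hasDerivAt_exp_div κ (regNorm_pos hε y))
    convert h using 1
    simp only [hP, v]
    push_cast
    field_simp
  have dP : ∀ y, HasLineDerivAt ℝ P (Q y) y (e3 i) := by
    intro y
    have h := hasLineDerivAt_comp_regNorm hε y i (hasDerivAt_exp_div' κ (regNorm_pos hε y))
    have hy : HasLineDerivAt ℝ (fun y : E3 => (y i : ℂ)) 1 y (e3 i) := by
      have h3 : HasDerivAt (fun t : ℝ => y i + t) 1 0 := (hasDerivAt_id (0 : ℝ)).const_add (y i)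
      have h4 := h3.ofReal_comp
      unfold HasLineDerivAt
      refine (h4.congr_of_eventuallyEq ?_).congr_deriv (by simp)
      filter_upwards with t
      simp
    have h5 := HasDerivAt.mul hy h
    unfold HasLineDerivAt
    refine (h5.congr_of_eventuallyEq ?_).congr_deriv ?_
    · filter_upwards with t
      simp only [hP, v, Pi.mul_apply]
      ring
    · simp only [hQ, v, zero_smul, add_zero]
      push_cast
      ring
  have iK0 : Integrable fun y => K y * pd i g y := by
    simpa [hK, invReg_apply, v] using integrable_bcf_mul hε hε1 c1.continuous h1 (invReg hε)
  have iK : Integrable fun y => K y * pd i (pd i g) y := by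
    simpa [hK, invReg_apply, v] using integrable_bcf_mul hε hε1 c2 h2 (invReg hε)
  have iP1 : Integrable fun y => P y * pd i g y := by
    refine (integrable_bcf_mul hε hε1 c1.continuous h1
      (-(κ • (dirReg hε i * invReg hε) + dirReg hε i * invReg hε ^ 2))).congr ?_
    filter_upwards with y
    simp [hP, v, invReg_apply, dirReg_apply]
    left; ring
  have iP0 : Integrable fun y => P y * g y := by
    refine (integrable_bcf_mul hε hε1 hg.continuous h0
      (-(κ • (dirReg hε i * invReg hε) + dirReg hε i * invReg hε ^ 2))).congr ?_
    filter_upwards with y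
    simp [hP, v, invReg_apply, dirReg_apply]
    left; ring
  have iQ : Integrable fun y => Q y * g y := by
    refine (integrable_bcf_mul hε hε1 hg.continuous h0
      (-(κ • invReg hε ^ 2 + invReg hε ^ 3) + dirReg hε i ^ 2 * (κ ^ 2 • invReg hε
        + (3 * κ) • invReg hε ^ 2 + (3 : ℂ) • invReg hε ^ 3))).congr ?_
    filter_upwards with y
    simp [hQ, v, invReg_apply, dirReg_apply]
  have A := integral_bilinear_hasLineDerivAt_right_eq_neg_left_of_integrable (μ := volume)
    (f := K) (f' := P) (g := pd i g) (g' := pd i (pd i g)) (v := e3 i)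
    (B := ContinuousLinearMap.mul ℝ ℂ) iP1 iK iK0 (fun x _ => dK x)
    (fun x _ => (hpd x).hasFDerivAt.hasLineDerivAt _)
  have B := integral_bilinear_hasLineDerivAt_right_eq_neg_left_of_integrable (μ := volume)
    (f := P) (f' := Q) (g := g) (g' := pd i g) (v := e3 i)
    (B := ContinuousLinearMap.mul ℝ ℂ) iQ iP1 iP0 (fun x _ => dP x)
    (fun x _ => (hgd x).hasFDerivAt.hasLineDerivAt _)
  simp only [ContinuousLinearMap.mul_apply'] at A B
  rw [A, B, neg_neg]

theorem integral_regNorm_helmholtz {ε : ℝ} (hε : 0 < ε) (hε1 : ε ≤ 1) {κ : ℂ} {g : E3 → ℂ}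
    (hg : ContDiff ℝ 2 g) (h0 : Tame κ g) (h1 : ∀ i, Tame κ (pd i g))
    (h2 : ∀ i, Tame κ (pd i (pd i g))) :
    let v : E3 → ℂ := fun y => (regNorm ε y : ℂ)⁻¹
    ∫ y, v y * Complex.exp (-κ * regNorm ε y) * (κ ^ 2 * g y - lap g y) =
      ∫ y, ε ^ 2 * (κ ^ 2 * v y ^ 3 + 3 * κ * v y ^ 4 + 3 * v y ^ 5) *
        Complex.exp (-κ * regNorm ε y) * g y := by
  intro v
  have c2 : ∀ i, Continuous (pd i (pd i g)) := fun i => by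
    have c1 : ContDiff ℝ 1 (pd i g) := contDiff_pd_nat (n := 1) (by exact_mod_cast hg) i
    exact (contDiff_pd_nat (n := 0) (by exact_mod_cast c1) i).continuous
  have iK : ∀ i, Integrable fun y => v y * Complex.exp (-κ * regNorm ε y) * pd i (pd i g) y :=
    fun i => by
      simpa [invReg_apply, v] using integrable_bcf_mul hε hε1 (c2 i) (h2 i) (invReg hε)
  have iK0 : Integrable fun y => v y * Complex.exp (-κ * regNorm ε y) * g y := by
    simpa [invReg_apply, v] using integrable_bcf_mul hε hε1 hg.continuous h0 (invReg hε)
  have iQ : ∀ i : Fin 3, Integrable fun y => (-(κ * v y ^ 2 + v y ^ 3) + (y i * v y) ^ 2 *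
      (κ ^ 2 * v y + 3 * κ * v y ^ 2 + 3 * v y ^ 3)) * Complex.exp (-κ * regNorm ε y) * g y := by
    intro i
    refine (integrable_bcf_mul hε hε1 hg.continuous h0
      (-(κ • invReg hε ^ 2 + invReg hε ^ 3) + dirReg hε i ^ 2 * (κ ^ 2 • invReg hε
        + (3 * κ) • invReg hε ^ 2 + (3 : ℂ) • invReg hε ^ 3))).congr ?_
    filter_upwards with y
    simp [v, invReg_apply, dirReg_apply]
  have e1 : (fun y => v y * Complex.exp (-κ * regNorm ε y) * (κ ^ 2 * g y - lap g y))
      = fun y => κ ^ 2 * (v y * Complex.exp (-κ * regNorm ε y) * g y)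
        - ∑ i, v y * Complex.exp (-κ * regNorm ε y) * pd i (pd i g) y := by
    funext y
    simp only [lap, mul_sub, Finset.mul_sum]
    ring
  rw [e1, integral_sub (iK0.const_mul _) (integrable_finsetSum _ fun i _ => iK i),
    integral_finsetSum _ fun i _ => iK i]
  rw [Finset.sum_congr rfl fun i _ =>
    integral_regNorm_pd_pd hε hε1 hg h0 i (h1 i) (h2 i)]
  rw [← integral_finsetSum _ fun i _ => iQ i,
    ← integral_sub (iK0.const_mul _) (integrable_finsetSum _ fun i _ => iQ i)]
  congr 1
  funext y
  rw [Fin.sum_univ_three]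
  have hs : (regNorm ε y : ℂ) ≠ 0 := by exact_mod_cast (regNorm_pos hε y).ne'
  have hv : ((y 0 : ℂ) * v y) ^ 2 + (y 1 * v y) ^ 2 + (y 2 * v y) ^ 2 = 1 - ε ^ 2 * v y ^ 2 := by
    have h := regNorm_sq ε y
    rw [EuclideanSpace.norm_sq_eq, Fin.sum_univ_three] at h
    simp only [Real.norm_eq_abs, sq_abs] at h
    have h' : (regNorm ε y : ℂ) ^ 2 = (y 0 : ℂ) ^ 2 + y 1 ^ 2 + y 2 ^ 2 + ε ^ 2 := by
      exact_mod_cast h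
    simp only [v]
    field_simp
    linear_combination -h'
  linear_combination (-(κ ^ 2 * v y + 3 * κ * v y ^ 2 + 3 * v y ^ 3) *
    Complex.exp (-κ * regNorm ε y) * g y) * hv

open Filter Topology

theorem integrable_norm_inv_mul :
    Integrable fun y : E3 => ‖y‖⁻¹ * (1 + ‖y‖) ^ (-4 : ℝ) := by
  have h1 : IntegrableOn (fun y : E3 => ‖y‖⁻¹) (Metric.ball 0 1) := by
    refine integrableOn_ball_of_norm_le_rpow (C := 1) (α := 1) (by simp) (by simp) ?_
      (by fun_prop)
    filter_upwards with x
    simp [Real.rpow_neg_one]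
  have h2 : Integrable fun y : E3 => (1 + ‖y‖) ^ (-4 : ℝ) :=
    integrable_one_add_norm (by simp; norm_num)
  refine ((h1.integrable_indicator Metric.isOpen_ball.measurableSet).add h2).mono'
    (Measurable.aestronglyMeasurable (by fun_prop)) ?_
  filter_upwards with y
  have h0 : 0 ≤ (1 + ‖y‖) ^ (-4 : ℝ) := by positivity
  rw [norm_mul, norm_inv, norm_norm, Real.norm_of_nonneg h0, Pi.add_apply]
  by_cases hy : y ∈ Metric.ball (0 : E3) 1
  · rw [Set.indicator_of_mem hy]
    have h3 : (1 + ‖y‖) ^ (-4 : ℝ) ≤ 1 :=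
      Real.rpow_le_one_of_one_le_of_nonpos (by simp) (by norm_num)
    have : 0 ≤ ‖y‖⁻¹ := by positivity
    nlinarith
  · rw [Set.indicator_of_notMem hy, zero_add]
    have h3 : 1 ≤ ‖y‖ := by simpa using hy
    exact mul_le_of_le_one_left h0 (inv_le_one_of_one_le₀ h3)

theorem regNorm_zero (y : E3) : regNorm 0 y = ‖y‖ := by
  simp [regNorm]

theorem tendsto_regNorm (y : E3) : Tendsto (fun ε => regNorm ε y) (𝓝[>] 0) (𝓝 ‖y‖) := by
  have h : Continuous fun ε => regNorm ε y := by unfold regNorm; fun_prop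
  have := (h.tendsto 0).mono_left (nhdsWithin_le_nhds (s := Set.Ioi (0 : ℝ)))
  rwa [regNorm_zero] at this

theorem eventually_Ioc : ∀ᶠ ε in 𝓝[>] (0 : ℝ), 0 < ε ∧ ε ≤ 1 := by
  filter_upwards [Ioc_mem_nhdsGT (zero_lt_one' ℝ)] with ε h using h

theorem tendsto_integral_regNorm {κ : ℂ} {w : E3 → ℂ} (hw : Continuous w) (ht : Tame κ w) :
    Tendsto (fun ε : ℝ => ∫ y, (regNorm ε y : ℂ)⁻¹ * Complex.exp (-κ * regNorm ε y) * w y)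
      (𝓝[>] 0) (𝓝 (∫ y : E3, (‖y‖ : ℂ)⁻¹ * Complex.exp (-κ * ‖y‖) * w y)) := by
  obtain ⟨C, hC⟩ := ht
  refine tendsto_integral_filter_of_dominated_convergence
    (fun y => Real.exp ‖κ‖ * C * (‖y‖⁻¹ * (1 + ‖y‖) ^ (-4 : ℝ))) ?_ ?_
    (integrable_norm_inv_mul.const_mul _) ?_
  · filter_upwards [eventually_Ioc] with ε hε
    have := continuous_regNorm ε
    have := continuous_inv_regNorm hε.1
    exact Continuous.aestronglyMeasurable (by fun_prop)
  · filter_upwards [eventually_Ioc] with ε hε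
    filter_upwards [compl_mem_ae_iff.2 (measure_singleton (0 : E3))] with y hy
    have hy' : 0 < ‖y‖ := norm_pos_iff.2 hy
    rw [norm_mul, norm_mul, norm_inv, Complex.norm_real, Real.norm_of_nonneg (regNorm_pos hε.1 y).le]
    calc _ ≤ ‖y‖⁻¹ * (Real.exp ‖κ‖ * Real.exp (-κ.re * ‖y‖)) * ‖w y‖ := by
          gcongr
          · exact norm_le_regNorm y
          · exact exp_regNorm_le hε.1.le hε.2 κ y
      _ = ‖y‖⁻¹ * Real.exp ‖κ‖ * (Real.exp (-κ.re * ‖y‖) * ‖w y‖) := by ring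
      _ ≤ ‖y‖⁻¹ * Real.exp ‖κ‖ * (C * (1 + ‖y‖) ^ (-4 : ℝ)) :=
          mul_le_mul_of_nonneg_left (hC y) (by positivity)
      _ = _ := by ring
  · filter_upwards [compl_mem_ae_iff.2 (measure_singleton (0 : E3))] with y hy
    have h1 : Tendsto (fun ε => (regNorm ε y : ℂ)) (𝓝[>] 0) (𝓝 (‖y‖ : ℂ)) :=
      (Complex.continuous_ofReal.tendsto _).comp (tendsto_regNorm y)
    have hy' : (‖y‖ : ℂ) ≠ 0 := Complex.ofReal_ne_zero.2 (norm_ne_zero_iff.2 hy)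
    exact ((h1.inv₀ hy').mul ((Complex.continuous_exp.tendsto _).comp
      (h1.const_mul (-κ)))).mul_const _

theorem regNorm_smul {ε : ℝ} (hε : 0 < ε) (x : E3) : regNorm ε (ε • x) = ε * regNorm 1 x := by
  unfold regNorm
  rw [norm_smul, Real.norm_of_nonneg hε.le, ← Real.sqrt_sq hε.le, ← Real.sqrt_mul (by positivity),
    Real.sqrt_sq hε.le]
  congr 1
  ring

theorem half_le_regNorm (x : E3) : (1 + ‖x‖) / 2 ≤ regNorm 1 x :=
  Real.le_sqrt_of_sq_le (by nlinarith [sq_nonneg (‖x‖ - 1), norm_nonneg x])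

theorem integral_Ioi_sq_div :
    IntegrableOn (fun r : ℝ => 3 * r ^ 2 * (√(r ^ 2 + 1) ^ 5)⁻¹) (Set.Ioi 0) ∧
    ∫ r in Set.Ioi (0 : ℝ), 3 * r ^ 2 * (√(r ^ 2 + 1) ^ 5)⁻¹ = 1 := by
  have hd : ∀ r : ℝ, HasDerivAt (fun r : ℝ => r ^ 3 * (√(r ^ 2 + 1) ^ 3)⁻¹)
      (3 * r ^ 2 * (√(r ^ 2 + 1) ^ 5)⁻¹) r := by
    intro r
    have h1 : HasDerivAt (fun r : ℝ => √(r ^ 2 + 1)) (r / √(r ^ 2 + 1)) r := by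
      have := (((hasDerivAt_id r).fun_pow 2).add_const 1).sqrt (by simp; positivity)
      refine this.congr_deriv ?_
      simp
      rw [mul_div_mul_left _ _ two_ne_zero]
    have hpos : 0 < √(r ^ 2 + 1) := by positivity
    have h2 := ((hasDerivAt_id r).fun_pow 3).mul ((h1.fun_pow 3).fun_inv (by positivity))
    refine h2.congr_deriv ?_
    have hs : √(r ^ 2 + 1) ^ 2 = r ^ 2 + 1 := Real.sq_sqrt (by positivity)
    simp
    field_simp
    rw [hs]
    ring
  have hc : ContinuousWithinAt (fun r : ℝ => r ^ 3 * (√(r ^ 2 + 1) ^ 3)⁻¹) (Set.Ici 0) 0 :=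
    (hd 0).continuousAt.continuousWithinAt
  have hl : Tendsto (fun r : ℝ => r ^ 3 * (√(r ^ 2 + 1) ^ 3)⁻¹) atTop (𝓝 1) := by
    have h1 : Tendsto (fun r : ℝ => √(1 + (r⁻¹) ^ 2)) atTop (𝓝 (√(1 + 0 ^ 2))) :=
      ((tendsto_inv_atTop_zero.pow 2).const_add 1).sqrt
    have h2 : Tendsto (fun r : ℝ => (√(1 + (r⁻¹) ^ 2) ^ 3)⁻¹) atTop (𝓝 1) := by
      simpa using (h1.pow 3).inv₀ (by simp)
    refine h2.congr' ?_
    filter_upwards [eventually_gt_atTop 0] with r hr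
    have : √(r ^ 2 + 1) = r * √(1 + (r⁻¹) ^ 2) := by
      nth_rw 2 [← Real.sqrt_sq hr.le]
      rw [← Real.sqrt_mul (by positivity)]
      congr 1
      field_simp
    rw [this]
    have : 0 < √(1 + (r⁻¹) ^ 2) := by positivity
    field_simp
  have hp : ∀ r ∈ Set.Ioi (0 : ℝ), 0 ≤ 3 * r ^ 2 * (√(r ^ 2 + 1) ^ 5)⁻¹ := fun r _ => by positivity
  refine ⟨integrableOn_Ioi_deriv_of_nonneg hc (fun x _ => hd x) hp hl, ?_⟩
  rw [integral_Ioi_of_hasDerivAt_of_nonneg hc (fun x _ => hd x) hp hl]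
  simp

theorem integral_inv_regNorm_pow_five :
    ∫ x : E3, 3 * (regNorm 1 x ^ 5)⁻¹ = 4 * Real.pi := by
  have h := integral_fun_norm_addHaar (volume : Measure E3)
    (fun r : ℝ => 3 * (√(r ^ 2 + 1) ^ 5)⁻¹)
  have hv : (volume : Measure E3).real (Metric.ball 0 1) = Real.pi * 4 / 3 := by
    rw [measureReal_def, EuclideanSpace.volume_ball_fin_three]
    simp [ENNReal.toReal_ofReal (show 0 ≤ Real.pi * 4 / 3 by positivity)]
  have h3 : (∫ r in Set.Ioi (0 : ℝ), r ^ (Module.finrank ℝ E3 - 1) • (3 * (√(r ^ 2 + 1) ^ 5)⁻¹))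
      = 1 := by
    refine Eq.trans ?_ integral_Ioi_sq_div.2
    congr 1
    funext r
    simp
    ring
  rw [h3, hv] at h
  simp only [regNorm, one_pow]
  rw [h]
  simp
  ring

theorem tendsto_integral_scaled {κ : ℂ} {g : E3 → ℂ} (hg : Continuous g) (h0 : Tame κ g) :
    Tendsto (fun ε : ℝ => ∫ x : E3, (κ ^ 2 * ε ^ 2 * ((regNorm 1 x : ℂ) ^ 3)⁻¹
        + 3 * κ * ε * ((regNorm 1 x : ℂ) ^ 4)⁻¹ + 3 * ((regNorm 1 x : ℂ) ^ 5)⁻¹) *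
        Complex.exp (-κ * regNorm ε (ε • x)) * g (ε • x))
      (𝓝[>] 0) (𝓝 (4 * Real.pi * g 0)) := by
  obtain ⟨C, hC⟩ := h0
  have hC0 : 0 ≤ C := by
    have := (mul_nonneg (Real.exp_pos _).le (norm_nonneg _)).trans (hC 0)
    simpa using this
  have hlim : (4 * Real.pi * g 0 : ℂ) = ∫ x : E3, 3 * ((regNorm 1 x : ℂ) ^ 5)⁻¹ * g 0 := by
    rw [integral_mul_const]
    have := congrArg Complex.ofReal integral_inv_regNorm_pow_five
    rw [← integral_complex_ofReal] at this
    push_cast at this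
    rw [this]
  rw [hlim]
  have hi : Integrable fun x : E3 => (8 * ‖κ‖ ^ 2 + 48 * ‖κ‖ + 96) * Real.exp ‖κ‖ * C *
      (1 + ‖x‖) ^ (-4 : ℝ) :=
    (integrable_one_add_norm (by simp; norm_num)).const_mul _
  have hcr := continuous_regNorm 1
  have hci : Continuous fun x : E3 => ((regNorm 1 x : ℂ))⁻¹ := continuous_inv_regNorm zero_lt_one
  refine tendsto_integral_filter_of_dominated_convergence _ ?_ ?_ hi ?_
  · filter_upwards [eventually_Ioc] with ε hε
    have := continuous_regNorm ε
    simp only [← inv_pow]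
    exact Continuous.aestronglyMeasurable (by fun_prop)
  · filter_upwards [eventually_Ioc] with ε hε
    filter_upwards with x
    obtain ⟨hε0, hε1⟩ := hε
    set t : ℝ := (1 + ‖x‖)⁻¹ with ht
    have hx := norm_nonneg x
    have ht0 : 0 < t := by positivity
    have ht1 : t ≤ 1 := inv_le_one_of_one_le₀ (by linarith)
    have hr : (regNorm 1 x)⁻¹ ≤ 2 * t := by
      have h := inv_anti₀ (by positivity) (half_le_regNorm x)
      rw [inv_div, div_eq_mul_inv] at h
      exact h
    have hr0 : 0 < (regNorm 1 x)⁻¹ := inv_pos.2 (regNorm_pos one_pos x)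
    have e4 : (1 + ‖x‖) ^ (-4 : ℝ) = t ^ 4 := by
      rw [Real.rpow_neg (by positivity), ht, inv_pow]
      norm_cast
    have hgx : ‖Complex.exp (-κ * regNorm ε (ε • x))‖ * ‖g (ε • x)‖
        ≤ Real.exp ‖κ‖ * C * (1 + ε * ‖x‖) ^ (-4 : ℝ) := by
      calc _ ≤ Real.exp ‖κ‖ * Real.exp (-κ.re * ‖ε • x‖) * ‖g (ε • x)‖ := by
            gcongr
            exact exp_regNorm_le hε0.le hε1 κ _
        _ = Real.exp ‖κ‖ * (Real.exp (-κ.re * ‖ε • x‖) * ‖g (ε • x)‖) := by ring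
        _ ≤ Real.exp ‖κ‖ * (C * (1 + ‖ε • x‖) ^ (-4 : ℝ)) :=
            mul_le_mul_of_nonneg_left (hC _) (by positivity)
        _ = _ := by rw [norm_smul, Real.norm_of_nonneg hε0.le]; ring
    have hq1 : (1 + ε * ‖x‖) ^ (-4 : ℝ) ≤ 1 :=
      Real.rpow_le_one_of_one_le_of_nonpos (by nlinarith) (by norm_num)
    have hq0 : 0 ≤ (1 + ε * ‖x‖) ^ (-4 : ℝ) := by positivity
    have hq2 : ε * (1 + ε * ‖x‖) ^ (-4 : ℝ) ≤ t := by
      have h1 : (1 + ε * ‖x‖) ^ (-4 : ℝ) ≤ (1 + ε * ‖x‖) ^ (-1 : ℝ) :=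
        Real.rpow_le_rpow_of_exponent_le (by nlinarith) (by norm_num)
      rw [Real.rpow_neg_one] at h1
      have h2 : 0 < 1 + ε * ‖x‖ := by positivity
      have h3 : ε * (1 + ε * ‖x‖)⁻¹ ≤ t := by
        rw [ht, ← div_eq_mul_inv, div_le_iff₀ h2, inv_mul_eq_div, le_div_iff₀ (by positivity)]
        nlinarith
      exact (mul_le_mul_of_nonneg_left h1 hε0.le).trans h3
    set q := (1 + ε * ‖x‖) ^ (-4 : ℝ)
    rw [e4]
    set a := (regNorm 1 x)⁻¹ with ha
    have hpoly : ‖(κ ^ 2 * ε ^ 2 * ((regNorm 1 x : ℂ) ^ 3)⁻¹ + 3 * κ * ε * ((regNorm 1 x : ℂ) ^ 4)⁻¹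
        + 3 * ((regNorm 1 x : ℂ) ^ 5)⁻¹)‖ ≤ ‖κ‖ ^ 2 * ε ^ 2 * a ^ 3 + 3 * ‖κ‖ * ε * a ^ 4 + 3 * a ^ 5 := by
      refine (norm_add₃_le).trans (le_of_eq ?_)
      simp [ha, abs_of_pos hε0, abs_of_pos (regNorm_pos one_pos x)]
    rw [norm_mul, norm_mul, mul_assoc]
    calc _ ≤ (‖κ‖ ^ 2 * ε ^ 2 * a ^ 3 + 3 * ‖κ‖ * ε * a ^ 4 + 3 * a ^ 5) *
          (Real.exp ‖κ‖ * C * q) := by gcongr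
      _ = (Real.exp ‖κ‖ * C) * (‖κ‖ ^ 2 * ε * a ^ 3 * (ε * q) + (3 * ‖κ‖ * ε * a ^ 4
          + 3 * a ^ 5) * q) := by ring
      _ ≤ (Real.exp ‖κ‖ * C) * (‖κ‖ ^ 2 * 1 * (2 * t) ^ 3 * t + (3 * ‖κ‖ * 1 * (2 * t) ^ 4
          + 3 * (2 * t) ^ 5) * 1) := by gcongr
      _ = (Real.exp ‖κ‖ * C) * (8 * ‖κ‖ ^ 2 * t ^ 4 + 48 * ‖κ‖ * t ^ 4 + 96 * t ^ 4 * t) := by ring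
      _ ≤ (Real.exp ‖κ‖ * C) * (8 * ‖κ‖ ^ 2 * t ^ 4 + 48 * ‖κ‖ * t ^ 4 + 96 * t ^ 4 * 1) := by gcongr
      _ = _ := by ring
  · filter_upwards with x
    have hc : Continuous fun ε : ℝ => (κ ^ 2 * ε ^ 2 * ((regNorm 1 x : ℂ) ^ 3)⁻¹
        + 3 * κ * ε * ((regNorm 1 x : ℂ) ^ 4)⁻¹ + 3 * ((regNorm 1 x : ℂ) ^ 5)⁻¹) *
        Complex.exp (-κ * regNorm ε (ε • x)) * g (ε • x) := by
      unfold regNorm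
      fun_prop
    have := (hc.tendsto 0).mono_left (nhdsWithin_le_nhds (s := Set.Ioi (0 : ℝ)))
    simpa [regNorm_zero] using this

/-- `yukawa κ` is a fundamental solution of `κ² - Δ`. -/
theorem integral_yukawa_mul_helmholtz {κ : ℂ} {g : E3 → ℂ} (hg : ContDiff ℝ 2 g) (h0 : Tame κ g)
    (h1 : ∀ i, Tame κ (pd i g)) (h2 : ∀ i, Tame κ (pd i (pd i g))) :
    ∫ y, yukawa κ y * (κ ^ 2 * g y - lap g y) = g 0 := by
  have c2 : ∀ i, Continuous (pd i (pd i g)) := fun i => by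
    have c1 : ContDiff ℝ 1 (pd i g) := contDiff_pd_nat (n := 1) (by exact_mod_cast hg) i
    exact (contDiff_pd_nat (n := 0) (by exact_mod_cast c1) i).continuous
  have cl : Continuous (lap g) := by unfold lap; exact continuous_finsetSum _ fun i _ => c2 i
  have ht : Tame κ fun y => κ ^ 2 * g y - lap g y := by
    have := (h0.const_smul (κ ^ 2)).add ((Tame.lap h2).const_smul (-1))
    convert this using 1
    funext y
    simp [sub_eq_add_neg]
  have hgc := hg.continuous
  have hL := tendsto_integral_regNorm (by fun_prop : Continuous fun y => κ ^ 2 * g y - lap g y) ht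
  have hR := tendsto_integral_scaled hg.continuous h0
  have heq : (fun ε : ℝ => ∫ x : E3, (κ ^ 2 * ε ^ 2 * ((regNorm 1 x : ℂ) ^ 3)⁻¹
        + 3 * κ * ε * ((regNorm 1 x : ℂ) ^ 4)⁻¹ + 3 * ((regNorm 1 x : ℂ) ^ 5)⁻¹) *
        Complex.exp (-κ * regNorm ε (ε • x)) * g (ε • x)) =ᶠ[𝓝[>] 0]
      fun ε : ℝ => ∫ y, (regNorm ε y : ℂ)⁻¹ * Complex.exp (-κ * regNorm ε y) *
        (κ ^ 2 * g y - lap g y) := by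
    filter_upwards [eventually_Ioc] with ε hε
    obtain ⟨hε0, hε1⟩ := hε
    rw [integral_regNorm_helmholtz hε0 hε1 hg h0 h1 h2]
    have hsc := Measure.integral_comp_smul (volume : Measure E3) (fun y => (ε : ℂ) ^ 2 *
      (κ ^ 2 * ((regNorm ε y : ℂ)⁻¹) ^ 3 + 3 * κ * ((regNorm ε y : ℂ)⁻¹) ^ 4
        + 3 * ((regNorm ε y : ℂ)⁻¹) ^ 5) * Complex.exp (-κ * regNorm ε y) * g y) ε
    have hεc : (ε : ℂ) ≠ 0 := Complex.ofReal_ne_zero.2 hε0.ne'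
    have hscale : |(ε ^ Module.finrank ℝ E3)⁻¹| = (ε ^ 3)⁻¹ := by
      simp [abs_of_pos hε0]
    rw [hscale, eq_comm, inv_smul_eq_iff₀ (by positivity), ← integral_smul] at hsc
    rw [hsc]
    congr 1
    funext x
    have hs : (regNorm 1 x : ℂ) ≠ 0 := Complex.ofReal_ne_zero.2 (regNorm_pos one_pos x).ne'
    have hrs : (regNorm ε (ε • x) : ℂ)⁻¹ = (ε : ℂ)⁻¹ * (regNorm 1 x : ℂ)⁻¹ := by
      rw [regNorm_smul hε0]
      push_cast
      rw [mul_inv]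
    rw [hrs, Complex.real_smul]
    push_cast
    field_simp
  have := tendsto_nhds_unique (hR.congr' heq) hL
  have hpi : (4 * Real.pi : ℂ) ≠ 0 := by
    have := Real.pi_ne_zero
    norm_cast
    positivity
  calc _ = (4 * Real.pi : ℂ)⁻¹ * ∫ y : E3, (‖y‖ : ℂ)⁻¹ * Complex.exp (-κ * ‖y‖) *
        (κ ^ 2 * g y - lap g y) := by
        rw [← integral_const_mul]
        congr 1
        funext y
        rw [yukawa, div_eq_mul_inv, mul_inv]
        ring
    _ = g 0 := by rw [← this]; field_simp

open Filter Topology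

/-! ### Convolution operators with locally square-integrable kernels -/

/-- The convolution `k * f`. -/
def kconv (k f : E3 → ℂ) (x : E3) : ℂ := ∫ y, k (x - y) * f y

/-- Measurable functions that are square-integrable on every ball. -/
structure LocL2 (k : E3 → ℂ) : Prop where
  measurable : Measurable k
  memLp : ∀ r : ℝ, MemLp k 2 (volume.restrict (Metric.closedBall 0 r))

/-- The `L²` norm on the ball of radius `r`. -/
def ballNorm (k : E3 → ℂ) (r : ℝ) : ℝ :=
  (eLpNorm k 2 (volume.restrict (Metric.closedBall 0 r))).toReal

theorem ballNorm_nonneg (k : E3 → ℂ) (r : ℝ) : 0 ≤ ballNorm k r := ENNReal.toReal_nonneg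

theorem ballNorm_le_mul {k l : E3 → ℂ} (hl : LocL2 l) {c r : ℝ} (hc : 0 ≤ c)
    (h : ∀ y, ‖y‖ ≤ r → ‖k y‖ ≤ c * ‖l y‖) : ballNorm k r ≤ c * ballNorm l r := by
  have h1 : eLpNorm k 2 (volume.restrict (Metric.closedBall 0 r)) ≤
      ENNReal.ofReal c * eLpNorm l 2 (volume.restrict (Metric.closedBall 0 r)) := by
    refine eLpNorm_le_mul_eLpNorm_of_ae_le_mul ?_ 2
    filter_upwards [ae_restrict_mem Metric.isClosed_closedBall.measurableSet] with y hy
    exact h y (by simpa using hy)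
  have h2 := ENNReal.toReal_mono (ENNReal.mul_ne_top ENNReal.ofReal_ne_top (hl.memLp r).2.ne) h1
  rwa [ENNReal.toReal_mul, ENNReal.toReal_ofReal hc] at h2

theorem LocL2.add {k l : E3 → ℂ} (hk : LocL2 k) (hl : LocL2 l) : LocL2 (k + l) :=
  ⟨hk.1.add hl.1, fun r => (hk.2 r).add (hl.2 r)⟩

theorem LocL2.const_smul {k : E3 → ℂ} (hk : LocL2 k) (c : ℂ) : LocL2 (c • k) :=
  ⟨hk.1.const_smul c, fun r => (hk.2 r).const_smul c⟩

theorem LocL2.locallyIntegrable {k : E3 → ℂ} (hk : LocL2 k) : LocallyIntegrable k volume := by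
  rw [locallyIntegrable_iff]
  intro K hK
  obtain ⟨r, hr⟩ := hK.isBounded.subset_closedBall 0
  have : IsFiniteMeasure (volume.restrict (Metric.closedBall (0 : E3) r)) :=
    ⟨by simpa using measure_closedBall_lt_top (μ := (volume : Measure E3)) (x := 0) (r := r)⟩
  have h : IntegrableOn k (Metric.closedBall 0 r) volume := (hk.2 r).integrable (by norm_num)
  exact h.mono_set hr

theorem kconv_congr {k f g : E3 → ℂ} (h : f =ᵐ[volume] g) : kconv k f = kconv k g := by
  funext x
  apply integral_congr_ae
  filter_upwards [h] with y hy
  rw [hy]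

theorem integrable_kconv_and_norm_le {k f : E3 → ℂ} (hk : LocL2 k) (hf : MemLp f 2 volume)
    {a b : ℝ} (ha : ∀ᵐ y, y ∉ Metric.closedBall (0 : E3) a → f y = 0) {x : E3} (hx : ‖x‖ ≤ b) :
    Integrable (fun y => k (x - y) * f y) ∧ ‖kconv k f x‖ ≤ ballNorm k (a + b) * nrm f := by
  set B := Metric.closedBall (0 : E3) (a + b)
  have hB : MeasurableSet B := Metric.isClosed_closedBall.measurableSet
  have h1 : MemLp (B.indicator k) 2 volume := (memLp_indicator_iff_restrict hB).2 (hk.2 _)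
  have hmp : MeasurePreserving (fun y : E3 => x - y) volume volume :=
    Measure.measurePreserving_sub_left volume x
  have h2 : MemLp (fun y => B.indicator k (x - y)) 2 volume := h1.comp_measurePreserving hmp
  have hn : nrm (fun y => B.indicator k (x - y)) = ballNorm k (a + b) := by
    unfold nrm ballNorm
    rw [← eLpNorm_indicator_eq_eLpNorm_restrict hB, ← eLpNorm_comp_measurePreserving h1.1 hmp]
    rfl
  have he : (fun y => B.indicator k (x - y) * f y) =ᵐ[volume] fun y => k (x - y) * f y := by
    filter_upwards [ha] with y hy
    by_cases h : y ∈ Metric.closedBall (0 : E3) a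
    · have : x - y ∈ B := by
        simp only [B, mem_closedBall_zero_iff] at h ⊢
        exact (norm_sub_le _ _).trans (by linarith)
      rw [Set.indicator_of_mem this]
    · rw [hy h, mul_zero, mul_zero]
  refine ⟨(h2.integrable_mul hf).congr he, ?_⟩
  rw [kconv, ← integral_congr_ae he, ← hn]
  exact norm_integral_mul_le h2 hf

theorem stronglyMeasurable_kconv {k f : E3 → ℂ} (hk : Measurable k) (hf : StronglyMeasurable f) :
    StronglyMeasurable (kconv k f) := by
  refine StronglyMeasurable.integral_prod_right (f := fun x y => k (x - y) * f y) ?_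
  exact (hk.comp measurable_sub).stronglyMeasurable.mul (hf.comp_measurable measurable_snd)

theorem exists_radius (f : L2comp) : ∃ a : ℝ, ∀ᵐ y, y ∉ Metric.closedBall (0 : E3) a →
    (f : L2) y = 0 := by
  obtain ⟨K, hK, h⟩ := f.2
  obtain ⟨a, ha⟩ := hK.isBounded.subset_closedBall 0
  exact ⟨a, h.mono fun y hy hya => hy fun hyK => hya (ha hyK)⟩

theorem integrable_kconv {k : E3 → ℂ} (hk : LocL2 k) (f : L2comp) (x : E3) :
    Integrable (fun y => k (x - y) * (f : L2) y) := by
  obtain ⟨a, ha⟩ := exists_radius f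
  exact (integrable_kconv_and_norm_le hk (Lp.memLp (f : L2)) ha le_rfl).1

theorem memLp_kconv {k : E3 → ℂ} (hk : LocL2 k) (f : L2comp) {K : Set E3} (hK : IsCompact K) :
    MemLp (kconv k (f : L2)) 2 (volume.restrict K) := by
  obtain ⟨a, ha⟩ := exists_radius f
  obtain ⟨b, hb⟩ := hK.isBounded.subset_closedBall 0
  have : IsFiniteMeasure (volume.restrict K) := ⟨by simpa using hK.measure_lt_top⟩
  refine MemLp.of_bound
    (stronglyMeasurable_kconv hk.1 (Lp.stronglyMeasurable _)).aestronglyMeasurable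
    (ballNorm k (a + b) * nrm (f : L2)) ?_
  filter_upwards [ae_restrict_mem hK.measurableSet] with x hx
  exact (integrable_kconv_and_norm_le hk (Lp.memLp (f : L2)) ha (by simpa using hb hx)).2

/-- The operator `f ↦ k * f` from `L²_comp(ℝ³)` to `L²_loc(ℝ³)`. -/
def convOp (k : E3 → ℂ) (hk : LocL2 k) : L2comp →ₗ[ℂ] L2loc where
  toFun f := ⟨AEEqFun.mk (kconv k (f : L2))
      (stronglyMeasurable_kconv hk.1 (Lp.stronglyMeasurable _)).aestronglyMeasurable,
    fun _ hK => (memLp_congr_ae (ae_restrict_of_ae (AEEqFun.coeFn_mk _ _))).2 (memLp_kconv hk f hK)⟩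
  map_add' f g := by
    refine Subtype.ext ((AEEqFun.mk_eq_mk.2 ?_).trans (AEEqFun.mk_add_mk _ _ _ _).symm)
    filter_upwards with x
    rw [Pi.add_apply, kconv, kconv, kconv,
      ← integral_add (integrable_kconv hk f x) (integrable_kconv hk g x)]
    apply integral_congr_ae
    filter_upwards [Lp.coeFn_add (f : L2) g] with y hy
    rw [Submodule.coe_add, hy, Pi.add_apply, mul_add]
  map_smul' c f := by
    refine Subtype.ext ((AEEqFun.mk_eq_mk.2 ?_).trans (AEEqFun.smul_mk c _ _).symm)
    filter_upwards with x
    rw [Pi.smul_apply, kconv, kconv, smul_eq_mul, ← integral_const_mul]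
    apply integral_congr_ae
    filter_upwards [Lp.coeFn_smul c (f : L2)] with y hy
    rw [Submodule.coe_smul, hy, Pi.smul_apply, smul_eq_mul]
    ring

theorem convOp_coe (k : E3 → ℂ) (hk : LocL2 k) (f : L2comp) :
    ((convOp k hk f : L2loc) : E3 →ₘ[volume] ℂ) =ᵐ[volume] kconv k (f : L2) :=
  AEEqFun.coeFn_mk _ _

theorem convOp_add {k l : E3 → ℂ} (hk : LocL2 k) (hl : LocL2 l) :
    convOp (k + l) (hk.add hl) = convOp k hk + convOp l hl := by
  ext1 f
  apply Subtype.ext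
  change AEEqFun.mk _ _ = AEEqFun.mk _ _ + AEEqFun.mk _ _
  rw [AEEqFun.mk_add_mk, AEEqFun.mk_eq_mk]
  filter_upwards with x
  rw [Pi.add_apply, kconv, kconv, kconv,
    ← integral_add (integrable_kconv hk f x) (integrable_kconv hl f x)]
  congr 1
  funext y
  simp [add_mul]

theorem convOp_smul {k : E3 → ℂ} (hk : LocL2 k) (c : ℂ) :
    convOp (c • k) (hk.const_smul c) = c • convOp k hk := by
  ext1 f
  apply Subtype.ext
  change AEEqFun.mk _ _ = c • AEEqFun.mk _ _
  rw [AEEqFun.smul_mk, AEEqFun.mk_eq_mk]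
  filter_upwards with x
  rw [Pi.smul_apply, kconv, kconv, smul_eq_mul, ← integral_const_mul]
  congr 1
  funext y
  simp [mul_assoc]

theorem mulComp_coe (ρ : 𝓓((⊤ : Opens E3), ℂ)) (f : L2) :
    ((mulComp ρ f : L2comp) : L2) =ᵐ[volume] fun x => ρ x * f x :=
  (memLp_cutoff_L2 ρ f).coeFn_toLp

theorem mulLoc_coe (ρ : 𝓓((⊤ : Opens E3), ℂ)) (u : L2loc) :
    (mulLoc ρ u : L2) =ᵐ[volume] fun x => ρ x * (u : E3 →ₘ[volume] ℂ) x :=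
  (memLp_cutoff ρ u.2).coeFn_toLp

theorem cutoff_convOp_coe (ρ : 𝓓((⊤ : Opens E3), ℂ)) {k : E3 → ℂ} (hk : LocL2 k) (f : L2) :
    (cutoff ρ (convOp k hk) f : L2) =ᵐ[volume]
      fun x => ρ x * kconv k (fun y => ρ y * f y) x := by
  have h1 := mulLoc_coe ρ (convOp k hk (mulComp ρ f))
  filter_upwards [h1, convOp_coe k hk (mulComp ρ f)] with x h1 h2
  change (mulLoc ρ (convOp k hk (mulComp ρ f)) : L2) x = _
  rw [h1, h2, kconv_congr (mulComp_coe ρ f)]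

theorem norm_kconv_mul_le {R : ℝ} {ρ f k : E3 → ℂ} (hk : LocL2 k)
    (hρ : tsupport ρ ⊆ Metric.closedBall 0 R) (hf : MemLp (fun y => ρ y * f y) 2 volume) {x : E3}
    (hx : x ∈ Metric.closedBall (0 : E3) R) :
    ‖kconv k (fun y => ρ y * f y) x‖ ≤ ballNorm k (2 * R) * nrm fun y => ρ y * f y := by
  have h := (integrable_kconv_and_norm_le (a := R) (b := R) hk hf (by
    filter_upwards with y hy
    rw [image_eq_zero_of_notMem_tsupport fun h => hy (hρ h), zero_mul]) (by simpa using hx)).2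
  rwa [← two_mul] at h

theorem norm_cutoff_convOp_le (ρ : 𝓓((⊤ : Opens E3), ℂ)) {R : ℝ}
    (hρ : tsupport ρ ⊆ Metric.closedBall 0 R) :
    ∃ C : ℝ, 0 ≤ C ∧ ∀ (k : E3 → ℂ) (hk : LocL2 k) (f : L2),
      ‖cutoff ρ (convOp k hk) f‖ ≤ C * ballNorm k (2 * R) * ‖f‖ := by
  obtain ⟨D, hD⟩ := ρ.continuous.bounded_above_of_compact_support ρ.hasCompactSupport
  have hD0 : 0 ≤ D := (norm_nonneg _).trans (hD 0)
  have hρ2 : MemLp ρ 2 volume := memLp_of_hasCompactSupport ρ.continuous ρ.hasCompactSupport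
  refine ⟨nrm ρ * D, mul_nonneg (nrm_nonneg _) hD0, fun k hk f => ?_⟩
  have hf := memLp_cutoff_L2 ρ f
  have hρf : nrm (fun y => ρ y * f y) ≤ D * ‖f‖ := by
    rw [← norm_toLp_eq_nrm hf]
    refine Lp.norm_le_mul_norm_of_ae_le_mul ?_
    filter_upwards [hf.coeFn_toLp] with y hy
    rw [hy, norm_mul]
    exact mul_le_mul_of_nonneg_right (hD y) (norm_nonneg _)
  have hb := ballNorm_nonneg k (2 * R)
  have h1 : ‖cutoff ρ (convOp k hk) f‖ ≤ ballNorm k (2 * R) * (D * ‖f‖) * ‖hρ2.toLp ρ‖ := by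
    refine Lp.norm_le_mul_norm_of_ae_le_mul ?_
    filter_upwards [cutoff_convOp_coe ρ hk f, hρ2.coeFn_toLp] with x hx h2
    rw [hx, h2, norm_mul, mul_comm]
    by_cases hxs : x ∈ tsupport ρ
    · gcongr
      exact (norm_kconv_mul_le hk hρ hf (hρ hxs)).trans (by gcongr)
    · simp [image_eq_zero_of_notMem_tsupport hxs]
  rw [norm_toLp_eq_nrm] at h1
  linarith

/-- The bounded operator `ρ (k * ρ ·)` on `L²(ℝ³)`. -/
def cutoffConv (ρ : 𝓓((⊤ : Opens E3), ℂ)) (k : E3 → ℂ) (hk : LocL2 k) : L2 →L[ℂ] L2 :=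
  (cutoff ρ (convOp k hk)).mkContinuousOfExistsBound (by
    obtain ⟨R, hR⟩ := ρ.hasCompactSupport.isCompact.isBounded.subset_closedBall 0
    obtain ⟨C, _, h⟩ := norm_cutoff_convOp_le ρ hR
    exact ⟨_, fun f => h k hk f⟩)

theorem cutoff_add (ρ : 𝓓((⊤ : Opens E3), ℂ)) (S T : L2comp →ₗ[ℂ] L2loc) :
    cutoff ρ (S + T) = cutoff ρ S + cutoff ρ T := by
  simp [cutoff, LinearMap.add_comp, LinearMap.comp_add]

theorem cutoff_smul (ρ : 𝓓((⊤ : Opens E3), ℂ)) (c : ℂ) (T : L2comp →ₗ[ℂ] L2loc) :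
    cutoff ρ (c • T) = c • cutoff ρ T := by
  simp [cutoff, LinearMap.smul_comp, LinearMap.comp_smul]

/-! ### The operators with Yukawa kernel -/

theorem measurable_yukawa (κ : ℂ) : Measurable (yukawa κ) := by
  unfold yukawa
  fun_prop

theorem norm_yukawa (κ : ℂ) (y : E3) :
    ‖yukawa κ y‖ = Real.exp (-κ.re * ‖y‖) / (4 * Real.pi * ‖y‖) := by
  rw [yukawa, norm_div, Complex.norm_exp]
  simp [abs_of_pos Real.pi_pos]

theorem norm_yukawa_le (κ : ℂ) {y : E3} {r : ℝ} (hr : ‖y‖ ≤ r) :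
    ‖yukawa κ y‖ ≤ Real.exp (r * max (-κ.re) 0) * ‖yukawa 0 y‖ := by
  rw [norm_yukawa, norm_yukawa, ← mul_div_assoc, ← Real.exp_add]
  have h : -κ.re * ‖y‖ ≤ r * max (-κ.re) 0 := by
    have h1 : -κ.re * ‖y‖ ≤ max (-κ.re) 0 * ‖y‖ := by gcongr; exact le_max_left _ _
    have h2 : max (-κ.re) 0 * ‖y‖ ≤ max (-κ.re) 0 * r := by gcongr
    linarith
  gcongr
  simpa using h

theorem locL2_yukawa_zero : LocL2 (yukawa 0) := by
  refine ⟨measurable_yukawa 0, fun r => ?_⟩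
  rw [memLp_two_iff_integrable_sq_norm (measurable_yukawa 0).aestronglyMeasurable]
  have h : IntegrableOn (fun y : E3 => ‖yukawa 0 y‖ ^ 2) (Metric.ball 0 (r + 1)) := by
    refine integrableOn_ball_of_norm_le_rpow (C := 1) (α := 2) (by simp) (by simp; norm_num) ?_
      ((measurable_yukawa 0).norm.pow_const 2).aestronglyMeasurable
    filter_upwards with x
    rw [norm_yukawa, Real.norm_of_nonneg (by positivity), Real.rpow_neg (norm_nonneg _)]
    have hpi : 1 ≤ 4 * Real.pi := by linarith [Real.pi_gt_three]
    have h1 : Real.exp (-(0 : ℂ).re * ‖x‖) / (4 * Real.pi * ‖x‖) = (4 * Real.pi)⁻¹ * ‖x‖⁻¹ := by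
      simp [mul_comm]
    rw [h1, mul_pow, one_mul, inv_pow ‖x‖]
    norm_cast
    exact mul_le_of_le_one_left (by positivity)
      (pow_le_one₀ (by positivity) (inv_le_one_of_one_le₀ hpi))
  exact h.mono_set (Metric.closedBall_subset_ball (by linarith))

theorem locL2_yukawa (κ : ℂ) : LocL2 (yukawa κ) := by
  refine ⟨measurable_yukawa κ, fun r => ?_⟩
  refine (locL2_yukawa_zero.2 r).of_le_mul (c := Real.exp (r * max (-κ.re) 0))
    (measurable_yukawa κ).aestronglyMeasurable ?_
  filter_upwards [ae_restrict_mem Metric.isClosed_closedBall.measurableSet] with y hy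
  exact norm_yukawa_le κ (by simpa using hy)

theorem ballNorm_yukawa_le (κ : ℂ) (r : ℝ) :
    ballNorm (yukawa κ) r ≤ Real.exp (r * max (-κ.re) 0) * ballNorm (yukawa 0) r :=
  ballNorm_le_mul locL2_yukawa_zero (Real.exp_pos _).le fun _ hy => norm_yukawa_le κ hy

/-- The derivative of the Yukawa kernel with respect to `κ`. -/
def yukawaDeriv (κ : ℂ) (y : E3) : ℂ := -‖y‖ * yukawa κ y

theorem locL2_yukawaDeriv (κ : ℂ) : LocL2 (yukawaDeriv κ) := by
  have hm : Measurable (yukawaDeriv κ) := by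
    have := measurable_yukawa κ
    unfold yukawaDeriv
    fun_prop
  refine ⟨hm, fun r => ?_⟩
  refine ((locL2_yukawa κ).2 r).of_le_mul (c := r) hm.aestronglyMeasurable ?_
  filter_upwards [ae_restrict_mem Metric.isClosed_closedBall.measurableSet] with y hy
  rw [yukawaDeriv, norm_mul, norm_neg, Complex.norm_real, norm_norm]
  gcongr
  simpa using hy

theorem norm_yukawa_taylor_le (κ h : ℂ) {y : E3} {r : ℝ} (hy : ‖y‖ ≤ r) (hh : ‖h‖ * r ≤ 1) :
    ‖(yukawa (κ + h) + (-1 : ℂ) • yukawa κ + (-h) • yukawaDeriv κ) y‖ ≤ ‖h‖ ^ 2 * r ^ 2 * ‖yukawa κ y‖ := by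
  have e : (yukawa (κ + h) + (-1 : ℂ) • yukawa κ + (-h) • yukawaDeriv κ) y
      = (Complex.exp (-h * ‖y‖) - 1 - (-h * ‖y‖)) * yukawa κ y := by
    have : yukawa (κ + h) y = Complex.exp (-h * ‖y‖) * yukawa κ y := by
      rw [yukawa, yukawa, ← mul_div_assoc, ← Complex.exp_add]
      congr 2
      ring
    simp only [Pi.add_apply, Pi.smul_apply, smul_eq_mul, this, yukawaDeriv]
    ring
  have hn : ‖-h * (‖y‖ : ℂ)‖ = ‖h‖ * ‖y‖ := by simp
  have h1 : ‖h‖ * ‖y‖ ≤ ‖h‖ * r := by gcongr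
  have h2 := Complex.norm_exp_sub_one_sub_id_le (x := -h * (‖y‖ : ℂ)) (by rw [hn]; linarith)
  rw [e, norm_mul]
  gcongr
  refine h2.trans ?_
  rw [hn, ← mul_pow]
  gcongr

theorem hasDerivAt_cutoffConv_yukawa (ρ : 𝓓((⊤ : Opens E3), ℂ)) (κ : ℂ) :
    HasDerivAt (fun κ => cutoffConv ρ (yukawa κ) (locL2_yukawa κ))
      (cutoffConv ρ (yukawaDeriv κ) (locL2_yukawaDeriv κ)) κ := by
  obtain ⟨R, hR⟩ := ρ.hasCompactSupport.isCompact.isBounded.subset_closedBall 0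
  obtain ⟨C, hC0, hC⟩ := norm_cutoff_convOp_le ρ hR
  rw [hasDerivAt_iff_isLittleO_nhds_zero]
  have hO : (fun h : ℂ => cutoffConv ρ (yukawa (κ + h)) (locL2_yukawa (κ + h)) -
      cutoffConv ρ (yukawa κ) (locL2_yukawa κ) -
      h • cutoffConv ρ (yukawaDeriv κ) (locL2_yukawaDeriv κ)) =O[𝓝 0] fun h : ℂ => h ^ 2 := by
    refine Asymptotics.IsBigO.of_bound
      (C * ((2 * R) ^ 2 * ballNorm (yukawa κ) (2 * R))) ?_
    have hlim : Tendsto (fun h : ℂ => ‖h‖ * (2 * R)) (𝓝 0) (𝓝 0) := by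
      have : Continuous fun h : ℂ => ‖h‖ * (2 * R) := by fun_prop
      simpa using this.tendsto 0
    filter_upwards [hlim.eventually (gt_mem_nhds one_pos)] with h hh
    have h1 := (locL2_yukawa κ).const_smul (-1)
    have h2 := (locL2_yukawaDeriv κ).const_smul (-h)
    have hl := ((locL2_yukawa (κ + h)).add h1).add h2
    have e : cutoffConv ρ (yukawa (κ + h)) (locL2_yukawa (κ + h)) -
        cutoffConv ρ (yukawa κ) (locL2_yukawa κ) -
        h • cutoffConv ρ (yukawaDeriv κ) (locL2_yukawaDeriv κ) = cutoffConv ρ _ hl := by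
      ext1 f
      change _ = cutoff ρ (convOp _ hl) f
      rw [convOp_add ((locL2_yukawa (κ + h)).add h1) h2, convOp_add (locL2_yukawa (κ + h)) h1,
        convOp_smul (locL2_yukawaDeriv κ), convOp_smul (locL2_yukawa κ), cutoff_add, cutoff_add,
        cutoff_smul, cutoff_smul]
      simp only [sub_eq_add_neg, LinearMap.add_apply, neg_smul, one_smul]
      rfl
    rw [e]
    have hb : ballNorm (yukawa (κ + h) + (-1 : ℂ) • yukawa κ + (-h) • yukawaDeriv κ) (2 * R) ≤
        ‖h‖ ^ 2 * (2 * R) ^ 2 * ballNorm (yukawa κ) (2 * R) :=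
      ballNorm_le_mul (locL2_yukawa κ) (by positivity) fun y hy =>
        norm_yukawa_taylor_le κ h hy hh.le
    refine ContinuousLinearMap.opNorm_le_bound _ ?_ fun f => ?_
    · have := ballNorm_nonneg (yukawa κ) (2 * R)
      positivity
    · refine (hC _ hl f).trans ?_
      refine mul_le_mul_of_nonneg_right ?_ (norm_nonneg _)
      calc _ ≤ C * (‖h‖ ^ 2 * (2 * R) ^ 2 * ballNorm (yukawa κ) (2 * R)) := by gcongr
        _ = _ := by rw [norm_pow]; ring
  refine hO.trans_isLittleO ?_
  simpa using Asymptotics.isLittleO_pow_id (𝕜 := ℂ) one_lt_two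

/-- The operators `R₀(z) = (2z²)⁻¹ ((-Δ - z²)⁻¹ - (-Δ + z²)⁻¹)` from `L²_comp(ℝ³)` to
`L²_loc(ℝ³)`, given by their integral kernels. -/
def freeRes (z : ℂ) : L2comp →ₗ[ℂ] L2loc :=
  (2 * z ^ 2)⁻¹ • (convOp (yukawa (-Complex.I * z)) (locL2_yukawa _) +
    (-1 : ℂ) • convOp (yukawa z) (locL2_yukawa _))

theorem isAnalyticFamily_freeRes : IsAnalyticFamily freeRes {0}ᶜ := by
  intro ρ
  refine ⟨fun z => (2 * z ^ 2)⁻¹ • (cutoffConv ρ (yukawa (-Complex.I * z)) (locL2_yukawa _) +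
    (-1 : ℂ) • cutoffConv ρ (yukawa z) (locL2_yukawa _)), fun z _ => ?_, ?_⟩
  · rw [freeRes, cutoff_smul, cutoff_add, cutoff_smul]
    rfl
  · refine DifferentiableOn.analyticOnNhd ?_ isOpen_compl_singleton
    intro z hz
    have hz' : (2 * z ^ 2) ≠ 0 := by
      simpa using hz
    have h1 : DifferentiableAt ℂ (fun z : ℂ => (2 * z ^ 2)⁻¹) z :=
      ((differentiableAt_id.pow 2).const_mul 2).inv hz'
    have h2 := (hasDerivAt_cutoffConv_yukawa ρ z).differentiableAt
    have h3 : DifferentiableAt ℂ (fun z => cutoffConv ρ (yukawa (-Complex.I * z))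
        (locL2_yukawa _)) z :=
      (hasDerivAt_cutoffConv_yukawa ρ (-Complex.I * z)).differentiableAt.comp z
        (differentiableAt_id.const_mul (-Complex.I))
    exact (h1.smul (h3.add (h2.const_smul (-1 : ℂ)))).differentiableWithinAt

/-! ### Interior energy estimates -/

theorem norm_integral_le_nrm_mul {f p q : E3 → ℂ} (hp : MemLp p 2 volume) (hq : MemLp q 2 volume)
    (h : ∀ x, ‖f x‖ = ‖p x‖ * ‖q x‖) : ‖∫ x, f x‖ ≤ nrm p * nrm q := by
  have hp' : MemLp (fun x => (‖p x‖ : ℂ)) 2 volume := hp.norm.ofReal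
  have hq' : MemLp (fun x => (‖q x‖ : ℂ)) 2 volume := hq.norm.ofReal
  have e : ∀ r : E3 → ℂ, nrm (fun x => (‖r x‖ : ℂ)) = nrm r := fun r => by
    unfold nrm
    exact congrArg _ (eLpNorm_congr_norm_ae (by filter_upwards with x; simp))
  have h1 : ‖∫ x, f x‖ ≤ ∫ x, ‖p x‖ * ‖q x‖ :=
    (norm_integral_le_integral_norm f).trans_eq (by simp_rw [h])
  have h2 : ((∫ x, ‖p x‖ * ‖q x‖ : ℝ) : ℂ) = ∫ x, (‖p x‖ : ℂ) * (‖q x‖ : ℂ) := by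
    rw [← integral_complex_ofReal]
    simp
  have h3 := norm_integral_mul_le hp' hq'
  rw [← h2, e, e, Complex.norm_real] at h3
  exact h1.trans ((le_abs_self _).trans h3)

theorem contDiff_star {f : E3 → ℂ} (hf : ContDiff ℝ ∞ f) : ContDiff ℝ ∞ (star f) :=
  Complex.conjCLE.contDiff.comp hf

theorem energy_le {χ W F G : E3 → ℂ} (hχ : ContDiff ℝ ∞ χ) (hc : HasCompactSupport χ)
    (hW : ContDiff ℝ ∞ W) (hF : ContDiff ℝ ∞ F) (hG : ContDiff ℝ ∞ G) (j : Fin 3)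
    (hlap : lap W = F + pd j G) :
    ∑ i, nrm (χ * pd i W) ^ 2 ≤ nrm (χ * W) * nrm (χ * F) + 2 * nrm (pd j χ * W) * nrm (χ * G) +
      nrm (χ * pd j W) * nrm (χ * G) + 2 * ∑ i, nrm (pd i χ * W) * nrm (χ * pd i W) := by
  have L2 : ∀ {a b : E3 → ℂ}, ContDiff ℝ ∞ a → ContDiff ℝ ∞ b → HasCompactSupport a →
      MemLp (a * b) 2 volume := fun ha hb hca =>
    memLp_of_hasCompactSupport (ha.continuous.mul hb.continuous) hca.mul_right
  have hχs := contDiff_star hχ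
  have hWs := contDiff_star hW
  have hcp : ∀ i, HasCompactSupport (pd i χ) := hasCompactSupport_pd hc
  have hpχ : ∀ i, ContDiff ℝ ∞ (pd i χ) := contDiff_pd hχ
  have hpW : ∀ i, ContDiff ℝ ∞ (pd i W) := contDiff_pd hW
  have hd : ∀ {f : E3 → ℂ}, ContDiff ℝ ∞ f → Differentiable ℝ f := fun h => h.differentiable (by simp)
  have I : ∀ {a b : E3 → ℂ}, ContDiff ℝ ∞ a → ContDiff ℝ ∞ b → HasCompactSupport a →
      Integrable fun x => a x * b x := fun ha hb hca =>
    (ha.continuous.mul hb.continuous).integrable_of_hasCompactSupport hca.mul_right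
  set a : E3 → ℂ := χ * star χ * star W with ha
  have hac : ContDiff ℝ ∞ a := (hχ.mul hχs).mul hWs
  have haK : HasCompactSupport a := (hc.mul_right).mul_right
  have hpa : ∀ i, pd i a = pd i χ * star χ * star W + χ * star (pd i χ) * star W
      + χ * star χ * star (pd i W) := by
    intro i
    have hm : ContDiff ℝ ∞ (χ * star χ) := hχ.mul hχs
    rw [ha, pd_mul (hd hm) (hd hWs), pd_mul (hd hχ) (hd hχs), pd_star, pd_star]
    ring
  -- the three parts of `∫ ∂ᵢa H`
  have split : ∀ (i : Fin 3) (H : E3 → ℂ), ContDiff ℝ ∞ H →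
      ∃ z : ℂ, ‖z‖ ≤ 2 * nrm (pd i χ * W) * nrm (χ * H) ∧
        ∫ x, pd i a x * H x = z + ∫ x, χ x * star (χ x) * star (pd i W x) * H x := by
    intro i H hH
    have i1 : Integrable fun x => (pd i χ * star χ * star W) x * H x :=
      I (((hpχ i).mul hχs).mul hWs) hH ((hcp i).mul_right).mul_right
    have i2 : Integrable fun x => (χ * star (pd i χ) * star W) x * H x :=
      I ((hχ.mul (contDiff_star (hpχ i))).mul hWs) hH (hc.mul_right).mul_right
    have i3 : Integrable fun x => (χ * star χ * star (pd i W)) x * H x :=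
      I ((hχ.mul hχs).mul (contDiff_star (hpW i))) hH (hc.mul_right).mul_right
    refine ⟨(∫ x, (pd i χ * star χ * star W) x * H x) + ∫ x, (χ * star (pd i χ) * star W) x * H x,
      ?_, ?_⟩
    · have b1 : ‖∫ x, (pd i χ * star χ * star W) x * H x‖ ≤ nrm (pd i χ * W) * nrm (χ * H) :=
        norm_integral_le_nrm_mul (L2 (hpχ i) hW (hcp i)) (L2 hχ hH hc) fun x => by
          simp only [Pi.mul_apply, Pi.star_apply, norm_mul, norm_star]; ring
      have b2 : ‖∫ x, (χ * star (pd i χ) * star W) x * H x‖ ≤ nrm (pd i χ * W) * nrm (χ * H) :=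
        norm_integral_le_nrm_mul (L2 (hpχ i) hW (hcp i)) (L2 hχ hH hc) fun x => by
          simp only [Pi.mul_apply, Pi.star_apply, norm_mul, norm_star]; ring
      refine (norm_add_le _ _).trans ?_
      linarith
    · rw [← integral_add i1 i2]
      refine Eq.trans ?_ (integral_add (i1.add i2) i3)
      congr 1
      funext x
      simp only [hpa, Pi.add_apply, Pi.mul_apply, Pi.star_apply]
      ring
  choose z hz hz' using split
  have hsq : ∀ i, ∫ x, χ x * star (χ x) * star (pd i W x) * pd i W x
      = ((nrm (χ * pd i W) ^ 2 : ℝ) : ℂ) := by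
    intro i
    rw [← integral_star_mul_self (L2 hχ (hpW i) hc)]
    congr 1
    funext x
    simp only [Pi.mul_apply, star_mul']
    ring
  have hsum : ∫ x, a x * lap W x = -∑ i, (z i (pd i W) (hpW i) + ((nrm (χ * pd i W) ^ 2 : ℝ) : ℂ)) := by
    have e : (fun x => a x * lap W x) = fun x => ∑ i, a x * pd i (pd i W) x := by
      funext x
      simp [lap, Finset.mul_sum]
    rw [e, integral_finsetSum _ fun i _ => I hac (contDiff_pd (hpW i) i) haK,
      ← Finset.sum_neg_distrib]
    refine Finset.sum_congr rfl fun i _ => ?_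
    rw [integral_mul_pd hac (hpW i) haK, hz' i (pd i W) (hpW i), hsq]
  have hrhs : ∫ x, a x * lap W x = (∫ x, a x * F x) -
      (z j G hG + ∫ x, χ x * star (χ x) * star (pd j W x) * G x) := by
    rw [← hz', ← neg_neg (∫ x, pd j a x * G x), ← integral_mul_pd hac hG haK, sub_neg_eq_add,
      ← integral_add (I hac hF haK) (I hac (contDiff_pd hG j) haK)]
    congr 1
    funext x
    rw [hlap, Pi.add_apply, mul_add]
  have bF : ‖∫ x, a x * F x‖ ≤ nrm (χ * W) * nrm (χ * F) :=
    norm_integral_le_nrm_mul (L2 hχ hW hc) (L2 hχ hF hc) fun x => by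
      simp only [ha, Pi.mul_apply, Pi.star_apply, norm_mul, norm_star]; ring
  have bG : ‖∫ x, χ x * star (χ x) * star (pd j W x) * G x‖ ≤ nrm (χ * pd j W) * nrm (χ * G) :=
    norm_integral_le_nrm_mul (L2 hχ (hpW j) hc) (L2 hχ hG hc) fun x => by
      simp only [Pi.mul_apply, norm_mul, norm_star]; ring
  have key : ((∑ i, nrm (χ * pd i W) ^ 2 : ℝ) : ℂ) = -(∫ x, a x * F x) + z j G hG
      + (∫ x, χ x * star (χ x) * star (pd j W x) * G x) - ∑ i, z i (pd i W) (hpW i) := by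
    rw [hrhs, Finset.sum_add_distrib] at hsum
    push_cast at hsum ⊢
    linear_combination hsum
  have hnn : 0 ≤ ∑ i, nrm (χ * pd i W) ^ 2 := Finset.sum_nonneg fun i _ => by positivity
  have hnorm := congrArg norm key
  rw [Complex.norm_real, Real.norm_of_nonneg hnn] at hnorm
  have hz3 : ‖∑ i, z i (pd i W) (hpW i)‖ ≤ 2 * ∑ i, nrm (pd i χ * W) * nrm (χ * pd i W) := by
    refine (norm_sum_le _ _).trans ?_
    rw [Finset.mul_sum]
    exact Finset.sum_le_sum fun i _ => (hz i _ _).trans_eq (by ring)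
  rw [hnorm]
  refine (norm_sub_le _ _).trans ?_
  have h4 := norm_add₃_le (a := -(∫ x, a x * F x)) (b := z j G hG)
    (c := ∫ x, χ x * star (χ x) * star (pd j W x) * G x)
  rw [norm_neg] at h4
  have h5 := hz j G hG
  linarith

/-- For every smooth cut-off `χ` supported in the ball of radius `R`, the norms `‖χ wᵢ‖` are
bounded by a constant times `bᵢ`. -/
def LocBdd {ι : Type*} (R : ℝ) (w : ι → E3 → ℂ) (b : ι → ℝ) : Prop :=
  ∀ χ : E3 → ℂ, ContDiff ℝ ∞ χ → tsupport χ ⊆ Metric.closedBall 0 R →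
    ∃ C : ℝ, 0 ≤ C ∧ ∀ i, nrm (χ * w i) ≤ C * b i

theorem hasCompactSupport_of_subset {χ : E3 → ℂ} {R : ℝ}
    (h : tsupport χ ⊆ Metric.closedBall 0 R) : HasCompactSupport χ :=
  (isCompact_closedBall (0 : E3) R).of_isClosed_subset (isClosed_tsupport _) h

theorem memLp_mul {χ w : E3 → ℂ} {R : ℝ} (hχ : ContDiff ℝ ∞ χ)
    (h : tsupport χ ⊆ Metric.closedBall 0 R) (hw : ContDiff ℝ ∞ w) : MemLp (χ * w) 2 volume :=
  memLp_of_hasCompactSupport (hχ.continuous.mul hw.continuous)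
    (hasCompactSupport_of_subset h).mul_right

section LocBdd

variable {ι : Type*} {R : ℝ}

theorem LocBdd.mono {w : ι → E3 → ℂ} {b c : ι → ℝ} (h : LocBdd R w b) {D : ℝ} (hD : 0 ≤ D)
    (hbc : ∀ i, b i ≤ D * c i) : LocBdd R w c := by
  intro χ hχ hs
  obtain ⟨C, hC, H⟩ := h χ hχ hs
  refine ⟨C * D, by positivity, fun i => (H i).trans ?_⟩
  rw [mul_assoc]
  exact mul_le_mul_of_nonneg_left (hbc i) hC

theorem locBdd_zero (b : ι → ℝ) : LocBdd R (fun _ => 0) b := by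
  intro χ _ _
  exact ⟨0, le_rfl, fun i => by simp [nrm]⟩

theorem LocBdd.add {v w : ι → E3 → ℂ} {b : ι → ℝ} (hv : LocBdd R v b) (hw : LocBdd R w b)
    (cv : ∀ i, ContDiff ℝ ∞ (v i)) (cw : ∀ i, ContDiff ℝ ∞ (w i)) :
    LocBdd R (fun i => v i + w i) b := by
  intro χ hχ hs
  obtain ⟨C, hC, H⟩ := hv χ hχ hs
  obtain ⟨D, hD, K⟩ := hw χ hχ hs
  refine ⟨C + D, by positivity, fun i => ?_⟩
  rw [mul_add, add_mul]
  exact (nrm_add_le (memLp_mul hχ hs (cv i)) (memLp_mul hχ hs (cw i))).trans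
    (add_le_add (H i) (K i))

theorem LocBdd.smul {w : ι → E3 → ℂ} {b : ι → ℝ} (hw : LocBdd R w b) (c : ι → ℂ) :
    LocBdd R (fun i => c i • w i) (fun i => ‖c i‖ * b i) := by
  intro χ hχ hs
  obtain ⟨C, hC, H⟩ := hw χ hχ hs
  refine ⟨C, hC, fun i => ?_⟩
  rw [mul_smul_comm, nrm_const_smul]
  calc _ ≤ ‖c i‖ * (C * b i) := by gcongr; exact H i
    _ = _ := by ring

/-- Interior gradient estimate for `Δw = F + ∂ⱼG`. -/
theorem LocBdd.pd {w F G : ι → E3 → ℂ} {b M : ι → ℝ} (cw : ∀ i, ContDiff ℝ ∞ (w i))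
    (cF : ∀ i, ContDiff ℝ ∞ (F i)) (cG : ∀ i, ContDiff ℝ ∞ (G i)) (j : Fin 3)
    (hlap : ∀ i, lap (w i) = F i + Biharmonic.pd j (G i)) (hb : ∀ i, 0 ≤ b i) (hM : ∀ i, 1 ≤ M i)
    (hw : LocBdd R w b) (hF : LocBdd R F fun i => b i * M i ^ 2)
    (hG : LocBdd R G fun i => b i * M i) (k : Fin 3) :
    LocBdd R (fun i => Biharmonic.pd k (w i)) fun i => b i * M i := by
  intro χ hχ hs
  have hsp : ∀ k, tsupport (Biharmonic.pd k χ) ⊆ Metric.closedBall 0 R := fun k =>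
    (tsupport_pd_subset χ k).trans hs
  obtain ⟨C, hC, H⟩ := hw χ hχ hs
  obtain ⟨D, hD, K⟩ := hF χ hχ hs
  obtain ⟨E, hE, L⟩ := hG χ hχ hs
  choose P hP Q using fun k => hw (Biharmonic.pd k χ) (contDiff_pd hχ k) (hsp k)
  set S := C + D + E + ∑ k, P k with hS
  have hP0 : 0 ≤ ∑ k, P k := Finset.sum_nonneg fun k _ => hP k
  have hS0 : 0 ≤ S := by positivity
  refine ⟨9 * S, by positivity, fun i => ?_⟩
  have hPS : ∀ k, P k ≤ S := fun k => by
    have := Finset.single_le_sum (fun k _ => hP k) (Finset.mem_univ k)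
    linarith
  have hbi := hb i
  have hMi := hM i
  set β := b i * M i with hβ
  have hbβ : b i ≤ β := by rw [hβ]; nlinarith
  have hβ0 : 0 ≤ β := hbi.trans hbβ
  have e1 : nrm (χ * w i) * nrm (χ * F i) ≤ (S * β) ^ 2 := by
    calc _ ≤ (C * b i) * (D * (b i * M i ^ 2)) :=
          mul_le_mul (H i) (K i) (nrm_nonneg _) (by positivity)
      _ = C * D * β ^ 2 := by rw [hβ]; ring
      _ ≤ S * S * β ^ 2 := by gcongr <;> linarith
      _ = _ := by ring
  have hGS : nrm (χ * G i) ≤ S * β := (L i).trans (by gcongr; linarith)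
  have hQ : ∀ k, nrm (Biharmonic.pd k χ * w i) ≤ S * β := fun k =>
    (Q k i).trans (mul_le_mul (hPS k) hbβ hbi hS0)
  have hen := energy_le hχ (hasCompactSupport_of_subset hs) (cw i) (cF i) (cG i) j (hlap i)
  set X : Fin 3 → ℝ := fun k => nrm (χ * Biharmonic.pd k (w i)) with hX
  have hX0 : ∀ k, 0 ≤ X k := fun k => nrm_nonneg _
  have e2 : 2 * nrm (Biharmonic.pd j χ * w i) * nrm (χ * G i) ≤ 2 * (S * β) ^ 2 := by
    calc _ ≤ 2 * (S * β) * (S * β) := by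
          have := nrm_nonneg (χ * G i)
          gcongr
          exact hQ j
      _ = _ := by ring
  have e3 : X j * nrm (χ * G i) ≤ (S * β) * ∑ k, X k := by
    rw [mul_comm]
    exact mul_le_mul hGS (Finset.single_le_sum (fun k _ => hX0 k) (Finset.mem_univ j)) (hX0 j)
      (by positivity)
  have e4 : ∑ k, nrm (Biharmonic.pd k χ * w i) * X k ≤ (S * β) * ∑ k, X k := by
    rw [Finset.mul_sum]
    exact Finset.sum_le_sum fun k _ => mul_le_mul_of_nonneg_right (hQ k) (hX0 k)
  have e5 : ∑ k, X k ^ 2 ≤ 3 * (S * β) ^ 2 + 3 * (S * β) * ∑ k, X k := by linarith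
  have e6 : (∑ k, X k) ^ 2 ≤ 3 * ∑ k, X k ^ 2 := by
    have := sq_sum_le_card_mul_sum_sq (s := (Finset.univ : Finset (Fin 3))) (f := X)
    simpa using this
  have hSβ : 0 ≤ S * β := by positivity
  have e7 : ∑ k, X k ≤ 10 * (S * β) := by
    by_contra hcon
    push Not at hcon
    nlinarith
  have e8 : X k ^ 2 ≤ (9 * (S * β)) ^ 2 := by
    have : X k ^ 2 ≤ ∑ k, X k ^ 2 :=
      Finset.single_le_sum (f := fun k => X k ^ 2) (fun k _ => by positivity) (Finset.mem_univ k)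
    nlinarith
  have e9 : X k ≤ 9 * (S * β) := le_of_sq_le_sq e8 (by positivity)
  change X k ≤ 9 * S * β
  linarith

theorem LocBdd.pd_pd {w : ι → E3 → ℂ} {b M : ι → ℝ} (cw : ∀ i, ContDiff ℝ ∞ (w i))
    (hb : ∀ i, 0 ≤ b i) (hM : ∀ i, 1 ≤ M i) (hw : LocBdd R w b)
    (hl : LocBdd R (fun i => lap (w i)) fun i => b i * M i ^ 2) :
    (∀ k, LocBdd R (fun i => Biharmonic.pd k (w i)) fun i => b i * M i) ∧
    ∀ k l, LocBdd R (fun i => Biharmonic.pd k (Biharmonic.pd l (w i))) fun i => b i * M i ^ 2 := by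
  have hM0 : ∀ i, 0 ≤ M i := fun i => zero_le_one.trans (hM i)
  have h1 : ∀ k, LocBdd R (fun i => Biharmonic.pd k (w i)) fun i => b i * M i := fun k =>
    LocBdd.pd (F := fun i => lap (w i)) (G := fun _ => 0) cw (fun i => contDiff_lap (cw i))
      (fun _ => contDiff_const) 0 (fun i => by
        have : Biharmonic.pd 0 (0 : E3 → ℂ) = 0 := by
          funext x; simp [Biharmonic.pd]
        rw [this, add_zero]) hb hM hw hl
      (locBdd_zero _) k
  refine ⟨h1, fun k l => ?_⟩
  have h2 := LocBdd.pd (w := fun i => Biharmonic.pd l (w i)) (F := fun _ => 0)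
    (G := fun i => lap (w i)) (b := fun i => b i * M i) (M := M) (R := R)
    (fun i => contDiff_pd (cw i) l)
    (fun _ => contDiff_const) (fun i => contDiff_lap (cw i)) l
    (fun i => by rw [lap_pd (cw i), zero_add]) (fun i => mul_nonneg (hb i) (hM0 i)) hM (h1 l)
    (locBdd_zero _)
    (hl.mono zero_le_one fun i => by rw [one_mul, mul_assoc, ← sq]) k
  exact h2.mono zero_le_one fun i => by rw [one_mul, mul_assoc, ← sq]

/-- Interior estimates of order four from bounds on `w`, `Δw`, `Δ²w`. -/
theorem LocBdd.pdl {w : ι → E3 → ℂ} {b M : ι → ℝ} (cw : ∀ i, ContDiff ℝ ∞ (w i))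
    (hb : ∀ i, 0 ≤ b i) (hM : ∀ i, 1 ≤ M i) (hw : LocBdd R w b)
    (hl : LocBdd R (fun i => lap (w i)) fun i => b i * M i ^ 2)
    (hll : LocBdd R (fun i => lap (lap (w i))) fun i => b i * M i ^ 4)
    (l : List (Fin 3)) (hlen : l.length ≤ 4) :
    LocBdd R (fun i => Biharmonic.pdl l (w i)) fun i => b i * M i ^ l.length := by
  have hb2 : ∀ i, 0 ≤ b i * M i ^ 2 := fun i => mul_nonneg (hb i) (sq_nonneg _)
  have A := LocBdd.pd_pd cw hb hM hw hl
  have B := LocBdd.pd_pd (w := fun i => lap (w i)) (fun i => contDiff_lap (cw i)) hb2 hM hl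
    (hll.mono zero_le_one fun i => le_of_eq (by ring))
  have C : ∀ k m, _ := fun k m => LocBdd.pd_pd (w := fun i => Biharmonic.pd k (Biharmonic.pd m (w i)))
    (b := fun i => b i * M i ^ 2) (M := M) (R := R)
    (fun i => contDiff_pd (contDiff_pd (cw i) m) k) hb2 hM (A.2 k m)
    (by
      have := B.2 k m
      refine (this.mono zero_le_one fun i => (one_mul _).ge : LocBdd R _ _) |> fun h => ?_
      convert h using 2 with i
      rw [lap_pd (contDiff_pd (cw i) m), lap_pd (cw i)])
  match l, hlen with
  | [], _ => simpa [Biharmonic.pdl] using hw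
  | [i₁], _ => simpa [Biharmonic.pdl] using A.1 i₁
  | [i₁, i₂], _ => simpa [Biharmonic.pdl] using A.2 i₁ i₂
  | [i₁, i₂, i₃], _ =>
    simp only [Biharmonic.pdl]
    exact ((C i₂ i₃).1 i₁).mono zero_le_one fun i => le_of_eq (by simp; ring)
  | [i₁, i₂, i₃, i₄], _ =>
    simp only [Biharmonic.pdl]
    exact ((C i₃ i₄).2 i₁ i₂).mono zero_le_one fun i => le_of_eq (by simp; ring)
  | _ :: _ :: _ :: _ :: _ :: _, h => simp at h; omega

theorem pdl_add {f g : E3 → ℂ} (hf : ContDiff ℝ ∞ f) (hg : ContDiff ℝ ∞ g) (l : List (Fin 3)) :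
    pdl l (f + g) = pdl l f + pdl l g := by
  induction l with
  | nil => rfl
  | cons i l ih =>
    simp only [pdl, ih]
    exact pd_add ((contDiff_pdl hf l).differentiable (by simp))
      ((contDiff_pdl hg l).differentiable (by simp)) i

/-- Derivatives of the products `χ wᵢ`. -/
theorem exists_nrm_pdl_mul_le {w : ι → E3 → ℂ} {b M : ι → ℝ} (cw : ∀ i, ContDiff ℝ ∞ (w i))
    (hb : ∀ i, 0 ≤ b i) (hM : ∀ i, 1 ≤ M i) {n : ℕ}
    (h : ∀ l : List (Fin 3), l.length ≤ n →
      LocBdd R (fun i => pdl l (w i)) fun i => b i * M i ^ l.length)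
    (l : List (Fin 3)) : ∀ l' : List (Fin 3), l.length + l'.length ≤ n →
    ∀ χ : E3 → ℂ, ContDiff ℝ ∞ χ → tsupport χ ⊆ Metric.closedBall 0 R →
    ∃ C : ℝ, 0 ≤ C ∧ ∀ i, nrm (pdl l (χ * pdl l' (w i))) ≤ C * (b i * M i ^ (l.length + l'.length)) := by
  induction l using List.reverseRecOn with
  | nil =>
    intro l' hl' χ hχ hs
    simpa [pdl] using h l' (by simpa using hl') χ hχ hs
  | append_singleton l k ih =>
    intro l' hl' χ hχ hs
    simp only [List.length_append, List.length_singleton] at hl' ⊢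
    obtain ⟨C, hC, H⟩ := ih l' (by omega) (pd k χ) (contDiff_pd hχ k)
      ((tsupport_pd_subset χ k).trans hs)
    obtain ⟨D, hD, K⟩ := ih (k :: l') (by simp; omega) χ hχ hs
    refine ⟨C + D, by positivity, fun i => ?_⟩
    have c1 := contDiff_pdl (cw i) l'
    have c2 : ContDiff ℝ ∞ (pdl (k :: l') (w i)) := contDiff_pdl (cw i) _
    have m1 : ContDiff ℝ ∞ (pd k χ * pdl l' (w i)) := (contDiff_pd hχ k).mul c1
    have m2 : ContDiff ℝ ∞ (χ * pdl (k :: l') (w i)) := hχ.mul c2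
    have s1 : HasCompactSupport (pd k χ * pdl l' (w i)) :=
      (hasCompactSupport_pd (hasCompactSupport_of_subset hs) k).mul_right
    have s2 : HasCompactSupport (χ * pdl (k :: l') (w i)) :=
      (hasCompactSupport_of_subset hs).mul_right
    have e : pdl (l ++ [k]) (χ * pdl l' (w i))
        = pdl l (pd k χ * pdl l' (w i)) + pdl l (χ * pdl (k :: l') (w i)) := by
      rw [pdl_append, ← pdl_add m1 m2]
      congr 1
      exact pd_mul (hχ.differentiable (by simp)) (c1.differentiable (by simp)) k
    rw [e]
    refine (nrm_add_le
      (memLp_of_hasCompactSupport (contDiff_pdl m1 l).continuous (hasCompactSupport_pdl s1 l))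
      (memLp_of_hasCompactSupport (contDiff_pdl m2 l).continuous (hasCompactSupport_pdl s2 l))).trans ?_
    have hMp : M i ^ (l.length + l'.length) ≤ M i ^ (l.length + 1 + l'.length) :=
      pow_le_pow_right₀ (hM i) (by omega)
    have hK := K i
    rw [List.length_cons, show l.length + (l'.length + 1) = l.length + 1 + l'.length by ring] at hK
    rw [add_mul]
    refine add_le_add ((H i).trans ?_) hK
    have := hb i
    gcongr

end LocBdd

/-! ### Regularity of convolutions with smooth functions -/

theorem kconv_eq_integral (k g : E3 → ℂ) (x : E3) : kconv k g x = ∫ t, k t * g (x - t) := by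
  rw [kconv, ← integral_sub_left_eq_self _ volume x]
  simp

theorem kconv_eq_convolution (k g : E3 → ℂ) :
    kconv k g = convolution k g (ContinuousLinearMap.mul ℝ ℂ) volume :=
  funext fun x => kconv_eq_integral k g x

theorem contDiff_kconv {k g : E3 → ℂ} (hk : LocL2 k) (hg : ContDiff ℝ ∞ g)
    (hc : HasCompactSupport g) : ContDiff ℝ ∞ (kconv k g) := by
  rw [kconv_eq_convolution]
  exact hc.contDiff_convolution_right _ hk.locallyIntegrable hg

theorem pd_kconv {k g : E3 → ℂ} (hk : LocL2 k) (hg : ContDiff ℝ ∞ g)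
    (hc : HasCompactSupport g) (i : Fin 3) : pd i (kconv k g) = kconv k (pd i g) := by
  funext x
  have h1 : ContDiff ℝ 1 g := hg.of_le (by exact_mod_cast le_top)
  rw [kconv_eq_convolution, kconv_eq_convolution, pd,
    (hc.hasFDerivAt_convolution_right _ hk.locallyIntegrable h1 x).fderiv,
    convolution_precompR_apply _ hk.locallyIntegrable (hc.fderiv ℝ)
      (h1.continuous_fderiv one_ne_zero)]
  rfl

theorem integrable_mul_comp_sub {k g : E3 → ℂ} (hk : LocL2 k) (hg : Continuous g)
    (hc : HasCompactSupport g) (x : E3) : Integrable fun t => k t * g (x - t) :=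
  hc.convolutionExists_right (ContinuousLinearMap.mul ℝ ℂ) hk.locallyIntegrable hg x

theorem lap_kconv {k g : E3 → ℂ} (hk : LocL2 k) (hg : ContDiff ℝ ∞ g)
    (hc : HasCompactSupport g) : lap (kconv k g) = kconv k (lap g) := by
  funext x
  have h : ∀ i, pd i (pd i (kconv k g)) x = kconv k (pd i (pd i g)) x := fun i => by
    rw [pd_kconv hk hg hc, pd_kconv hk (contDiff_pd hg i) (hasCompactSupport_pd hc i)]
  simp only [lap, h, kconv_eq_integral, Finset.mul_sum]
  rw [integral_finsetSum _ fun i _ => integrable_mul_comp_sub hk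
    (contDiff_pd (contDiff_pd hg i) i).continuous
    (hasCompactSupport_pd (hasCompactSupport_pd hc i) i) x]

theorem kconv_yukawa_helmholtz {κ : ℂ} {g : E3 → ℂ} (hg : ContDiff ℝ ∞ g)
    (h0 : ∀ x, Tame κ fun t => g (x - t)) (h1 : ∀ i x, Tame κ fun t => pd i g (x - t))
    (h2 : ∀ i x, Tame κ fun t => pd i (pd i g) (x - t)) :
    kconv (yukawa κ) (fun y => κ ^ 2 * g y - lap g y) = g := by
  funext x
  have e1 : ∀ i, pd i (fun t => g (x - t)) = (-1 : ℂ) • fun t => pd i g (x - t) := fun i => by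
    rw [pd_comp_const_sub, neg_one_smul]
  have e2 : ∀ i, pd i (pd i (fun t => g (x - t))) = fun t => pd i (pd i g) (x - t) := fun i => by
    rw [pd_comp_const_sub, pd_neg, pd_comp_const_sub, neg_neg]
  have h := integral_yukawa_mul_helmholtz (κ := κ) (g := fun t => g (x - t))
    ((contDiff_infty.1 hg 2).comp (contDiff_const.sub contDiff_id)) (h0 x)
    (fun i => by rw [e1]; exact (h1 i x).const_smul _) (fun i => by rw [e2]; exact h2 i x)
  rw [lap_comp_const_sub] at h
  simpa [kconv_eq_integral] using h

theorem tame_of_hasCompactSupport (κ : ℂ) {h : E3 → ℂ} (hh : Continuous h)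
    (hc : HasCompactSupport h) : Tame κ h := by
  have hcont : Continuous fun y : E3 =>
      ((Real.exp (-κ.re * ‖y‖) * (1 + ‖y‖) ^ 4 : ℝ) : ℂ) * h y := by fun_prop
  obtain ⟨C, hC⟩ := hcont.bounded_above_of_compact_support hc.mul_left
  refine ⟨C, fun y => ?_⟩
  have hp : 0 < 1 + ‖y‖ := by positivity
  have e : (1 + ‖y‖) ^ (-4 : ℝ) = ((1 + ‖y‖) ^ 4)⁻¹ := by
    rw [Real.rpow_neg hp.le]
    norm_cast
  rw [e, ← div_eq_mul_inv, le_div_iff₀ (by positivity)]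
  refine le_trans (le_of_eq ?_) (hC y)
  rw [norm_mul, Complex.norm_real, Real.norm_of_nonneg (by positivity)]
  ring

theorem hasCompactSupport_comp_const_sub {h : E3 → ℂ} (hc : HasCompactSupport h) (x : E3) :
    HasCompactSupport fun t => h (x - t) :=
  hc.comp_homeomorph (Homeomorph.subLeft x)

theorem lap_kconv_yukawa (κ : ℂ) {g : E3 → ℂ} (hg : ContDiff ℝ ∞ g) (hc : HasCompactSupport g) :
    lap (kconv (yukawa κ) g) = κ ^ 2 • kconv (yukawa κ) g - g := by
  have T : ∀ {h : E3 → ℂ}, ContDiff ℝ ∞ h → HasCompactSupport h →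
      ∀ x, Tame κ fun t => h (x - t) := fun hh hch x =>
    tame_of_hasCompactSupport κ (hh.continuous.comp (continuous_const.sub continuous_id))
      (hasCompactSupport_comp_const_sub hch x)
  have h := kconv_yukawa_helmholtz (κ := κ) hg (T hg hc)
    (fun i => T (contDiff_pd hg i) (hasCompactSupport_pd hc i))
    (fun i => T (contDiff_pd (contDiff_pd hg i) i)
      (hasCompactSupport_pd (hasCompactSupport_pd hc i) i))
  rw [lap_kconv (locL2_yukawa κ) hg hc]
  funext x
  have hx := congrFun h x
  have hlc : HasCompactSupport (lap g) := by
    refine HasCompactSupport.intro hc fun x hx => Finset.sum_eq_zero fun i _ => ?_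
    exact image_eq_zero_of_notMem_tsupport fun h =>
      hx (tsupport_pd_subset _ i (tsupport_pd_subset _ i h))
  have i1 := integrable_mul_comp_sub (locL2_yukawa κ) hg.continuous hc x
  have i2 := integrable_mul_comp_sub (locL2_yukawa κ) (contDiff_lap hg).continuous hlc x
  rw [kconv_eq_integral] at hx
  have e : (fun t => yukawa κ t * (κ ^ 2 * g (x - t) - lap g (x - t))) =
      fun t => κ ^ 2 * (yukawa κ t * g (x - t)) - yukawa κ t * lap g (x - t) := by
    funext t; ring
  rw [e, integral_sub (i1.const_mul _) i2, integral_const_mul] at hx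
  simp only [Pi.sub_apply, Pi.smul_apply, kconv_eq_integral, smul_eq_mul]
  linear_combination -hx

/-! ### The smooth solutions `R₀(z) g` -/

/-- The growth factor in the resolvent estimate. -/
def growth (R : ℝ) (z : ℂ) : ℝ :=
  Real.exp (2 * R * max (-z.im) 0) + Real.exp (2 * R * max (-z.re) 0)

theorem one_le_growth {R : ℝ} (hR : 0 ≤ R) (z : ℂ) : 1 ≤ growth R z := by
  have h1 : 1 ≤ Real.exp (2 * R * max (-z.im) 0) := Real.one_le_exp (by positivity)
  have h2 := Real.exp_pos (2 * R * max (-z.re) 0)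
  unfold growth
  linarith

/-- `R₀(z) g`, as a function. -/
def freeSol (z : ℂ) (g : E3 → ℂ) : E3 → ℂ :=
  (2 * z ^ 2)⁻¹ • (kconv (yukawa (-Complex.I * z)) g + (-1 : ℂ) • kconv (yukawa z) g)

theorem contDiff_add {f g : E3 → ℂ} (hf : ContDiff ℝ ∞ f) (hg : ContDiff ℝ ∞ g) :
    ContDiff ℝ ∞ (f + g) :=
  hf.add hg

theorem contDiff_const_smul {f : E3 → ℂ} (hf : ContDiff ℝ ∞ f) (c : ℂ) : ContDiff ℝ ∞ (c • f) :=
  hf.const_smul c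

theorem contDiff_freeSol (z : ℂ) {g : E3 → ℂ} (hg : ContDiff ℝ ∞ g) (hc : HasCompactSupport g) :
    ContDiff ℝ ∞ (freeSol z g) :=
  contDiff_const_smul ((contDiff_kconv (locL2_yukawa _) hg hc).add
    (contDiff_const_smul (contDiff_kconv (locL2_yukawa _) hg hc) _)) _

theorem lap_freeSol {z : ℂ} (hz : z ≠ 0) {g : E3 → ℂ} (hg : ContDiff ℝ ∞ g)
    (hc : HasCompactSupport g) : lap (freeSol z g) =
      (-(1 / 2) : ℂ) • (kconv (yukawa (-Complex.I * z)) g + kconv (yukawa z) g) := by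
  have c : ∀ κ, ContDiff ℝ ∞ (kconv (yukawa κ) g) := fun κ =>
    contDiff_kconv (locL2_yukawa κ) hg hc
  rw [freeSol, lap_const_smul (contDiff_add (c _) (contDiff_const_smul (c _) _)),
    lap_add (c _) (contDiff_const_smul (c _) _), lap_const_smul (c _), lap_kconv_yukawa _ hg hc,
    lap_kconv_yukawa _ hg hc]
  funext x
  simp only [Pi.smul_apply, Pi.add_apply, Pi.sub_apply, smul_eq_mul]
  field_simp
  rw [Complex.I_sq]
  ring

theorem lap_lap_freeSol {z : ℂ} (hz : z ≠ 0) {g : E3 → ℂ} (hg : ContDiff ℝ ∞ g)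
    (hc : HasCompactSupport g) : lap (lap (freeSol z g)) = z ^ 4 • freeSol z g + g := by
  have c : ∀ κ, ContDiff ℝ ∞ (kconv (yukawa κ) g) := fun κ =>
    contDiff_kconv (locL2_yukawa κ) hg hc
  rw [lap_freeSol hz hg hc, lap_const_smul (contDiff_add (c _) (c _)), lap_add (c _) (c _),
    lap_kconv_yukawa _ hg hc, lap_kconv_yukawa _ hg hc, freeSol]
  funext x
  simp only [Pi.smul_apply, Pi.add_apply, Pi.sub_apply, smul_eq_mul]
  field_simp
  rw [Complex.I_sq]
  ring

section Family

variable {ι : Type*} {R : ℝ} {z : ι → ℂ} {g : ι → E3 → ℂ}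

theorem locBdd_kconv_yukawa {κ : ι → ℂ} (hg : ∀ i, ContDiff ℝ ∞ (g i))
    (hs : ∀ i, tsupport (g i) ⊆ Metric.closedBall 0 R) :
    LocBdd R (fun i => kconv (yukawa (κ i)) (g i))
      fun i => Real.exp (2 * R * max (-(κ i).re) 0) * nrm (g i) := by
  intro χ hχ hsχ
  refine ⟨ballNorm (yukawa 0) (R + R) * nrm χ,
    mul_nonneg (ballNorm_nonneg _ _) (nrm_nonneg _), fun i => ?_⟩
  set c := ballNorm (yukawa (κ i)) (R + R) * nrm (g i) with hc
  have hc0 : 0 ≤ c := mul_nonneg (ballNorm_nonneg _ _) (nrm_nonneg _)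
  have hm : MemLp χ 2 volume :=
    memLp_of_hasCompactSupport hχ.continuous (hasCompactSupport_of_subset hsχ)
  have hgm : MemLp (g i) 2 volume :=
    memLp_of_hasCompactSupport (hg i).continuous (hasCompactSupport_of_subset (hs i))
  have h1 : nrm (χ * kconv (yukawa (κ i)) (g i)) ≤ nrm ((c : ℂ) • χ) := by
    refine nrm_mono (hm.const_smul _) fun x => ?_
    rw [Pi.mul_apply, Pi.smul_apply, norm_smul, norm_mul, Complex.norm_real,
      Real.norm_of_nonneg hc0, mul_comm]
    by_cases hx : x ∈ Metric.closedBall 0 R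
    · refine mul_le_mul_of_nonneg_right ?_ (norm_nonneg _)
      refine (integrable_kconv_and_norm_le (locL2_yukawa _) hgm (a := R) (b := R)
        (Filter.Eventually.of_forall fun y hy => ?_) (by simpa using hx)).2
      exact image_eq_zero_of_notMem_tsupport fun h => hy (hs i h)
    · rw [image_eq_zero_of_notMem_tsupport fun h => hx (hsχ h)]
      simp
  rw [nrm_const_smul, Complex.norm_real, Real.norm_of_nonneg hc0] at h1
  refine h1.trans ?_
  have h2 := ballNorm_yukawa_le (κ i) (R + R)
  have h3 := nrm_nonneg (g i)
  have h4 := nrm_nonneg χ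
  calc c * nrm χ ≤ Real.exp ((R + R) * max (-(κ i).re) 0) * ballNorm (yukawa 0) (R + R) *
        nrm (g i) * nrm χ := by
        rw [hc]
        gcongr
    _ = _ := by rw [← two_mul]; ring

theorem exists_nrm_pdl_mul_freeSol_le_family (hR : 0 ≤ R) (hz : ∀ i, z i ≠ 0)
    (hg : ∀ i, ContDiff ℝ ∞ (g i)) (hs : ∀ i, tsupport (g i) ⊆ Metric.closedBall 0 R)
    {χ : E3 → ℂ} (hχ : ContDiff ℝ ∞ χ) (hsχ : tsupport χ ⊆ Metric.closedBall 0 R)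
    (l : List (Fin 3)) (hl : l.length ≤ 4) :
    ∃ C : ℝ, 0 ≤ C ∧ ∀ i, nrm (pdl l (χ * freeSol (z i) (g i))) ≤
      C * ((‖z i‖ ^ 2)⁻¹ * (growth R (z i) * nrm (g i)) * √(1 + ‖z i‖ ^ 2) ^ l.length) := by
  have hgc : ∀ i, HasCompactSupport (g i) := fun i => hasCompactSupport_of_subset (hs i)
  set b : ι → ℝ := fun i => (‖z i‖ ^ 2)⁻¹ * (growth R (z i) * nrm (g i)) with hb
  set M : ι → ℝ := fun i => √(1 + ‖z i‖ ^ 2) with hM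
  have hE : ∀ i, 1 ≤ growth R (z i) := fun i => one_le_growth hR _
  have hzp : ∀ i, 0 < ‖z i‖ ^ 2 := fun i => by
    have := norm_pos_iff.2 (hz i)
    positivity
  have hM2 : ∀ i, M i ^ 2 = 1 + ‖z i‖ ^ 2 := fun i => Real.sq_sqrt (by positivity)
  have hM1 : ∀ i, 1 ≤ M i := fun i => Real.one_le_sqrt.2 (by nlinarith [hzp i])
  have hn : ∀ i, 0 ≤ growth R (z i) * nrm (g i) := fun i =>
    mul_nonneg (zero_le_one.trans (hE i)) (nrm_nonneg _)
  have hb0 : ∀ i, 0 ≤ b i := fun i => mul_nonneg (inv_nonneg.2 (hzp i).le) (hn i)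
  have hbz : ∀ i, growth R (z i) * nrm (g i) = ‖z i‖ ^ 2 * b i := fun i => by
    rw [hb]
    exact (mul_inv_cancel_left₀ (hzp i).ne' _).symm
  have cu : ∀ i, ContDiff ℝ ∞ (freeSol (z i) (g i)) := fun i => contDiff_freeSol _ (hg i) (hgc i)
  have c1 : ∀ (κ : ι → ℂ) i, ContDiff ℝ ∞ (kconv (yukawa (κ i)) (g i)) := fun κ i =>
    contDiff_kconv (locL2_yukawa _) (hg i) (hgc i)
  have k1 : LocBdd R (fun i => kconv (yukawa (-Complex.I * z i)) (g i))
      fun i => growth R (z i) * nrm (g i) :=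
    (locBdd_kconv_yukawa (κ := fun i => -Complex.I * z i) hg hs).mono zero_le_one fun i => by
      rw [one_mul]
      refine mul_le_mul_of_nonneg_right ?_ (nrm_nonneg _)
      have := Real.exp_pos (2 * R * max (-(z i).re) 0)
      simp only [growth, neg_mul, Complex.neg_re, Complex.I_mul_re, neg_neg]
      linarith
  have k2 : LocBdd R (fun i => kconv (yukawa (z i)) (g i))
      fun i => growth R (z i) * nrm (g i) :=
    (locBdd_kconv_yukawa (κ := z) hg hs).mono zero_le_one fun i => by
      rw [one_mul]
      refine mul_le_mul_of_nonneg_right ?_ (nrm_nonneg _)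
      have := Real.exp_pos (2 * R * max (-(z i).im) 0)
      simp only [growth]
      linarith
  have k3 : LocBdd R g fun i => growth R (z i) * nrm (g i) := by
    intro φ hφ hsφ
    obtain ⟨B, hB⟩ := hφ.continuous.bounded_above_of_compact_support
      (hasCompactSupport_of_subset hsφ)
    refine ⟨|B|, abs_nonneg B, fun i => ?_⟩
    have hm : MemLp (g i) 2 volume := memLp_of_hasCompactSupport (hg i).continuous (hgc i)
    have h1 : nrm (φ * g i) ≤ nrm ((B : ℂ) • g i) :=
      nrm_mono (hm.const_smul _) fun x => by
        rw [Pi.mul_apply, Pi.smul_apply, norm_smul, norm_mul, Complex.norm_real]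
        exact mul_le_mul_of_nonneg_right ((hB x).trans (le_abs_self B)) (norm_nonneg _)
    rw [nrm_const_smul, Complex.norm_real, Real.norm_eq_abs] at h1
    refine h1.trans (mul_le_mul_of_nonneg_left ?_ (abs_nonneg B))
    exact le_mul_of_one_le_left (nrm_nonneg _) (hE i)
  have hu : LocBdd R (fun i => freeSol (z i) (g i)) b := by
    have h := (k1.add ((k2.smul fun _ => (-1 : ℂ)).mono zero_le_one fun i => by
      rw [one_mul, norm_neg, norm_one, one_mul]) (c1 _)
      (fun i => contDiff_const_smul (c1 z i) _)).smul fun i => (2 * z i ^ 2)⁻¹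
    refine h.mono zero_le_one fun i => ?_
    rw [norm_inv, norm_mul, norm_pow, one_mul]
    refine mul_le_mul_of_nonneg_right ?_ (hn i)
    refine inv_anti₀ (hzp i) ?_
    have := hzp i
    norm_num
    linarith
  have hl2 : LocBdd R (fun i => lap (freeSol (z i) (g i))) fun i => b i * M i ^ 2 := by
    have h := (k1.add k2 (c1 _) (c1 z)).smul fun _ => (-(1 / 2) : ℂ)
    simp_rw [← fun i => lap_freeSol (hz i) (hg i) (hgc i)] at h
    refine h.mono zero_le_one fun i => ?_
    rw [hM2, hbz, one_mul]
    have := hb0 i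
    have h2 := mul_nonneg (hzp i).le (hb0 i)
    norm_num
    nlinarith
  have hl4 : LocBdd R (fun i => lap (lap (freeSol (z i) (g i)))) fun i => b i * M i ^ 4 := by
    have h4 : ∀ i, M i ^ 4 = (1 + ‖z i‖ ^ 2) ^ 2 := fun i => by rw [← hM2]; ring
    have h := ((hu.smul fun i => z i ^ 4).mono (c := fun i => b i * M i ^ 4) zero_le_one
      fun i => ?_).add (k3.mono (c := fun i => b i * M i ^ 4) zero_le_one fun i => ?_)
      (fun i => contDiff_const_smul (cu i) _) hg
    · simp_rw [← fun i => lap_lap_freeSol (hz i) (hg i) (hgc i)] at h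
      exact h
    · rw [h4, one_mul, norm_pow, mul_comm]
      refine mul_le_mul_of_nonneg_left ?_ (hb0 i)
      nlinarith [hzp i]
    · rw [h4, one_mul, hbz, mul_comm]
      refine mul_le_mul_of_nonneg_left ?_ (hb0 i)
      nlinarith [hzp i]
  obtain ⟨C, hC, H⟩ := exists_nrm_pdl_mul_le cu hb0 hM1 (n := 4)
    (fun l hl => LocBdd.pdl cu hb0 hM1 hu hl2 hl4 l hl) l [] (by simpa using hl) χ hχ hsχ
  exact ⟨C, hC, fun i => by simpa [pdl] using H i⟩

end Family

theorem exists_nrm_pdl_mul_freeSol_le {R : ℝ} (hR : 0 ≤ R) {χ : E3 → ℂ} (hχ : ContDiff ℝ ∞ χ)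
    (hsχ : tsupport χ ⊆ Metric.closedBall 0 R) (l : List (Fin 3)) (hl : l.length ≤ 4) :
    ∃ C : ℝ, 0 ≤ C ∧ ∀ z : ℂ, z ≠ 0 → ∀ g : E3 → ℂ, ContDiff ℝ ∞ g →
      tsupport g ⊆ Metric.closedBall 0 R → nrm (pdl l (χ * freeSol z g)) ≤
      C * ((‖z‖ ^ 2)⁻¹ * (growth R z * nrm g) * √(1 + ‖z‖ ^ 2) ^ l.length) := by
  obtain ⟨C, hC, H⟩ := exists_nrm_pdl_mul_freeSol_le_family
    (ι := {p : ℂ × (E3 → ℂ) // p.1 ≠ 0 ∧ ContDiff ℝ ∞ p.2 ∧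
      tsupport p.2 ⊆ Metric.closedBall 0 R}) (z := fun p => p.1.1) (g := fun p => p.1.2) hR
    (fun p => p.2.1) (fun p => p.2.2.1) (fun p => p.2.2.2) hχ hsχ l hl
  exact ⟨C, hC, fun z hz g hg hs => H ⟨(z, g), hz, hg, hs⟩⟩

/-! ### Sobolev estimates for the cut-off resolvent -/

theorem kconv_add {k f g : E3 → ℂ} (hk : LocL2 k) (hf : Continuous f) (hg : Continuous g)
    (hfc : HasCompactSupport f) (hgc : HasCompactSupport g) :
    kconv k (f + g) = kconv k f + kconv k g := by
  funext x
  simp only [Pi.add_apply, kconv_eq_integral, mul_add]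
  exact integral_add (integrable_mul_comp_sub hk hf hfc x) (integrable_mul_comp_sub hk hg hgc x)

theorem kconv_const_smul (k f : E3 → ℂ) (c : ℂ) : kconv k (c • f) = c • kconv k f := by
  funext x
  simp only [Pi.smul_apply, kconv, smul_eq_mul, ← integral_const_mul]
  congr 1
  funext y
  ring

theorem freeSol_add (z : ℂ) {f g : E3 → ℂ} (hf : Continuous f) (hg : Continuous g)
    (hfc : HasCompactSupport f) (hgc : HasCompactSupport g) :
    freeSol z (f + g) = freeSol z f + freeSol z g := by
  rw [freeSol, kconv_add (locL2_yukawa _) hf hg hfc hgc, kconv_add (locL2_yukawa _) hf hg hfc hgc,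
    freeSol, freeSol]
  module

theorem freeSol_const_smul (z c : ℂ) (f : E3 → ℂ) : freeSol z (c • f) = c • freeSol z f := by
  rw [freeSol, kconv_const_smul, kconv_const_smul, freeSol]
  module

theorem pdl_const_smul {f : E3 → ℂ} (hf : ContDiff ℝ ∞ f) (c : ℂ) (l : List (Fin 3)) :
    pdl l (c • f) = c • pdl l f := by
  induction l with
  | nil => rfl
  | cons i l ih =>
    simp only [pdl, ih]
    exact pd_const_smul ((contDiff_pdl hf l).differentiable (by simp)) c i

/-- The linear functional `f ↦ ∫ f φ` on `L²(ℝ³)`. -/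
def pairing {φ : E3 → ℂ} (hφ : MemLp φ 2 volume) : L2 →L[ℂ] ℂ :=
  innerSL ℂ (hφ.star.toLp (star φ))

theorem pairing_apply {φ : E3 → ℂ} (hφ : MemLp φ 2 volume) (f : L2) :
    pairing hφ f = ∫ x, f x * φ x := by
  rw [pairing, innerSL_apply_apply, L2.inner_def]
  apply integral_congr_ae
  filter_upwards [hφ.star.coeFn_toLp] with x h1
  simp [h1]

theorem cutoff_freeRes_coe (ρ : 𝓓((⊤ : Opens E3), ℂ)) (z : ℂ) (f : L2) :
    (cutoff ρ (freeRes z) f : L2) =ᵐ[volume] fun x => ρ x * freeSol z (fun y => ρ y * f y) x := by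
  rw [freeRes, cutoff_smul, cutoff_add, cutoff_smul]
  simp only [LinearMap.smul_apply, LinearMap.add_apply]
  have h1 := cutoff_convOp_coe ρ (locL2_yukawa (-Complex.I * z)) f
  have h2 := cutoff_convOp_coe ρ (locL2_yukawa z) f
  filter_upwards [h1, h2, Lp.coeFn_smul (2 * z ^ 2)⁻¹
    (cutoff ρ (convOp _ (locL2_yukawa (-Complex.I * z))) f +
      (-1 : ℂ) • cutoff ρ (convOp _ (locL2_yukawa z)) f),
    Lp.coeFn_add (cutoff ρ (convOp _ (locL2_yukawa (-Complex.I * z))) f)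
      ((-1 : ℂ) • cutoff ρ (convOp _ (locL2_yukawa z)) f),
    Lp.coeFn_smul (-1 : ℂ) (cutoff ρ (convOp _ (locL2_yukawa z)) f)] with x h1 h2 h3 h4 h5
  rw [h3, Pi.smul_apply, h4, Pi.add_apply, h5, Pi.smul_apply, h1, h2]
  simp only [freeSol, Pi.smul_apply, Pi.add_apply, smul_eq_mul]
  ring

theorem contDiff_schwartz (h : SchwartzMap E3 ℂ) : ContDiff ℝ ∞ h := h.smooth _

theorem contDiff_mul_freeSol {ρ : E3 → ℂ} (hρ : ContDiff ℝ ∞ ρ) (hc : HasCompactSupport ρ) (z : ℂ) (h : SchwartzMap E3 ℂ) :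
    ContDiff ℝ ∞ (ρ * freeSol z (ρ * h)) :=
  hρ.mul (contDiff_freeSol z (hρ.mul (contDiff_schwartz h)) hc.mul_right)

theorem memLp_pdl_mul_freeSol {ρ : E3 → ℂ} (hρ : ContDiff ℝ ∞ ρ) (hc : HasCompactSupport ρ) (z : ℂ) (l : List (Fin 3)) (h : SchwartzMap E3 ℂ) :
    MemLp (pdl l (ρ * freeSol z (ρ * h))) 2 volume :=
  memLp_of_hasCompactSupport (contDiff_pdl (contDiff_mul_freeSol hρ hc z h) l).continuous
    (hasCompactSupport_pdl hc.mul_right l)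

/-- The derivatives of `ρ R₀(z) ρ h`, for Schwartz functions `h`. -/
def derivSol {ρ : E3 → ℂ} (hρ : ContDiff ℝ ∞ ρ) (hc : HasCompactSupport ρ) (z : ℂ) (l : List (Fin 3)) : SchwartzMap E3 ℂ →ₗ[ℂ] L2 where
  toFun h := (memLp_pdl_mul_freeSol hρ hc z l h).toLp
  map_add' f g := by
    rw [← MemLp.toLp_add]
    refine MemLp.toLp_congr _ _ (Filter.EventuallyEq.of_eq ?_)
    have e : ρ * ⇑(f + g) = ρ * ⇑f + ρ * ⇑g := by
      funext x; simp [mul_add]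
    have hf : ContDiff ℝ ∞ (ρ * ⇑f) := hρ.mul (contDiff_schwartz f)
    have hg : ContDiff ℝ ∞ (ρ * ⇑g) := hρ.mul (contDiff_schwartz g)
    rw [e, freeSol_add z hf.continuous hg.continuous hc.mul_right hc.mul_right, mul_add,
      pdl_add (contDiff_mul_freeSol hρ hc z f) (contDiff_mul_freeSol hρ hc z g)]
  map_smul' c f := by
    rw [RingHom.id_apply, ← MemLp.toLp_const_smul]
    refine MemLp.toLp_congr _ _ (Filter.EventuallyEq.of_eq ?_)
    have e : ρ * ⇑(c • f) = c • (ρ * ⇑f) := by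
      funext x
      simp only [Pi.mul_apply, smul_apply, Pi.smul_apply, smul_eq_mul]
      ring
    rw [e, freeSol_const_smul, mul_smul_comm, pdl_const_smul (contDiff_mul_freeSol hρ hc z f)]

theorem derivSol_coe {ρ : E3 → ℂ} (hρ : ContDiff ℝ ∞ ρ) (hc : HasCompactSupport ρ) (z : ℂ) (l : List (Fin 3)) (h : SchwartzMap E3 ℂ) :
    (derivSol hρ hc z l h : L2) =ᵐ[volume] pdl l (ρ * freeSol z (ρ * h)) :=
  (memLp_pdl_mul_freeSol hρ hc z l h).coeFn_toLp

theorem exists_norm_derivSol_le {ρ : E3 → ℂ} (hρ : ContDiff ℝ ∞ ρ) (hc : HasCompactSupport ρ) {R : ℝ} (hR : 0 ≤ R) (hs : tsupport ρ ⊆ Metric.closedBall 0 R)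
    (l : List (Fin 3)) (hl : l.length ≤ 4) :
    ∃ C : ℝ, 0 ≤ C ∧ ∀ z : ℂ, z ≠ 0 → ∀ h : SchwartzMap E3 ℂ, ‖derivSol hρ hc z l h‖ ≤
      C * ((‖z‖ ^ 2)⁻¹ * growth R z * √(1 + ‖z‖ ^ 2) ^ l.length) * ‖h.toLp 2 volume‖ := by
  obtain ⟨C, hC, H⟩ := exists_nrm_pdl_mul_freeSol_le hR hρ hs l hl
  obtain ⟨B, hB⟩ := hρ.continuous.bounded_above_of_compact_support hc
  have hB0 : 0 ≤ B := (norm_nonneg _).trans (hB 0)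
  refine ⟨C * B, by positivity, fun z hz h => ?_⟩
  have h1 : nrm (ρ * h) ≤ B * ‖h.toLp 2 volume‖ := by
    have : nrm (ρ * h) ≤ nrm ((B : ℂ) • ⇑h) := nrm_mono ((h.memLp 2 volume).const_smul _) fun x => by
      rw [Pi.mul_apply, Pi.smul_apply, norm_smul, norm_mul, Complex.norm_real,
        Real.norm_of_nonneg hB0]
      exact mul_le_mul_of_nonneg_right (hB x) (norm_nonneg _)
    rw [nrm_const_smul, Complex.norm_real, Real.norm_of_nonneg hB0] at this
    rwa [SchwartzMap.norm_toLp]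
  have h2 := H z hz (ρ * h) (hρ.mul (contDiff_schwartz h)) ((tsupport_mul_subset_left).trans hs)
  have hg := zero_le_one.trans (one_le_growth hR z)
  change ‖(memLp_pdl_mul_freeSol hρ hc z l h).toLp‖ ≤ _
  rw [norm_toLp_eq_nrm]
  refine h2.trans ?_
  calc _ ≤ C * ((‖z‖ ^ 2)⁻¹ * (growth R z * (B * ‖h.toLp 2 volume‖)) *
        √(1 + ‖z‖ ^ 2) ^ l.length) := by gcongr
    _ = _ := by ring

theorem denseRange_toLpL2 : DenseRange (SchwartzMap.toLpCLM ℂ (E := E3) ℂ 2 volume).toLinearMap :=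
  SchwartzMap.denseRange_toLpCLM (E := E3) (F := ℂ) ENNReal.ofNat_ne_top

/-- The cut-off resolvent has weak derivatives up to order four, with the asserted bounds. -/
theorem exists_weakDeriv_cutoff_freeRes (ρ : 𝓓((⊤ : Opens E3), ℂ)) {R : ℝ} (hR : 0 ≤ R)
    (hs : tsupport ρ ⊆ Metric.closedBall 0 R) (l : List (Fin 3)) (hl : l.length ≤ 4) :
    ∃ C : ℝ, 0 ≤ C ∧ ∀ z : ℂ, z ≠ 0 → ∀ f : L2, ∃ G : L2,
      ‖G‖ ≤ C * ((‖z‖ ^ 2)⁻¹ * growth R z * √(1 + ‖z‖ ^ 2) ^ l.length) * ‖f‖ ∧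
      ∀ φ : E3 → ℂ, ContDiff ℝ ∞ φ → HasCompactSupport φ →
        ∫ x, (cutoff ρ (freeRes z) f : L2) x * pdl l φ x =
          (-1) ^ l.length * ∫ x, G x * φ x := by
  have hρ : ContDiff ℝ ∞ ρ := ρ.contDiff
  have hc : HasCompactSupport ρ := ρ.hasCompactSupport
  obtain ⟨C, hC, H⟩ := exists_norm_derivSol_le hρ hc hR hs l.reverse (by simpa using hl)
  rw [List.length_reverse] at H
  obtain ⟨A, hA, -⟩ := isAnalyticFamily_freeRes ρ
  refine ⟨C, hC, fun z hz f => ?_⟩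
  set e := (SchwartzMap.toLpCLM ℂ (E := E3) ℂ 2 volume).toLinearMap with he
  refine ⟨(derivSol hρ hc z l.reverse).extendOfNorm e f,
    LinearMap.norm_extendOfNorm_apply_le denseRange_toLpL2 _ (H z hz) f, fun φ hφ hφc => ?_⟩
  have m1 : MemLp (pdl l φ) 2 volume :=
    memLp_of_hasCompactSupport (contDiff_pdl hφ l).continuous (hasCompactSupport_pdl hφc l)
  have m2 : MemLp φ 2 volume := memLp_of_hasCompactSupport hφ.continuous hφc
  rw [← pairing_apply m1, ← pairing_apply m2]
  have hAf : ∀ f, cutoff ρ (freeRes z) f = A z f := fun f => by rw [← hA z hz]; rfl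
  rw [hAf]
  refine denseRange_toLpL2.induction (P := fun f => pairing m1 (A z f) = (-1) ^ l.length *
    pairing m2 ((derivSol hρ hc z l.reverse).extendOfNorm e f)) ?_
    (isClosed_eq (by fun_prop) (by fun_prop)) f
  rintro _ ⟨h, rfl⟩
  rw [LinearMap.extendOfNorm_eq denseRange_toLpL2 ⟨_, H z hz⟩, ← hAf, pairing_apply, pairing_apply]
  have e1 : ∫ x, (cutoff ρ (freeRes z) (e h) : L2) x * pdl l φ x =
      ∫ x, (⇑ρ * freeSol z (⇑ρ * ⇑h)) x * pdl l φ x := by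
    apply integral_congr_ae
    have hh : (e h : L2) =ᵐ[volume] h := h.coeFn_toLp 2 volume
    have h2 : (fun y => ρ y * (e h : L2) y) =ᵐ[volume] ⇑ρ * ⇑h := by
      filter_upwards [hh] with y hy
      rw [hy, Pi.mul_apply]
    filter_upwards [cutoff_freeRes_coe ρ z (e h)] with x hx
    rw [hx, freeSol, kconv_congr h2, kconv_congr h2]
    rfl
  have e2 : ∫ x, (derivSol hρ hc z l.reverse h : L2) x * φ x =
      ∫ x, pdl l.reverse (⇑ρ * freeSol z (⇑ρ * ⇑h)) x * φ x := by
    apply integral_congr_ae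
    filter_upwards [derivSol_coe hρ hc z l.reverse h] with x hx
    rw [hx]
  exact e1.trans ((integral_mul_pdl (contDiff_mul_freeSol hρ hc z h) hφ hc.mul_right l).trans
    (by rw [e2]))

theorem weakDerivENorm_le (R : ℝ) {m : ℕ} (i : Fin m → Fin 3) (u G : L2)
    (h : ∀ φ : E3 → ℂ, ContDiff ℝ ∞ φ → HasCompactSupport φ →
      ∫ x, u x * pdl (List.ofFn i) φ x = (-1) ^ m * ∫ x, G x * φ x) :
    weakDerivENorm (openBall R) i u ≤ ENNReal.ofReal ‖G‖ := by
  have L : ∀ f : L2, LocallyIntegrableOn f (openBall R) volume := fun f =>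
    ((Lp.memLp f).locallyIntegrable (by norm_num)).locallyIntegrableOn _
  refine (iInf₂_le (G : E3 → ℂ) (show IsWeakDeriv (openBall R) i u G from
    ⟨L u, L G, fun φ => ?_⟩)).trans ?_
  · have hφ : ContDiff ℝ ∞ φ := φ.contDiff
    have hs : tsupport φ ⊆ openBall R := φ.tsupport_subset
    have z1 : ∀ x, x ∉ (openBall R : Set E3) → φ x = 0 := fun x hx =>
      image_eq_zero_of_notMem_tsupport fun h => hx (hs h)
    have z2 : ∀ x, x ∉ (openBall R : Set E3) → pdl (List.ofFn i) φ x = 0 := fun x hx =>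
      image_eq_zero_of_notMem_tsupport fun h => hx (hs (tsupport_pdl_subset _ _ h))
    rw [setIntegral_eq_integral_of_forall_compl_eq_zero,
      setIntegral_eq_integral_of_forall_compl_eq_zero, ← h φ hφ φ.hasCompactSupport]
    · congr 1
      funext x
      rw [iteratedFDeriv_eq_pdl hφ]
    · intro x hx
      rw [z1 x hx, mul_zero]
    · intro x hx
      rw [iteratedFDeriv_eq_pdl hφ, z2 x hx, mul_zero]
  · refine (eLpNorm_mono_measure _ Measure.restrict_le_self).trans ?_
    rw [ofReal_norm, Lp.enorm_def]

theorem eq_zero_of_notMem_ball {ρ : E3 → ℂ} (hρ : Continuous ρ) {R : ℝ} (hR : R ≠ 0)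
    (hs : tsupport ρ ⊆ Metric.closedBall 0 R) {x : E3} (hx : x ∉ Metric.ball (0 : E3) R) :
    ρ x = 0 := by
  by_contra h
  have h1 : Function.support ρ ⊆ interior (Metric.closedBall 0 R) :=
    interior_maximal ((subset_tsupport ρ).trans hs) hρ.isOpen_support
  rw [interior_closedBall _ hR] at h1
  exact hx (h1 h)

theorem exists_sobolevENorm_cutoff_freeRes_le (ρ : 𝓓((⊤ : Opens E3), ℂ)) {R : ℝ} (hR : 0 < R)
    (hs : tsupport ρ ⊆ Metric.closedBall 0 R) :
    ∃ C : ℝ, 0 < C ∧ ∀ z : ℂ, z ≠ 0 → ∀ j : ℕ, j ≤ 4 → ∀ f : L2,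
      sobolevENorm (openBall R) j (cutoff ρ (freeRes z) f) ≤
        ENNReal.ofReal (C * (‖z‖ ^ (-2 : ℤ) * (1 + ‖z‖ ^ 2) ^ ((j : ℝ) / 2) * growth R z)) *
        eLpNorm f 2 (volume.restrict (Metric.ball 0 R)) := by
  have H : ∀ l : List (Fin 3), ∃ C : ℝ, 0 ≤ C ∧ (l.length ≤ 4 → ∀ z : ℂ, z ≠ 0 → ∀ f : L2,
      ∃ G : L2, ‖G‖ ≤ C * ((‖z‖ ^ 2)⁻¹ * growth R z * √(1 + ‖z‖ ^ 2) ^ l.length) * ‖f‖ ∧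
      ∀ φ : E3 → ℂ, ContDiff ℝ ∞ φ → HasCompactSupport φ →
        ∫ x, (cutoff ρ (freeRes z) f : L2) x * pdl l φ x =
          (-1) ^ l.length * ∫ x, G x * φ x) := fun l => by
    by_cases hl : l.length ≤ 4
    · obtain ⟨C, hC, h⟩ := exists_weakDeriv_cutoff_freeRes ρ hR.le hs l hl
      exact ⟨C, hC, fun _ => h⟩
    · exact ⟨0, le_rfl, fun h => absurd h hl⟩
  choose K hK H using H
  set S : ℝ≥0∞ := ∑ m ∈ Finset.range 5, ∑ i : Fin m → Fin 3,
    ENNReal.ofReal (K (List.ofFn i)) ^ 2 with hS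
  clear_value S
  have hStop : S ^ (1 / 2 : ℝ) ≠ ⊤ := by
    refine ENNReal.rpow_ne_top_of_nonneg (by norm_num) ?_
    rw [hS]
    simp [ENNReal.sum_eq_top]
  refine ⟨(S ^ (1 / 2 : ℝ)).toReal + 1, add_pos_of_nonneg_of_pos ENNReal.toReal_nonneg one_pos, fun z hz j hj f => ?_⟩
  have hg := zero_le_one.trans (one_le_growth hR.le z)
  set β : ℝ := ‖z‖ ^ (-2 : ℤ) * (1 + ‖z‖ ^ 2) ^ ((j : ℝ) / 2) * growth R z with hβ
  have hβ0 : 0 ≤ β := by positivity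
  -- replace `f` by its restriction to the ball
  have hm : MemLp ((Metric.ball (0 : E3) R).indicator f) 2 volume :=
    (Lp.memLp f).indicator Metric.isOpen_ball.measurableSet
  set f' : L2 := hm.toLp with hf'
  have hcut : cutoff ρ (freeRes z) f = cutoff ρ (freeRes z) f' := by
    have : mulComp ρ f = mulComp ρ f' := by
      refine Subtype.ext (Lp.ext ?_)
      filter_upwards [mulComp_coe ρ f, mulComp_coe ρ f', hm.coeFn_toLp] with x h1 h2 h3
      rw [h1, h2, h3]
      by_cases hx : x ∈ Metric.ball (0 : E3) R
      · rw [Set.indicator_of_mem hx]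
      · rw [eq_zero_of_notMem_ball ρ.continuous hR.ne' hs hx, zero_mul, zero_mul]
    simp only [cutoff, LinearMap.comp_apply, this]
  have hnorm : ENNReal.ofReal ‖f'‖ = eLpNorm f 2 (volume.restrict (Metric.ball 0 R)) := by
    rw [ofReal_norm, Lp.enorm_toLp,
      eLpNorm_indicator_eq_eLpNorm_restrict Metric.isOpen_ball.measurableSet]
  rw [hcut, ← hnorm]
  set Z : ℝ≥0∞ := ENNReal.ofReal β * ENNReal.ofReal ‖f'‖ with hZ
  have hterm : ∀ m ∈ Finset.range (j + 1), ∀ i : Fin m → Fin 3,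
      weakDerivENorm (openBall R) i (cutoff ρ (freeRes z) f' : L2) ≤
        ENNReal.ofReal (K (List.ofFn i)) * Z := by
    intro m hmj i
    have hmj' : m ≤ j := Nat.lt_succ_iff.1 (Finset.mem_range.1 hmj)
    obtain ⟨G, hG, hG'⟩ := H (List.ofFn i) (by simpa using hmj'.trans hj) z hz f'
    rw [List.length_ofFn] at hG hG'
    refine (weakDerivENorm_le R i _ G hG').trans ?_
    rw [hZ, ← ENNReal.ofReal_mul hβ0, ← ENNReal.ofReal_mul (hK _)]
    refine ENNReal.ofReal_le_ofReal (hG.trans ?_)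
    rw [← mul_assoc (K (List.ofFn i)) β]
    refine mul_le_mul_of_nonneg_right (mul_le_mul_of_nonneg_left ?_ (hK _)) (norm_nonneg f')
    have e1 : (1 + ‖z‖ ^ 2) ^ ((j : ℝ) / 2) = √(1 + ‖z‖ ^ 2) ^ j := by
      rw [Real.sqrt_eq_rpow, ← Real.rpow_natCast (_ ^ (1 / 2 : ℝ)), ← Real.rpow_mul (by positivity)]
      congr 1
      ring
    have e2 : √(1 + ‖z‖ ^ 2) ^ m ≤ √(1 + ‖z‖ ^ 2) ^ j :=
      pow_le_pow_right₀ (Real.one_le_sqrt.2 (by nlinarith [sq_nonneg ‖z‖])) hmj'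
    rw [hβ, e1, zpow_neg, mul_right_comm]
    have e3 : ‖z‖ ^ (2 : ℤ) = ‖z‖ ^ 2 := by norm_cast
    rw [e3]
    gcongr
  have hsum : ∑ m ∈ Finset.range (j + 1), ∑ i : Fin m → Fin 3,
      weakDerivENorm (openBall R) i (cutoff ρ (freeRes z) f' : L2) ^ 2 ≤ S * Z ^ 2 := by
    calc _ ≤ ∑ m ∈ Finset.range (j + 1), ∑ i : Fin m → Fin 3,
          (ENNReal.ofReal (K (List.ofFn i)) * Z) ^ 2 := by
          refine Finset.sum_le_sum fun m hm => Finset.sum_le_sum fun i _ => ?_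
          exact pow_le_pow_left' (hterm m hm i) 2
      _ = (∑ m ∈ Finset.range (j + 1), ∑ i : Fin m → Fin 3,
          ENNReal.ofReal (K (List.ofFn i)) ^ 2) * Z ^ 2 := by
          simp only [mul_pow, Finset.sum_mul]
      _ ≤ S * Z ^ 2 := by
          rw [hS]
          refine mul_le_mul_left (Finset.sum_le_sum_of_subset ?_) _
          exact Finset.range_subset_range.2 (by omega)
  calc sobolevENorm (openBall R) j (cutoff ρ (freeRes z) f' : L2)
      ≤ (S * Z ^ 2) ^ (1 / 2 : ℝ) := ENNReal.rpow_le_rpow hsum (by norm_num)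
    _ = S ^ (1 / 2 : ℝ) * Z := by
        rw [ENNReal.mul_rpow_of_nonneg _ _ (by norm_num), ← ENNReal.rpow_natCast,
          ← ENNReal.rpow_mul]
        norm_num
    _ = ENNReal.ofReal ((S ^ (1 / 2 : ℝ)).toReal) * Z := by rw [ENNReal.ofReal_toReal hStop]
    _ ≤ ENNReal.ofReal ((S ^ (1 / 2 : ℝ)).toReal + 1) * Z := by gcongr; linarith
    _ = _ := by rw [hZ, ← mul_assoc, ← ENNReal.ofReal_mul
        (add_nonneg ENNReal.toReal_nonneg zero_le_one)]

open scoped SchwartzMap FourierTransform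

/-! ### Bounded Fourier multipliers on `L²(ℝ³)` -/

/-- The Fourier multiplier with symbol `g` on tempered distributions. -/
abbrev fm (g : E3 → ℂ) : 𝓢'(E3, ℂ) →L[ℂ] 𝓢'(E3, ℂ) :=
  TemperedDistribution.fourierMultiplierCLM ℂ g

theorem exists_multiplier {g : E3 → ℂ} (hg : g.HasTemperateGrowth) {C : ℝ}
    (hC : ∀ ξ, ‖g ξ‖ ≤ C) : ∃ A : L2 →L[ℂ] L2, ‖A‖ ≤ C ∧
      ∀ f, Lp.toTemperedDistribution (A f) = fm g (Lp.toTemperedDistribution f) := by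
  have hC0 : 0 ≤ C := (norm_nonneg _).trans (hC 0)
  have hm : MemLp g ∞ (volume : Measure E3) :=
    memLp_top_of_bound hg.1.continuous.aestronglyMeasurable C (Filter.Eventually.of_forall hC)
  have hn : ‖hm.toLp g‖ ≤ C := by
    rw [Lp.norm_toLp]
    refine ENNReal.toReal_le_of_le_ofReal hC0 ?_
    rw [eLpNorm_exponent_top]
    exact eLpNormEssSup_le_of_ae_bound (Filter.Eventually.of_forall hC)
  let S : L2 →ₗ[ℂ] L2 :=
    { toFun := fun f => (hm.toLp g : Lp ℂ ∞ (volume : Measure E3)) • f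
      map_add' := fun f h => Lp.add_smul _ f h
      map_smul' := fun c f => (Lp.smul_comm c _ f).symm }
  let B : L2 →L[ℂ] L2 := S.mkContinuous C fun f =>
    (Lp.norm_smul_le _ _).trans (mul_le_mul_of_nonneg_right hn (norm_nonneg f))
  let F := Lp.fourierTransformₗᵢ E3 ℂ
  refine ⟨(F.symm.toContinuousLinearEquiv : L2 →L[ℂ] L2) ∘L B ∘L
    (F.toContinuousLinearEquiv : L2 →L[ℂ] L2), ?_, fun f => ?_⟩
  · refine ContinuousLinearMap.opNorm_le_bound _ hC0 fun f => ?_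
    change ‖F.symm (B (F f))‖ ≤ _
    rw [F.symm.norm_map, ← F.norm_map f]
    exact B.le_of_opNorm_le (S.mkContinuous_norm_le hC0 _) _
  · change Lp.toTemperedDistribution (𝓕⁻ ((hm.toLp g : Lp ℂ ∞ (volume : Measure E3)) • 𝓕 f : L2)) = _
    rw [← Lp.fourierInv_toTemperedDistribution_eq, Lp.toTemperedDistribution_smul_eq hg hm,
      ← Lp.fourier_toTemperedDistribution_eq]
    rfl

/-! ### The symbol of the resolvent -/

/-- The symbol `|2πξ|²` of `-Δ`. -/
def symb (ξ : E3) : ℝ := (2 * Real.pi) ^ 2 * ‖ξ‖ ^ 2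

theorem symb_nonneg (ξ : E3) : 0 ≤ symb ξ := by unfold symb; positivity

theorem symb_temperate : symb.HasTemperateGrowth := by
  unfold symb
  fun_prop

/-- The symbol of `(-Δ - c)⁻¹`. -/
def poleMult (c : ℂ) (ξ : E3) : ℂ := ((symb ξ : ℂ) - c)⁻¹

theorem inv_sub_temperate {c : ℂ} (hc : c.im ≠ 0) :
    Function.HasTemperateGrowth fun t : ℝ => ((t : ℂ) - c)⁻¹ := by
  have e : (fun t : ℝ => ((t : ℂ) - c)⁻¹) = fun t : ℝ => ((t : ℂ) - star c) *
      (((c.im ^ 2)⁻¹ * (1 + ‖(c.im)⁻¹ * (t - c.re)‖ ^ 2) ^ (-1 : ℝ) : ℝ) : ℂ) := by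
    funext t
    have h0 : (t : ℂ) - c ≠ 0 := fun h => hc (by simpa using congrArg Complex.im h)
    have h1 : ((c.im ^ 2)⁻¹ * (1 + ‖(c.im)⁻¹ * (t - c.re)‖ ^ 2) ^ (-1 : ℝ) : ℝ) =
        (Complex.normSq ((t : ℂ) - c))⁻¹ := by
      rw [Real.rpow_neg_one, ← mul_inv, Complex.normSq_apply, Real.norm_eq_abs, sq_abs]
      congr 1
      simp only [Complex.sub_re, Complex.ofReal_re, Complex.sub_im, Complex.ofReal_im]
      field_simp
      ring
    rw [h1, Complex.inv_def]
    simp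
  rw [e]
  have h2 : Function.HasTemperateGrowth fun t : ℝ => (c.im)⁻¹ * (t - c.re) := by fun_prop
  have h3 := (Function.hasTemperateGrowth_one_add_norm_sq_rpow ℝ (-1)).comp h2
  have h4 : Function.HasTemperateGrowth fun t : ℝ =>
      (c.im ^ 2)⁻¹ * (1 + ‖(c.im)⁻¹ * (t - c.re)‖ ^ 2) ^ (-1 : ℝ) :=
    (Function.HasTemperateGrowth.const ((c.im ^ 2)⁻¹)).mul h3
  have h5 := Function.HasTemperateGrowth.comp Function.Complex.hasTemperateGrowth_ofReal h4
  have h6 : Function.HasTemperateGrowth fun t : ℝ => (t : ℂ) - star c := by fun_prop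
  exact h6.mul h5

theorem poleMult_temperate {c : ℂ} (hc : c.im ≠ 0) : (poleMult c).HasTemperateGrowth :=
  (inv_sub_temperate hc).comp symb_temperate

theorem abs_im_le_norm_sub (t : ℝ) (c : ℂ) : |c.im| ≤ ‖(t : ℂ) - c‖ := by
  simpa using Complex.abs_im_le_norm ((t : ℂ) - c)

theorem sub_ne_zero_of_im {c : ℂ} (hc : c.im ≠ 0) (t : ℝ) : (t : ℂ) - c ≠ 0 :=
  norm_pos_iff.1 ((abs_pos.2 hc).trans_le (abs_im_le_norm_sub t c))

theorem norm_mul_poleMult_le {c : ℂ} (hc : c.im ≠ 0) (ξ : E3) :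
    (1 + ‖ξ‖ ^ 2) * ‖poleMult c ξ‖ ≤ 1 + (1 + ‖c‖) / |c.im| := by
  have h1 := abs_im_le_norm_sub (symb ξ) c
  have h2 : ‖ξ‖ ^ 2 ≤ symb ξ := by
    have : 1 ≤ (2 * Real.pi) ^ 2 := by nlinarith [Real.pi_gt_three]
    unfold symb
    nlinarith [sq_nonneg ‖ξ‖]
  have h3 : symb ξ ≤ ‖(symb ξ : ℂ) - c‖ + ‖c‖ := by
    have := norm_add_le ((symb ξ : ℂ) - c) c
    rwa [sub_add_cancel, Complex.norm_real, Real.norm_of_nonneg (symb_nonneg ξ)] at this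
  have h4 := abs_pos.2 hc
  have h5 := h4.trans_le h1
  rw [poleMult, norm_inv, ← div_eq_mul_inv, div_le_iff₀ h5, add_mul, one_mul]
  have h6 : 1 + ‖c‖ ≤ (1 + ‖c‖) / |c.im| * ‖(symb ξ : ℂ) - c‖ := by
    rw [div_mul_eq_mul_div, le_div_iff₀ h4]
    exact mul_le_mul_of_nonneg_left h1 (by positivity)
  linarith

/-- The symbol `(|2πξ|⁴ - z⁴)⁻¹` of the resolvent of the bi-Laplacian. -/
def resMult (z : ℂ) : E3 → ℂ := poleMult (z ^ 2) * poleMult (-z ^ 2)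

theorem im_sq_pos {z : ℂ} (hz : z ∈ quadrant) : 0 < (z ^ 2).im := by
  have : (z ^ 2).im = 2 * (z.re * z.im) := by rw [sq, Complex.mul_im]; ring
  rw [this]
  exact mul_pos two_pos (mul_pos hz.1 hz.2)

theorem im_neg_sq_ne {z : ℂ} (hz : z ∈ quadrant) : (-z ^ 2).im ≠ 0 := by
  rw [Complex.neg_im]
  exact neg_ne_zero.2 (im_sq_pos hz).ne'

theorem resMult_temperate {z : ℂ} (hz : z ∈ quadrant) : (resMult z).HasTemperateGrowth :=
  (poleMult_temperate (im_sq_pos hz).ne').mul (poleMult_temperate (im_neg_sq_ne hz))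

theorem symb_sq_mul_resMult {z : ℂ} (hz : z ∈ quadrant) (ξ : E3) :
    (symb ξ : ℂ) ^ 2 * resMult z ξ - z ^ 4 * resMult z ξ = 1 := by
  have h1 := sub_ne_zero_of_im (im_sq_pos hz).ne' (symb ξ)
  have h2 := sub_ne_zero_of_im (im_neg_sq_ne hz) (symb ξ)
  simp only [resMult, Pi.mul_apply, poleMult]
  field_simp
  ring

theorem norm_resMult_le {z : ℂ} (hz : z ∈ quadrant) (ξ : E3) :
    ‖resMult z ξ‖ ≤ 1 / (‖z‖ ^ 2 * z.im * z.re) := by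
  have him : (z ^ 2).im = 2 * (z.re * z.im) := by rw [sq, Complex.mul_im]; ring
  have hab := mul_pos hz.1 hz.2
  have hz0 : 0 < ‖z‖ ^ 2 := by
    have : z ≠ 0 := fun h => hz.1.ne' (by rw [h]; rfl)
    positivity
  have hs := symb_nonneg ξ
  set s := symb ξ with hsdef
  set w := z ^ 2 with hw
  have hwn : ‖w‖ = ‖z‖ ^ 2 := norm_pow _ _
  have a1 : 2 * (z.re * z.im) ≤ ‖(s : ℂ) - w‖ := by
    have := abs_im_le_norm_sub s w
    rwa [him, abs_of_pos (by positivity)] at this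
  have a2 : 2 * (z.re * z.im) ≤ ‖(s : ℂ) - -w‖ := by
    have := abs_im_le_norm_sub s (-w)
    rwa [Complex.neg_im, abs_neg, him, abs_of_pos (by positivity)] at this
  have key : ‖z‖ ^ 2 * (2 * (z.re * z.im)) ≤ ‖(s : ℂ) - w‖ * ‖(s : ℂ) - -w‖ := by
    rcases le_total 0 w.re with h | h
    · have : ‖w‖ ≤ ‖(s : ℂ) - -w‖ := by
        rw [Complex.norm_def, Complex.norm_def]
        refine Real.sqrt_le_sqrt ?_
        simp only [Complex.normSq_apply, Complex.sub_re, Complex.ofReal_re, Complex.neg_re,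
          Complex.sub_im, Complex.ofReal_im, Complex.neg_im]
        nlinarith [mul_nonneg hs h, sq_nonneg s]
      rw [← hwn, mul_comm]
      exact mul_le_mul a1 this (norm_nonneg _) (norm_nonneg _)
    · have : ‖w‖ ≤ ‖(s : ℂ) - w‖ := by
        rw [Complex.norm_def, Complex.norm_def]
        refine Real.sqrt_le_sqrt ?_
        simp only [Complex.normSq_apply, Complex.sub_re, Complex.ofReal_re,
          Complex.sub_im, Complex.ofReal_im]
        nlinarith [mul_nonneg hs (neg_nonneg.2 h), sq_nonneg s]
      rw [← hwn]
      exact mul_le_mul this a2 (by positivity) (norm_nonneg _)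
  have hp : 0 < ‖z‖ ^ 2 * z.im * z.re := by
    have h1 := hz.1
    have h2 := hz.2
    positivity
  rw [resMult, Pi.mul_apply, poleMult, poleMult, ← hsdef, ← mul_inv, norm_inv, norm_mul, one_div]
  refine inv_anti₀ hp (le_trans ?_ key)
  nlinarith

/-! ### The resolvent of the bi-Laplacian -/

theorem fm_fm {g h : E3 → ℂ} (hg : g.HasTemperateGrowth) (hh : h.HasTemperateGrowth)
    (f : 𝓢'(E3, ℂ)) : fm h (fm g f) = fm (g * h) f :=
  TemperedDistribution.fourierMultiplierCLM_fourierMultiplierCLM_apply hg hh f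

theorem fm_sub {g h : E3 → ℂ} (hg : g.HasTemperateGrowth) (hh : h.HasTemperateGrowth)
    (f : 𝓢'(E3, ℂ)) : fm (g - h) f = fm g f - fm h f := by
  simp only [fm, TemperedDistribution.fourierMultiplierCLM_apply,
    TemperedDistribution.smulLeftCLM_sub hg hh, sub_apply]
  exact map_sub (FourierTransform.fourierInvCLM ℂ 𝓢'(E3, ℂ)) _ _

theorem symbC_temperate : Function.HasTemperateGrowth fun ξ : E3 => (symb ξ : ℂ) :=
  Function.HasTemperateGrowth.comp Function.Complex.hasTemperateGrowth_ofReal symb_temperate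

theorem laplacian_eq_fm (f : 𝓢'(E3, ℂ)) : Δ f = -fm (fun ξ => (symb ξ : ℂ)) f := by
  have e : (fun ξ : E3 => (symb ξ : ℂ)) =
      (((2 * Real.pi) ^ 2 : ℝ) : ℂ) • fun ξ : E3 => Complex.ofReal (‖ξ‖ ^ 2) := by
    funext ξ
    simp [symb]
  rw [TemperedDistribution.laplacian_eq_fourierMultiplierCLM, e, fm,
    TemperedDistribution.fourierMultiplierCLM_smul (by fun_prop), neg_smul]
  rfl

theorem biLaplacian_eq_fm (f : 𝓢'(E3, ℂ)) :
    Δ (Δ f) = fm (fun ξ => (symb ξ : ℂ) ^ 2) f := by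
  rw [laplacian_eq_fm, laplacian_eq_fm f, map_neg, neg_neg, fm_fm symbC_temperate symbC_temperate]
  congr 2
  funext ξ
  simp [sq]

theorem symbC_sq_temperate : Function.HasTemperateGrowth fun ξ : E3 => (symb ξ : ℂ) ^ 2 :=
  symbC_temperate.pow 2

theorem fm_symb_sq_mul_resMult {z : ℂ} (hz : z ∈ quadrant) (f : 𝓢'(E3, ℂ)) :
    fm ((fun ξ => (symb ξ : ℂ) ^ 2) * resMult z) f - z ^ 4 • fm (resMult z) f = f := by
  have hr := resMult_temperate hz
  have h1 : z ^ 4 • fm (resMult z) f = fm (z ^ 4 • resMult z) f := by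
    rw [fm, fm, TemperedDistribution.fourierMultiplierCLM_smul hr]
    rfl
  have hs : (z ^ 4 • resMult z).HasTemperateGrowth :=
    (Function.HasTemperateGrowth.const (z ^ 4)).mul hr
  rw [h1, ← fm_sub (symbC_sq_temperate.mul hr) hs]
  have e : (fun ξ => (symb ξ : ℂ) ^ 2) * resMult z - z ^ 4 • resMult z = fun _ => 1 := by
    funext ξ
    simpa using symb_sq_mul_resMult hz ξ
  rw [e, fm, TemperedDistribution.fourierMultiplierCLM_const]
  simp

theorem biLaplacian_fm_resMult {z : ℂ} (hz : z ∈ quadrant) (f : 𝓢'(E3, ℂ)) :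
    Δ (Δ (fm (resMult z) f)) - z ^ 4 • fm (resMult z) f = f := by
  rw [biLaplacian_eq_fm, fm_fm (resMult_temperate hz) symbC_sq_temperate, mul_comm]
  exact fm_symb_sq_mul_resMult hz f

theorem fm_resMult_biLaplacian {z : ℂ} (hz : z ∈ quadrant) (f : 𝓢'(E3, ℂ)) :
    fm (resMult z) (Δ (Δ f) - z ^ 4 • f) = f := by
  rw [map_sub, map_smul, biLaplacian_eq_fm, fm_fm symbC_sq_temperate (resMult_temperate hz)]
  exact fm_symb_sq_mul_resMult hz f

theorem exists_resolvent {z : ℂ} (hz : z ∈ quadrant) : ∃ A : L2 →L[ℂ] L2,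
    IsResolvent H0 (z ^ 4) A ∧ ‖A‖ ≤ 1 / (‖z‖ ^ 2 * z.im * z.re) ∧
      ∀ f, Lp.toTemperedDistribution (A f) = fm (resMult z) (Lp.toTemperedDistribution f) := by
  obtain ⟨A, hA, hAf⟩ := exists_multiplier (resMult_temperate hz) (norm_resMult_le hz)
  have hsub : ∀ a b : L2, Lp.toTemperedDistribution (a - b)
      = Lp.toTemperedDistribution a - Lp.toTemperedDistribution b :=
    map_sub (Lp.toTemperedDistributionCLM ℂ (volume : Measure E3) 2)
  have hsmul : ∀ (c : ℂ) (a : L2), Lp.toTemperedDistribution (c • a)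
      = c • Lp.toTemperedDistribution a :=
    map_smul (Lp.toTemperedDistributionCLM ℂ (volume : Measure E3) 2)
  refine ⟨A, ⟨fun f => ?_, fun u => ?_⟩, hA, hAf⟩
  · have hmem : TemperedDistribution.MemSobolev 4 2 (Lp.toTemperedDistribution (A f)) := by
      have hb : Function.HasTemperateGrowth fun ξ : E3 =>
          (((1 + ‖ξ‖ ^ 2) ^ ((4 : ℝ) / 2) : ℝ) : ℂ) := by fun_prop
      obtain ⟨B, -, hB⟩ := exists_multiplier ((resMult_temperate hz).mul hb)
        (C := (1 + (1 + ‖z ^ 2‖) / |(z ^ 2).im|) * (1 + (1 + ‖-z ^ 2‖) / |(-z ^ 2).im|))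
        fun ξ => by
          have h1 := norm_mul_poleMult_le (im_sq_pos hz).ne' ξ
          have h2 := norm_mul_poleMult_le (im_neg_sq_ne hz) ξ
          have h3 : (1 + ‖ξ‖ ^ 2) ^ ((4 : ℝ) / 2) = (1 + ‖ξ‖ ^ 2) ^ 2 := by
            rw [show (4 : ℝ) / 2 = (2 : ℕ) by norm_num, Real.rpow_natCast]
          rw [Pi.mul_apply, h3, resMult, Pi.mul_apply, norm_mul, norm_mul, Complex.norm_real,
            Real.norm_of_nonneg (by positivity)]
          refine le_trans (le_of_eq ?_) (mul_le_mul h1 h2 (by positivity) (by positivity))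
          ring
      refine ⟨B f, ?_⟩
      rw [hAf, TemperedDistribution.besselPotential, hB]
      exact fm_fm (resMult_temperate hz) hb _
    refine ⟨hmem, toTemperedDistribution_injective ?_⟩
    rw [hsub, hsmul, H0_spec, hAf]
    exact biLaplacian_fm_resMult hz _
  · apply toTemperedDistribution_injective
    rw [hAf, hsub, hsmul, H0_spec]
    exact fm_resMult_biLaplacian hz _

open scoped SchwartzMap FourierTransform LineDeriv

/-! ### The integral kernel of the resolvent -/

theorem pd_schwartz (g : 𝓢(E3, ℂ)) (i : Fin 3) : pd i g = (∂_{e3 i} g : 𝓢(E3, ℂ)) := rfl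

theorem lap_schwartz (g : 𝓢(E3, ℂ)) : lap g = (Δ g : 𝓢(E3, ℂ)) := by
  funext x
  rw [SchwartzMap.laplacian_eq_sum (EuclideanSpace.basisFun (Fin 3) ℝ)]
  simp only [lap, pd_schwartz, EuclideanSpace.basisFun_apply, sum_apply]

theorem tame_schwartz {κ : ℂ} (hκ : 0 ≤ κ.re) (h : 𝓢(E3, ℂ)) (x : E3) :
    Tame κ fun t => h (x - t) := by
  have H := SchwartzMap.one_add_le_sup_seminorm_apply (𝕜 := ℝ) (m := (4, 0)) (k := 4) (n := 0)
    le_rfl le_rfl h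
  set S := 2 ^ 4 * (Finset.Iic ((4, 0) : ℕ × ℕ)).sup
    (fun m => SchwartzMap.seminorm ℝ m.1 m.2) h with hS
  refine ⟨(1 + ‖x‖) ^ 4 * S, fun t => ?_⟩
  have hp : 0 < 1 + ‖t‖ := by positivity
  have e : (1 + ‖t‖) ^ (-4 : ℝ) = ((1 + ‖t‖) ^ 4)⁻¹ := by
    rw [Real.rpow_neg hp.le]
    norm_cast
  rw [e, ← div_eq_mul_inv, le_div_iff₀ (by positivity)]
  have h1 : Real.exp (-κ.re * ‖t‖) ≤ 1 := Real.exp_le_one_iff.2 (by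
    rw [neg_mul]
    exact neg_nonpos.2 (mul_nonneg hκ (norm_nonneg t)))
  have h2 : (1 + ‖x - t‖) ^ 4 * ‖h (x - t)‖ ≤ S := by simpa using H (x - t)
  have h3 : 1 + ‖t‖ ≤ (1 + ‖x‖) * (1 + ‖x - t‖) := by
    have : ‖t‖ ≤ ‖x‖ + ‖x - t‖ := by
      have := norm_sub_le x (x - t)
      rwa [sub_sub_cancel] at this
    nlinarith [norm_nonneg x, norm_nonneg (x - t), mul_nonneg (norm_nonneg x) (norm_nonneg (x - t))]
  calc Real.exp (-κ.re * ‖t‖) * ‖h (x - t)‖ * (1 + ‖t‖) ^ 4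
      ≤ 1 * ‖h (x - t)‖ * ((1 + ‖x‖) * (1 + ‖x - t‖)) ^ 4 := by gcongr
    _ = (1 + ‖x‖) ^ 4 * ((1 + ‖x - t‖) ^ 4 * ‖h (x - t)‖) := by ring
    _ ≤ (1 + ‖x‖) ^ 4 * S := by gcongr

theorem kconv_yukawa_schwartz {κ : ℂ} (hκ : 0 ≤ κ.re) (ψ : 𝓢(E3, ℂ)) :
    kconv (yukawa κ) (κ ^ 2 • ψ - Δ ψ : 𝓢(E3, ℂ)) = ψ := by
  have h := kconv_yukawa_helmholtz (κ := κ) (contDiff_schwartz ψ) (tame_schwartz hκ ψ)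
    (fun i => tame_schwartz hκ (∂_{e3 i} ψ)) (fun i => tame_schwartz hκ (∂_{e3 i} (∂_{e3 i} ψ)))
  rw [lap_schwartz] at h
  exact h

theorem laplacian_smul_sub (c : ℂ) (a b : 𝓢(E3, ℂ)) : Δ (c • a - b) = c • Δ a - Δ b := by
  simp only [← SchwartzMap.laplacianCLM_eq ℂ, map_sub, map_smul]

theorem freeSol_biLaplacian {z : ℂ} (hz : z ∈ quadrant) (φ : 𝓢(E3, ℂ)) :
    freeSol z (Δ (Δ φ) - z ^ 4 • φ : 𝓢(E3, ℂ)) = φ := by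
  have h1 := kconv_yukawa_schwartz (κ := -Complex.I * z) (by simpa using hz.2.le)
    (z ^ 2 • φ - Δ φ)
  have h2 := kconv_yukawa_schwartz (κ := z) hz.1.le (-z ^ 2 • φ - Δ φ)
  have e1 : (-Complex.I * z) ^ 2 • (z ^ 2 • φ - Δ φ) - Δ (z ^ 2 • φ - Δ φ) =
      Δ (Δ φ) - z ^ 4 • φ := by
    have : (-Complex.I * z) ^ 2 = -z ^ 2 := by rw [mul_pow, neg_sq, Complex.I_sq]; ring
    rw [laplacian_smul_sub, this]
    module
  have e2 : z ^ 2 • (-z ^ 2 • φ - Δ φ) - Δ (-z ^ 2 • φ - Δ φ) = Δ (Δ φ) - z ^ 4 • φ := by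
    rw [laplacian_smul_sub]
    module
  rw [e1] at h1
  rw [e2] at h2
  have hz0 : z ≠ 0 := fun h => hz.1.ne' (by rw [h]; rfl)
  rw [freeSol, h1, h2]
  funext x
  simp only [Pi.smul_apply, Pi.add_apply, sub_apply, smul_apply, smul_eq_mul]
  field_simp
  ring

theorem schwartz_ext_of_toTemperedDistribution {a b : 𝓢(E3, ℂ)} (h : (a : 𝓢'(E3, ℂ)) = b) :
    a = b := by
  have h1 : a.toLp 2 volume = b.toLp 2 volume := toTemperedDistribution_injective (by
    rw [Lp.toTemperedDistribution_toLp_eq, Lp.toTemperedDistribution_toLp_eq, h])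
  have h2 : (a : E3 → ℂ) =ᵐ[volume] b := by
    filter_upwards [a.coeFn_toLp 2 volume, b.coeFn_toLp 2 volume] with x ha hb
    rw [← ha, ← hb, h1]
  exact DFunLike.coe_injective ((a.continuous.ae_eq_iff_eq volume b.continuous).1 h2)

theorem biLaplacian_fourierMultiplier {z : ℂ} (hz : z ∈ quadrant) (g : 𝓢(E3, ℂ)) :
    Δ (Δ (SchwartzMap.fourierMultiplierCLM ℂ (resMult z) g)) -
      z ^ 4 • SchwartzMap.fourierMultiplierCLM ℂ (resMult z) g = g := by
  apply schwartz_ext_of_toTemperedDistribution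
  have h := biLaplacian_fm_resMult hz (g : 𝓢'(E3, ℂ))
  rw [fm, TemperedDistribution.fourierMultiplierCLM_toTemperedDistributionCLM_eq
    (resMult_temperate hz), TemperedDistribution.laplacian_toTemperedDistributionCLM_eq,
    TemperedDistribution.laplacian_toTemperedDistributionCLM_eq] at h
  rw [map_sub, map_smul]
  exact h

/-- Multiplication by a test function on `L²(ℝ³)`. -/
theorem exists_mulCLM (ρ : 𝓓((⊤ : Opens E3), ℂ)) : ∃ M : L2 →L[ℂ] L2,
    ∀ f, M f = (mulComp ρ f : L2) := by
  obtain ⟨B, hB⟩ := ρ.continuous.bounded_above_of_compact_support ρ.hasCompactSupport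
  refine ⟨(L2comp.subtype ∘ₗ mulComp ρ).mkContinuous B fun f => ?_, fun f => rfl⟩
  refine Lp.norm_le_mul_norm_of_ae_le_mul ?_
  filter_upwards [mulComp_coe ρ f] with x hx
  change ‖((mulComp ρ f : L2comp) : L2) x‖ ≤ _
  rw [hx, norm_mul]
  exact mul_le_mul_of_nonneg_right (hB x) (norm_nonneg _)

theorem cutoff_freeRes_eq {z : ℂ} (hz : z ∈ quadrant) {A : L2 →L[ℂ] L2}
    (hA : ∀ f, Lp.toTemperedDistribution (A f) = fm (resMult z) (Lp.toTemperedDistribution f))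
    (ρ : 𝓓((⊤ : Opens E3), ℂ)) (f : L2) :
    cutoff ρ (freeRes z) f = mulComp ρ (A (mulComp ρ f)) := by
  obtain ⟨M, hM⟩ := exists_mulCLM ρ
  obtain ⟨B, hB, -⟩ := isAnalyticFamily_freeRes ρ
  have hz0 : z ∈ ({0}ᶜ : Set ℂ) := fun h => hz.1.ne' (by
    rw [Set.mem_singleton_iff.1 h]; rfl)
  have hBf : ∀ f, cutoff ρ (freeRes z) f = B z f := fun f => by rw [← hB z hz0]; rfl
  rw [hBf, ← hM, ← hM]
  refine denseRange_toLpL2.induction (P := fun f => B z f = M (A (M f))) ?_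
    (isClosed_eq (by fun_prop) (by fun_prop)) f
  rintro _ ⟨h, rfl⟩
  have hs : HasCompactSupport (⇑ρ * ⇑h) := ρ.hasCompactSupport.mul_right
  have hc : ContDiff ℝ ∞ (⇑ρ * ⇑h) := ρ.contDiff.mul (contDiff_schwartz h)
  set g : 𝓢(E3, ℂ) := hs.toSchwartzMap hc with hg
  have hgc : ⇑g = ⇑ρ * ⇑h := rfl
  have e1 : (fun y => ρ y * (h.toLp 2 volume : L2) y) =ᵐ[volume] g := by
    filter_upwards [h.coeFn_toLp 2 volume] with y hy
    rw [hy]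
    rfl
  have e2 : (mulComp ρ (h.toLp 2 volume) : L2) = g.toLp 2 volume := by
    refine Lp.ext ?_
    filter_upwards [mulComp_coe ρ (h.toLp 2 volume), e1, g.coeFn_toLp 2 volume] with x h1 h2 h3
    rw [h1, h3, h2]
  set φ := SchwartzMap.fourierMultiplierCLM ℂ (resMult z) g with hφ
  have e3 : A (g.toLp 2 volume) = φ.toLp 2 volume := by
    apply toTemperedDistribution_injective
    rw [hA, Lp.toTemperedDistribution_toLp_eq, Lp.toTemperedDistribution_toLp_eq, fm,
      TemperedDistribution.fourierMultiplierCLM_toTemperedDistributionCLM_eq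
        (resMult_temperate hz)]
  have e4 : freeSol z g = φ := by
    have := freeSol_biLaplacian hz φ
    rwa [hφ, biLaplacian_fourierMultiplier hz] at this
  change B z (h.toLp 2 volume) = M (A (M (h.toLp 2 volume)))
  rw [← hBf, hM (h.toLp 2 volume), e2, e3, hM]
  refine Lp.ext ?_
  filter_upwards [cutoff_freeRes_coe ρ z (h.toLp 2 volume), mulComp_coe ρ (φ.toLp 2 volume),
    φ.coeFn_toLp 2 volume] with x h1 h2 h3
  rw [h1, h2, h3, ← e4, freeSol, kconv_congr e1, kconv_congr e1]
  rfl

theorem exists_testFunction_eq_one (r : ℝ) : ∃ ρ : 𝓓((⊤ : Opens E3), ℂ),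
    ∀ x ∈ Metric.closedBall (0 : E3) r, ρ x = 1 := by
  let b : ContDiffBump (0 : E3) := ⟨|r| + 1, |r| + 2, by positivity, by linarith⟩
  refine ⟨⟨fun x => (b x : ℂ), Complex.ofRealCLM.contDiff.comp b.contDiff,
    b.hasCompactSupport.comp_left (g := fun t : ℝ => (t : ℂ)) Complex.ofReal_zero,
    fun x _ => trivial⟩, fun x hx => ?_⟩
  change ((b x : ℝ) : ℂ) = 1
  rw [b.one_of_mem_closedBall, Complex.ofReal_one]
  refine Metric.closedBall_subset_closedBall ?_ hx
  change r ≤ |r| + 1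
  linarith [le_abs_self r]

/-- In the first quadrant, the resolvent has the integral kernel of `freeRes`. -/
theorem freeRes_eq_resolvent {z : ℂ} (hz : z ∈ quadrant) {A : L2 →L[ℂ] L2}
    (hA : ∀ f, Lp.toTemperedDistribution (A f) = fm (resMult z) (Lp.toTemperedDistribution f))
    (f : L2comp) :
    (freeRes z f : E3 →ₘ[volume] ℂ) = ((A (f : L2) : L2) : E3 →ₘ[volume] ℂ) := by
  obtain ⟨a, ha⟩ := exists_radius f
  have H : ∀ n : ℕ, ∀ᵐ x, x ∈ Metric.closedBall (0 : E3) n →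
      (freeRes z f : E3 →ₘ[volume] ℂ) x = (A (f : L2) : L2) x := by
    intro n
    obtain ⟨ρ, hρ⟩ := exists_testFunction_eq_one (max a n)
    have hf : mulComp ρ (f : L2) = f := by
      refine Subtype.ext (Lp.ext ?_)
      filter_upwards [mulComp_coe ρ (f : L2), ha] with x h1 h2
      rw [h1]
      by_cases hx : x ∈ Metric.closedBall (0 : E3) a
      · rw [hρ x (Metric.closedBall_subset_closedBall (le_max_left _ _) hx), one_mul]
      · rw [h2 hx, mul_zero]
    have h := cutoff_freeRes_eq hz hA ρ (f : L2)
    rw [hf] at h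
    have hL : cutoff ρ (freeRes z) (f : L2) = mulLoc ρ (freeRes z f) := by
      simp only [cutoff, LinearMap.comp_apply, hf]
    rw [hL] at h
    filter_upwards [mulLoc_coe ρ (freeRes z f), mulComp_coe ρ (A (f : L2))] with x h1 h2 hx
    rw [h, h2, hρ x (Metric.closedBall_subset_closedBall (le_max_right _ _) hx), one_mul,
      one_mul] at h1
    exact h1.symm
  refine AEEqFun.ext ?_
  filter_upwards [ae_all_iff.2 H] with x hx
  obtain ⟨n, hn⟩ := exists_nat_ge ‖x‖
  exact hx n (by simpa using hn)

end Biharmonic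

end

theorem mainTheorem4 :
    ∃ R₀ : ℂ → L2 →L[ℂ] L2,
      (∀ z ∈ quadrant, IsResolvent H0 (z ^ 4) (R₀ z)) ∧
      (∀ z ∈ quadrant, ‖R₀ z‖ ≤ 1 / (‖z‖ ^ 2 * z.im * z.re)) ∧
      ∃ T : ℂ → L2comp →ₗ[ℂ] L2loc,
        (∀ z ∈ quadrant, ∀ f : L2comp,
          (T z f : E3 →ₘ[volume] ℂ) = ((R₀ z (f : L2) : L2) : E3 →ₘ[volume] ℂ)) ∧
        IsAnalyticFamily T {0}ᶜ ∧
        ∀ (ρ : 𝓓((⊤ : Opens E3), ℂ)) (R : ℝ), 0 < R → tsupport ρ ⊆ Metric.closedBall 0 R →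
          ∃ C : ℝ, 0 < C ∧ ∀ z : ℂ, z ≠ 0 → ∀ j : ℕ, j ≤ 4 → ∀ f : L2,
            sobolevENorm (openBall R) j (cutoff ρ (T z) f) ≤
              ENNReal.ofReal (C * (‖z‖ ^ (-2 : ℤ) * (1 + ‖z‖ ^ 2) ^ ((j : ℝ) / 2) *
                (Real.exp (2 * R * max (-z.im) 0) + Real.exp (2 * R * max (-z.re) 0)))) *
              eLpNorm f 2 (volume.restrict (Metric.ball 0 R)) := by
  classical
  choose! R₀ h1 h2 h3 using fun (z : ℂ) (hz : z ∈ quadrant) => exists_resolvent hz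
  exact ⟨R₀, h1, h2, freeRes, fun z hz f => freeRes_eq_resolvent hz (h3 z hz) f,
    isAnalyticFamily_freeRes, fun ρ R hR hs => exists_sobolevENorm_cutoff_freeRes_le ρ hR hs⟩
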